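/- Let $L\ge 1$, $\alpha>0$, and let $\rho$ be a probability law on $\mathbb{R}_+^L=[0,\infty)^L$, the law of a weight vector $\mathbf W=(W_1,\dots,W_L)$. Assume: (i) (Multivariate regular variation.) There are a regularly varying function $b$ of index $1/\alpha$ and a non-zero Borel measure $\nu$ on $\mathbb{R}_+^L\setminus\{\mathbf 0\}$, finite on sets bounded away from $\mathbf 0$, such that $t\,\mathbb{E} f(\mathbf W/b(t))\to\int f\,d\nu$ as $t\to\infty$ for every bounded continuous $f\ge 0$ on $\mathbb{R}_+^L\setminus\{\mathbf 0\}$ whose support is bounded away from $\mathbf 0$. (ii) Every marginal tail $x\mapsto\mathbb{P}(W_l>x)$ is regularly varying with index $-\alpha$. Let $\mathbf W_1,\mathbf W_2,\dots$ be i.i.d. with law $\rho$, $\mathbf W_i=(W_{i1},\dots,W_{iL})$, and $T_l(N)=\sum_{i=1}^N W_{il}$. For each $N$ let $(A_{ijl})_{i,j\le N,\,l\le L}$ be symmetric in $(i,j)$ and, conditionally on $\mathbf W_1,\dots,\mathbf W_N$, let the $A_{ijl}$ with $i\le j$ be independent and Poisson with parameter $g_l\big(W_{il}W_{jl}/T_l(N)\big)$.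 The connection functions $g_l:[0,\infty)\to[0,\infty)$ are measurable with $\sup_{x>0}g_l(x)/x<\infty$ and $\lim_{x\downarrow0}g_l(x)/x=1$; if $\alpha\le 1$, they are also concave (for instance $g_l(x)=x$, $1-e^{-x}$, $\min(x,1)$, $x/(1+x)$). Let $D_{il}(N)=\sum_{j=1}^N A_{ijl}$, and let $(t_N)$ be a sequence of positive integers with $t_N\to\infty$ and $t_N/N\to0$. Let $\hat u_{l,N}=\inf\{x: \hat G_{l,N}(x)\ge 1-t_N/N\}$ with $\hat G_{l,N}(x)=\frac1N\#\{i\le N: D_{il}(N)\le x\}$. For two layers $s,m$ put $$\hat\lambda^{s,m}_{D(N)}=\frac{\#\{i\le N: D_{is}(N)>\hat u_{s,N},\ D_{im}(N)>\hat u_{m,N}\}}{\#\{i\le N: D_{is}(N)>\hat u_{s,N}\}}\qquad(0/0:=0).$$ Let $F_l$ be the distribution function of $W_l$, let $F_l^{-1}(q)=\inf\{x:F_l(x)\ge q\}$, and let $$\lambda_U^{s,m}=\lim_{q\to1^-}\mathbb{P}\big(W_m>F_m^{-1}(q)\,\big|\,W_s>F_s^{-1}(q)\big)$$ be the upper tail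 dependence coefficient, when this limit exists. Let $C_{s,m}$ be a copula of $(W_s,W_m)$, i.e. $\mathbb{P}(W_s\le x,W_m\le y)=C_{s,m}(F_s(x),F_m(y))$ for all $x,y$. Then: 1. $\lambda_U^{s,m}$ exists if and only if $\lim_{q\to1^-}\frac{1-2q+C_{s,m}(q,q)}{1-q}$ exists; in that case the two are equal and, as $N\to\infty$, $$\hat\lambda^{s,m}_{D(N)}\stackrel{p}{\longrightarrow}\lambda_U^{s,m}=\lim_{q\to1^-}\frac{1-2q+C_{s,m}(q,q)}{1-q}.$$ 2. The limit $\lambda_U^{s,m}$ exists whenever $\nu\{x:x_s>1\}>0$ and $\nu\{x:x_m>1\}>0$. 3. If $C_{s,m}$ is the Gumbel copula $C_\theta(u,v)=\exp\big(-((-\ln u)^{\theta}+(-\ln v)^{\theta})^{1/\theta}\big)$ with $\theta=\theta_{s,m}\ge1$, then $\lambda_U^{s,m}$ exists and $\hat\lambda^{s,m}_{D(N)}\stackrel{p}{\longrightarrow}\lambda_U^{s,m}=2-2^{1/\theta_{s,m}}$. -/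

import Mathlib

open MeasureTheory ProbabilityTheory Filter Topology
open scoped NNReal ENNReal

noncomputable section

/-- `f : ℝ₊ → ℝ₊` is regularly varying (at infinity) with index `r`. -/
structure IsRegularlyVarying (f : ℝ≥0 → ℝ≥0) (r : ℝ) : Prop where
  measurable : Measurable f
  eventually_pos : ∀ᶠ t in atTop, 0 < f t
  tendsto : ∀ x : ℝ≥0, 0 < x → Tendsto (fun t => f (t * x) / f t) atTop (𝓝 (x ^ r))

/-- The class `𝕄(ℝ₊ᴸ ∖ {0})`: Borel measures on `ℝ₊ᴸ ∖ {0}` (seen as measures on `ℝ₊ᴸ` without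
mass at the origin) that are finite on sets bounded away from the origin. -/
structure IsMMeasure {L : ℕ} (ν : Measure (Fin L → ℝ≥0)) : Prop where
  zero : ν {0} = 0
  finite_away : ∀ ε : ℝ, 0 < ε → ν {x | ε ≤ dist x 0} < ∞

/-- The test functions of `𝕄`-convergence: nonnegative, bounded, continuous on `ℝ₊ᴸ ∖ {0}`, with
support bounded away from the origin. -/
structure IsMTest {L : ℕ} (f : (Fin L → ℝ≥0) → ℝ≥0) : Prop where
  continuousOn : ContinuousOn f {0}ᶜ
  bounded : ∃ K : ℝ≥0, ∀ x, f x ≤ K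
  away : ∃ ε : ℝ, 0 < ε ∧ ∀ x, f x ≠ 0 → ε ≤ dist x 0

/-- Multivariate regular variation `MRV(α, b, ν, ℝ₊ᴸ ∖ {0})` of a law `ρ` on `ℝ₊ᴸ`:
`t · P(Z / b(t) ∈ ·) → ν` in `𝕄(ℝ₊ᴸ ∖ {0})` as `t → ∞`, with `ν` not the zero measure. -/
structure IsMRV {L : ℕ} (ρ : Measure (Fin L → ℝ≥0)) (α : ℝ) (b : ℝ≥0 → ℝ≥0)
    (ν : Measure (Fin L → ℝ≥0)) : Prop where
  scaling : IsRegularlyVarying b (1 / α)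
  limit : IsMMeasure ν
  nonzero : ν ≠ 0
  tendsto : ∀ f : (Fin L → ℝ≥0) → ℝ≥0, IsMTest f →
    Tendsto (fun t : ℝ≥0 => (t : ℝ≥0∞) * ∫⁻ z, (f (fun l => z l / b t) : ℝ≥0∞) ∂ρ) atTop
      (𝓝 (∫⁻ x, (f x : ℝ≥0∞) ∂ν))

/-- The tail function `x ↦ P(W_l > x)` of the `l`-th coordinate. -/
def marginalTail {L : ℕ} (ρ : Measure (Fin L → ℝ≥0)) (l : Fin L) (x : ℝ≥0) : ℝ≥0 :=
  (ρ {w | x < w l}).toNNReal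

/-- The distribution function `F_l` of the `l`-th coordinate. -/
def marginalCDF {L : ℕ} (ρ : Measure (Fin L → ℝ≥0)) (l : Fin L) (x : ℝ) : ℝ :=
  cdf (ρ.map (fun w => (w l : ℝ))) x

/-- The generalized inverse `F⁻¹(q) = inf {x : q ≤ F(x)}`. -/
def quantile (F : ℝ → ℝ) (q : ℝ) : ℝ := sInf {x : ℝ | q ≤ F x}

/-- `λ(q) = P(W_m > F_m⁻¹(q) | W_s > F_s⁻¹(q))`. -/
def utd {L : ℕ} (ρ : Measure (Fin L → ℝ≥0)) (s m : Fin L) (q : ℝ) : ℝ :=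
  (ProbabilityTheory.cond ρ {w | quantile (marginalCDF ρ s) q < (w s : ℝ)}).real
    {w | quantile (marginalCDF ρ m) q < (w m : ℝ)}

/-- `lam` is the upper tail dependence coefficient of the coordinates `s` and `m`. -/
def IsUTDCoeff {L : ℕ} (ρ : Measure (Fin L → ℝ≥0)) (s m : Fin L) (lam : ℝ) : Prop :=
  Tendsto (utd ρ s m) (𝓝[<] 1) (𝓝 lam)

/-- `C` restricted to `[0,1]²` is a bivariate copula. -/
structure IsCopula (C : ℝ → ℝ → ℝ) : Prop where
  zero_left : ∀ v ∈ Set.Icc (0 : ℝ) 1, C 0 v = 0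
  zero_right : ∀ u ∈ Set.Icc (0 : ℝ) 1, C u 0 = 0
  one_left : ∀ v ∈ Set.Icc (0 : ℝ) 1, C 1 v = v
  one_right : ∀ u ∈ Set.Icc (0 : ℝ) 1, C u 1 = u
  two_increasing : ∀ u ∈ Set.Icc (0 : ℝ) 1, ∀ u' ∈ Set.Icc (0 : ℝ) 1,
    ∀ v ∈ Set.Icc (0 : ℝ) 1, ∀ v' ∈ Set.Icc (0 : ℝ) 1, u ≤ u' → v ≤ v' →
      0 ≤ C u' v' - C u' v - C u v' + C u v

/-- `C` is a copula of the coordinates `s` and `m`: `P(W_s ≤ x, W_m ≤ y) = C(F_s(x), F_m(y))`. -/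
structure IsPairCopula {L : ℕ} (ρ : Measure (Fin L → ℝ≥0)) (s m : Fin L) (C : ℝ → ℝ → ℝ) :
    Prop where
  copula : IsCopula C
  sklar : ∀ x y : ℝ, ρ.real {w | (w s : ℝ) ≤ x ∧ (w m : ℝ) ≤ y} =
    C (marginalCDF ρ s x) (marginalCDF ρ m y)

/-- The bivariate Gumbel copula on `[0,1]²`; it vanishes where a coordinate is `0`, by the
convention `-ln 0 = ∞`. -/
def gumbel (θ : ℝ) (u v : ℝ) : ℝ :=
  if u = 0 ∨ v = 0 then 0
  else Real.exp (-(((-Real.log u) ^ θ + (-Real.log v) ^ θ) ^ (1 / θ)))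

/-- Connection functions: `g(x) = O(x)` on `ℝ₊` and `g(x) ~ x` at the origin; in the heavy regime
`α ≤ 1` also concave. -/
structure IsConnectionFun (α : ℝ) (g : ℝ≥0 → ℝ≥0) : Prop where
  measurable : Measurable g
  linear_bound : ∃ K : ℝ≥0, ∀ x, g x ≤ K * x
  tendsto_one : Tendsto (fun x => g x / x) (𝓝[>] 0) (𝓝 1)
  concave : α ≤ 1 → ConcaveOn ℝ≥0 Set.univ g

/-- The Poisson parameter `g_l(W_il W_jl / T_l(N))`, where `T_l(N) = ∑ᵢ W_il`. -/
def edgeRate {L N : ℕ} (g : Fin L → ℝ≥0 → ℝ≥0) (w : Fin N → Fin L → ℝ≥0) (i j : Fin N)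
    (l : Fin L) : ℝ≥0 :=
  g l (w i l * w j l / ∑ k, w k l)

/-- `A` is the adjacency tensor of the `L`-layer inhomogeneous random graph on `N` nodes with
weights `W`: it is symmetric in each layer and, conditionally on `W`, the entries `A_ijl` with
`i ≤ j` are independent with Poisson laws of parameters `edgeRate g W i j l`. The conditional law
is expressed by the joint law of `(A, W)`. -/
structure IsMIRG {Ω : Type*} [MeasurableSpace Ω] (μ : Measure Ω) {L N : ℕ}
    (g : Fin L → ℝ≥0 → ℝ≥0) (W : Fin N → Ω → Fin L → ℝ≥0)
    (A : Fin N → Fin N → Fin L → Ω → ℕ) : Prop where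
  measurable : ∀ i j l, Measurable (A i j l)
  symm : ∀ i j l ω, A i j l ω = A j i l ω
  cond_law : ∀ B : Set (Fin N → Fin L → ℝ≥0), MeasurableSet B →
    ∀ k : Fin N → Fin N → Fin L → ℕ,
      μ {ω | (fun i => W i ω) ∈ B ∧ ∀ i j l, i ≤ j → A i j l ω = k i j l} =
        ∫⁻ ω in {ω | (fun i => W i ω) ∈ B},
          ∏ i, ∏ j ∈ Finset.univ.filter (fun j => i ≤ j), ∏ l,
            poissonMeasure (edgeRate g (fun i => W i ω) i j l) {k i j l} ∂μ

/-- The degree `D_il(N) = ∑ⱼ A_ijl`. -/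
def degree {L N : ℕ} (a : Fin N → Fin N → Fin L → ℕ) (i : Fin N) (l : Fin L) : ℕ :=
  ∑ j, a i j l

/-- The empirical distribution function of the degrees in layer `l`. -/
def empiricalCDF {L N : ℕ} (a : Fin N → Fin N → Fin L → ℕ) (l : Fin L) (x : ℝ) : ℝ :=
  ((Finset.univ.filter (fun i => (degree a i l : ℝ) ≤ x)).card : ℝ) / N

/-- The empirical `(1 - t/N)`-quantile of the degrees in layer `l`. -/
def degreeThreshold {L N : ℕ} (a : Fin N → Fin N → Fin L → ℕ) (t : ℕ) (l : Fin L) : ℝ :=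
  quantile (empiricalCDF a l) (1 - (t : ℝ) / N)

/-- The degree-based estimator of the upper tail dependence coefficient of layers `s` and `m`. -/
def utdEstimator {L N : ℕ} (a : Fin N → Fin N → Fin L → ℕ) (t : ℕ) (s m : Fin L) : ℝ :=
  ((Finset.univ.filter (fun i => degreeThreshold a t s < (degree a i s : ℝ) ∧
      degreeThreshold a t m < (degree a i m : ℝ))).card : ℝ) /
    ((Finset.univ.filter (fun i => degreeThreshold a t s < (degree a i s : ℝ))).card : ℝ)

end

/-! Fix a layer. Given the weights, the degree of node `i` is Poisson with mean `m_i`, a function of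
the weights, so large degrees should belong to large weights. With `u₀` the `(1 - t/N)`-quantile of
the weight, the core is `tendsto_measure_symmDiff`: the nodes above the empirical degree threshold
and the nodes of weight above `u₀` differ in `o(t)` nodes. Applied in both layers, this reduces the
estimator to counts of i.i.d. weights. These concentrate by Chebyshev (`tendsto_measure_count`), and
their ratio tends to the tail dependence coefficient.

For the core one seeks a level `κ`, depending on the weights, such that nodes of weight at most `u =
(1+δ)u₀` have mean at most `κ/(1+c)` and nodes of weight above `(1+δ)u` have mean at least `κ(1+c)`.
Chernoff bounds then make a node misclassified with probability `exp(-const·κ)`. As `κ ≥ a u^β`,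
while the tail at `u` is at least polynomially small and of order `t/N`, only `o(t)` nodes are
misclassified (`tendsto_mul_exp_neg`). About `(1+δ)^(-α) t < t` weights exceed `u`, so the degree
threshold is at most `κ`; the rest is counting (`card_symmDiff_le`).

The existence of `κ` is `exists_separation`. If the weights have finite mean, then `T ~ N·E W` and
the largest weight is `o(N)`, so `m_i ≈ W_i` uniformly. If the mean is infinite, then `α ≤ 1` and
`g` is concave. Here `m_i = S(W_i/T)` with `S(y) = ∑ⱼ g(y Wⱼ)`, and `S(sy)` must exceed `S(y)` by a
fixed factor. In expectation this follows from a layer-cake formula and the growth of the tail under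
shrinking of its argument (`exists_sensitivity`). For the random sum one uses Chebyshev on truncated
increments, at finitely many geometric grid points covering the likely values of `u/T`. The scale
`τ` of `T` is defined by `N·E min(W/τ, 1) ≈ 1`.

The copula formula holds because the tail at the quantile is `(1-q)(1+o(1))`, even with atoms, and a
copula is monotone and Lipschitz. For the existence of the coefficient, multivariate regular
variation makes rescaled joint tails converge (`exists_tendsto_jointTail`), and joint tails are
insensitive to thresholds with asymptotically equal marginal tails (`abs_jointTail_sub_le`). The
Gumbel value is a derivative at `q = 1`. -/

/-! ### Exponential moments of Poisson laws. -/

lemma poissonMeasure_integrable_exp (r : ℝ≥0) (s : ℝ) :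
    Integrable (fun n : ℕ => Real.exp (s * n)) (poissonMeasure r) := by
  rw [integrable_poissonMeasure_iff]
  have h := (NormedSpace.expSeries_div_hasSum_exp ((r : ℝ) * Real.exp s)).summable.mul_left
    (Real.exp (-r))
  refine h.congr fun n => ?_
  rw [Real.norm_of_nonneg (Real.exp_pos _).le, mul_pow, ← Real.exp_nat_mul, mul_comm (n : ℝ) s]
  ring

lemma mgf_poissonMeasure (r : ℝ≥0) (s : ℝ) :
    mgf (fun n : ℕ => (n : ℝ)) (poissonMeasure r) s = Real.exp (r * (Real.exp s - 1)) := by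
  have h := (NormedSpace.expSeries_div_hasSum_exp ((r : ℝ) * Real.exp s)).mul_left
    (Real.exp (-r))
  rw [mgf, integral_poissonMeasure]
  rw [← Real.exp_eq_exp_ℝ, ← Real.exp_add] at h
  rw [show (r : ℝ) * (Real.exp s - 1) = -r + r * Real.exp s by ring, ← h.tsum_eq]
  congr with n
  rw [mul_pow, ← Real.exp_nat_mul, mul_comm (n : ℝ) s, smul_eq_mul]
  ring

/-! ### Edges and degrees conditionally on the weights; Chernoff bounds. -/

section Graph

variable {L N : ℕ}

/-- The edge slots `(i, j, l)` with `i ≤ j`. -/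
abbrev EdgeSlot (N L : ℕ) := {p : Fin N × Fin N × Fin L // p.1 ≤ p.2.1}

/-- The slot of the pair `{i, j}` in layer `l`. -/
def edgeSlot (i : Fin N) (l : Fin L) (j : Fin N) : EdgeSlot N L :=
  ⟨(min i j, max i j, l), min_le_max⟩

/-- This makes a degree a sum over distinct, hence independent, coordinates; the self-loop counts
once. -/
lemma edgeSlot_injective (i : Fin N) (l : Fin L) : Function.Injective (edgeSlot i l) := by
  intro j j' h
  simp only [edgeSlot, Subtype.mk.injEq, Prod.mk.injEq, and_true] at h
  obtain ⟨h1, h2⟩ := h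
  simp only [Fin.ext_iff, Fin.coe_min, Fin.coe_max] at *
  omega

/-- The degree read off the slots. -/
def slotDegree (i : Fin N) (l : Fin L) (k : EdgeSlot N L → ℕ) : ℕ := ∑ j, k (edgeSlot i l j)

/-- The law of independent Poisson multi-edges given weights `w`. -/
noncomputable def edgeLaw (g : Fin L → ℝ≥0 → ℝ≥0) (w : Fin N → Fin L → ℝ≥0) :
    Measure (EdgeSlot N L → ℕ) :=
  Measure.pi fun p => poissonMeasure (edgeRate g w p.1.1 p.1.2.1 p.1.2.2)

instance (g : Fin L → ℝ≥0 → ℝ≥0) (w : Fin N → Fin L → ℝ≥0) :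
    IsProbabilityMeasure (edgeLaw g w) := by
  unfold edgeLaw; infer_instance

/-- The conditional mean of the degree given the weights. -/
noncomputable def meanDegree (g : Fin L → ℝ≥0 → ℝ≥0) (w : Fin N → Fin L → ℝ≥0) (i : Fin N)
    (l : Fin L) : ℝ := ∑ j, (edgeRate g w i j l : ℝ)

lemma edgeRate_comm (g : Fin L → ℝ≥0 → ℝ≥0) (w : Fin N → Fin L → ℝ≥0) (i j : Fin N)
    (l : Fin L) : edgeRate g w i j l = edgeRate g w j i l := by
  simp only [edgeRate, mul_comm (w i l)]

lemma edgeRate_edgeSlot (g : Fin L → ℝ≥0 → ℝ≥0) (w : Fin N → Fin L → ℝ≥0) (i j : Fin N)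
    (l : Fin L) : edgeRate g w (edgeSlot i l j).1.1 (edgeSlot i l j).1.2.1
      (edgeSlot i l j).1.2.2 = edgeRate g w i j l := by
  rcases le_total i j with h | h
  · simp [edgeSlot, h]
  · simp [edgeSlot, h, edgeRate_comm g w i j l]

/-- A sum of independent Poisson variables. Only exponential moments enter the Chernoff bounds, so
the law of the degree itself is never identified. -/
lemma mgf_slotDegree (g : Fin L → ℝ≥0 → ℝ≥0) (w : Fin N → Fin L → ℝ≥0) (i : Fin N) (l : Fin L)
    (s : ℝ) : mgf (fun k => (slotDegree i l k : ℝ)) (edgeLaw g w) s =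
      Real.exp (meanDegree g w i l * (Real.exp s - 1)) ∧
      Integrable (fun k => Real.exp (s * (slotDegree i l k : ℝ))) (edgeLaw g w) := by
  have hind : iIndepFun (fun (p : EdgeSlot N L) (k : EdgeSlot N L → ℕ) => (k p : ℝ))
      (edgeLaw g w) :=
    iIndepFun_pi (μ := fun p : EdgeSlot N L =>
      poissonMeasure (edgeRate g w p.1.1 p.1.2.1 p.1.2.2))
      (X := fun _ (n : ℕ) => (n : ℝ)) (fun _ => Measurable.aemeasurable (by fun_prop))
  have hind2 := hind.precomp (edgeSlot_injective i l)
  have hmp : ∀ p : EdgeSlot N L, MeasurePreserving (Function.eval p) (edgeLaw g w)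
      (poissonMeasure (edgeRate g w p.1.1 p.1.2.1 p.1.2.2)) := fun p =>
    measurePreserving_eval _ p
  have hm : ∀ p : EdgeSlot N L, mgf (fun k : EdgeSlot N L → ℕ => (k p : ℝ)) (edgeLaw g w) s =
      Real.exp (edgeRate g w p.1.1 p.1.2.1 p.1.2.2 * (Real.exp s - 1)) := by
    intro p
    rw [← mgf_poissonMeasure, ← (hmp p).map_eq, mgf_map (hmp p).measurable.aemeasurable]
    · rfl
    · exact Measurable.aestronglyMeasurable (by fun_prop)
  have hi : ∀ p : EdgeSlot N L,
      Integrable (fun k : EdgeSlot N L → ℕ => Real.exp (s * (k p : ℝ))) (edgeLaw g w) := by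
    intro p
    exact (hmp p).integrable_comp_of_integrable (poissonMeasure_integrable_exp _ s)
  have e : (fun k : EdgeSlot N L → ℕ => (slotDegree i l k : ℝ)) =
      ∑ j, fun k : EdgeSlot N L → ℕ => (k (edgeSlot i l j) : ℝ) := by
    ext k; simp [slotDegree]
  constructor
  · rw [e, hind2.mgf_sum (fun j => Measurable.comp (by fun_prop) (measurable_pi_apply _))]
    simp only [hm, edgeRate_edgeSlot]
    rw [← Real.exp_sum, meanDegree, Finset.sum_mul]
  · have := hind2.integrable_exp_mul_sum (s := Finset.univ) (t := s)
      (fun j => Measurable.comp (by fun_prop) (measurable_pi_apply _)) (fun j _ => hi _)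
    simpa [slotDegree, Function.comp_def] using this

/-- Chernoff bound at exponent `log (1 + c)`, the optimal one when the mean equals `κ / (1 + c)`. -/
lemma edgeLaw_slotDegree_ge_le (g : Fin L → ℝ≥0 → ℝ≥0) (w : Fin N → Fin L → ℝ≥0) (i : Fin N)
    (l : Fin L) {c κ : ℝ} (hc : 0 < c) (h : meanDegree g w i l * (1 + c) ≤ κ) :
    (edgeLaw g w).real {k | κ ≤ (slotDegree i l k : ℝ)} ≤
      Real.exp (-(κ * (Real.log (1 + c) - c / (1 + c)))) := by
  obtain ⟨h1, h2⟩ := mgf_slotDegree g w i l (Real.log (1 + c))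
  refine (measure_ge_le_exp_mul_mgf κ (Real.log_nonneg (by linarith)) h2).trans ?_
  rw [h1, ← Real.exp_add, Real.exp_le_exp, Real.exp_log (by linarith)]
  have : meanDegree g w i l * c ≤ κ * (c / (1 + c)) := by
    rw [mul_div_assoc', le_div_iff₀ (by linarith)]
    nlinarith
  nlinarith

/-- Chernoff bound at exponent `-log (1 + c)`, the optimal one when the mean equals `κ (1 + c)`. -/
lemma edgeLaw_slotDegree_le_le (g : Fin L → ℝ≥0 → ℝ≥0) (w : Fin N → Fin L → ℝ≥0) (i : Fin N)
    (l : Fin L) {c κ : ℝ} (hc : 0 < c) (h : κ * (1 + c) ≤ meanDegree g w i l) :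
    (edgeLaw g w).real {k | (slotDegree i l k : ℝ) ≤ κ} ≤
      Real.exp (-(κ * (c - Real.log (1 + c)))) := by
  obtain ⟨h1, h2⟩ := mgf_slotDegree g w i l (-Real.log (1 + c))
  refine (measure_le_le_exp_mul_mgf κ
    (neg_nonpos.2 (Real.log_nonneg (by linarith))) h2).trans ?_
  rw [h1, ← Real.exp_add, Real.exp_le_exp, Real.exp_neg, Real.exp_log (by linarith)]
  have : (1 + c)⁻¹ - 1 = - (c / (1 + c)) := by field_simp; ring
  rw [this]
  have : κ * c ≤ meanDegree g w i l * (c / (1 + c)) := by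
    rw [mul_div_assoc', le_div_iff₀ (by linarith)]
    nlinarith
  nlinarith

lemma measurable_edgeRate {g : Fin L → ℝ≥0 → ℝ≥0} (hg : ∀ l, Measurable (g l)) (i j : Fin N)
    (l : Fin L) : Measurable fun w : Fin N → Fin L → ℝ≥0 => edgeRate g w i j l := by
  unfold edgeRate
  exact (hg l).comp (by fun_prop)

lemma measurable_meanDegree {g : Fin L → ℝ≥0 → ℝ≥0} (hg : ∀ l, Measurable (g l)) (i : Fin N)
    (l : Fin L) : Measurable fun w : Fin N → Fin L → ℝ≥0 => meanDegree g w i l := by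
  unfold meanDegree
  exact Finset.measurable_fun_sum _ fun j _ => (measurable_edgeRate hg i j l).coe_nnreal_real

lemma measurable_poissonMeasure_singleton (n : ℕ) :
    Measurable fun r : ℝ≥0 => poissonMeasure r {n} := by
  simp only [poissonMeasure_singleton]
  fun_prop

/-- Matches the nested product of `IsMIRG.cond_law` with a product measure. Atoms suffice, since
slot configurations form a countable space. -/
lemma edgeLaw_singleton (g : Fin L → ℝ≥0 → ℝ≥0) (w : Fin N → Fin L → ℝ≥0)
    (k : Fin N → Fin N → Fin L → ℕ) :
    edgeLaw g w {fun p => k p.1.1 p.1.2.1 p.1.2.2} =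
      ∏ i, ∏ j ∈ Finset.univ.filter (fun j => i ≤ j), ∏ l,
        poissonMeasure (edgeRate g w i j l) {k i j l} := by
  rw [edgeLaw, Measure.pi_singleton]
  rw [← Finset.prod_subtype (Finset.univ.filter fun p : Fin N × Fin N × Fin L => p.1 ≤ p.2.1)
    (by simp) (fun p : Fin N × Fin N × Fin L =>
      poissonMeasure (edgeRate g w p.1 p.2.1 p.2.2) {k p.1 p.2.1 p.2.2})]
  simp only [Finset.prod_filter]
  rw [Fintype.prod_prod_type]
  refine Finset.prod_congr rfl fun i _ => ?_
  rw [Fintype.prod_prod_type]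
  refine Finset.prod_congr rfl fun j _ => ?_
  by_cases h : i ≤ j <;> simp [h]

variable {Ω : Type*} [MeasurableSpace Ω] {μ : Measure Ω}
  {g : Fin L → ℝ≥0 → ℝ≥0} {W : Fin N → Ω → Fin L → ℝ≥0} {A : Fin N → Fin N → Fin L → Ω → ℕ}

/-- Conditional probability bound: events about the edges whose conditional probability is at most
`c` on a set `B` of weights. -/
lemma IsMIRG.measure_le [IsProbabilityMeasure μ] (hA : IsMIRG μ g W A) (hg : ∀ l, Measurable (g l))
    (hW : ∀ i, Measurable (W i)) {B : Set (Fin N → Fin L → ℝ≥0)} (hB : MeasurableSet B)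
    (S : (Fin N → Fin L → ℝ≥0) → Set (EdgeSlot N L → ℕ))
    (hS : ∀ k, MeasurableSet {w | k ∈ S w}) (c : ℝ≥0∞) (hc : ∀ w ∈ B, edgeLaw g w (S w) ≤ c) :
    μ {ω | (fun i => W i ω) ∈ B ∧
      (fun p : EdgeSlot N L => A p.1.1 p.1.2.1 p.1.2.2 ω) ∈ S (fun i => W i ω)} ≤ c := by
  have hWm : Measurable fun ω => fun i => W i ω := measurable_pi_lambda _ hW
  -- The conditional law is given on atoms, so the event is split over the configurations `k`; the
  -- condition `k ∈ S w` concerns the weights alone and joins `B`.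
  have hcount : ∀ k : EdgeSlot N L → ℕ,
      μ {ω | (fun i => W i ω) ∈ B ∩ {w | k ∈ S w} ∧
        ∀ p : EdgeSlot N L, A p.1.1 p.1.2.1 p.1.2.2 ω = k p} =
      ∫⁻ ω in {ω | (fun i => W i ω) ∈ B},
        (S (fun i => W i ω)).indicator (fun k => edgeLaw g (fun i => W i ω) {k}) k ∂μ := by
    intro k
    -- `cond_law` asks for a full tensor; its entries with `i > j` play no role.
    let k' : Fin N → Fin N → Fin L → ℕ := fun i j l =>
      if h : i ≤ j then k ⟨(i, j, l), h⟩ else 0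
    have hk : (fun p : EdgeSlot N L => k' p.1.1 p.1.2.1 p.1.2.2) = k := by
      ext ⟨⟨i, j, l⟩, h⟩
      simp only [k', h, dite_true]
    have hset : {ω | (fun i => W i ω) ∈ B ∩ {w | k ∈ S w} ∧
        ∀ p : EdgeSlot N L, A p.1.1 p.1.2.1 p.1.2.2 ω = k p} =
        {ω | (fun i => W i ω) ∈ B ∩ {w | k ∈ S w} ∧
        ∀ i j l, i ≤ j → A i j l ω = k' i j l} := by
      ext ω
      simp only [Set.mem_ofPred_eq, and_congr_right_iff]
      intro _
      constructor
      · intro h i j l hij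
        simp only [k', hij, dite_true]
        exact h ⟨(i, j, l), hij⟩
      · rintro h ⟨⟨i, j, l⟩, hij⟩
        have := h i j l hij
        simpa only [k', show i ≤ j from hij, dite_true] using this
    rw [hset, hA.cond_law _ (hB.inter (hS k)) k']
    simp only [← edgeLaw_singleton, hk]
    have hm1 : MeasurableSet {ω | (fun i => W i ω) ∈ B} := hWm hB
    have hm2 : MeasurableSet {ω | k ∈ S (fun i => W i ω)} := hWm (hS k)
    rw [show {ω | (fun i => W i ω) ∈ B ∩ {w | k ∈ S w}} =
      {ω | k ∈ S (fun i => W i ω)} ∩ {ω | (fun i => W i ω) ∈ B} by ext; simp [and_comm]]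
    rw [← Measure.restrict_restrict hm2, ← lintegral_indicator hm2]
    rfl
  calc _ ≤ μ (⋃ k : EdgeSlot N L → ℕ, {ω | (fun i => W i ω) ∈ B ∩ {w | k ∈ S w} ∧
        ∀ p : EdgeSlot N L, A p.1.1 p.1.2.1 p.1.2.2 ω = k p}) := by
        refine measure_mono fun ω hω => ?_
        simp only [Set.mem_iUnion]
        exact ⟨_, ⟨hω.1, hω.2⟩, fun p => rfl⟩
    _ ≤ ∑' k : EdgeSlot N L → ℕ, μ {ω | (fun i => W i ω) ∈ B ∩ {w | k ∈ S w} ∧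
        ∀ p : EdgeSlot N L, A p.1.1 p.1.2.1 p.1.2.2 ω = k p} := measure_iUnion_le _
    _ = ∫⁻ ω in {ω | (fun i => W i ω) ∈ B}, ∑' k : EdgeSlot N L → ℕ,
        (S (fun i => W i ω)).indicator (fun k => edgeLaw g (fun i => W i ω) {k}) k ∂μ := by
        rw [lintegral_tsum]
        · simp only [hcount]
        · intro k
          have : (fun ω => (S (fun i => W i ω)).indicator
              (fun k => edgeLaw g (fun i => W i ω) {k}) k) =
              {ω | k ∈ S (fun i => W i ω)}.indicator
                fun ω => edgeLaw g (fun i => W i ω) {k} := rfl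
          rw [this]
          refine (Measurable.indicator ?_ (hWm (hS k))).aemeasurable
          simp only [edgeLaw, Measure.pi_singleton]
          refine Finset.measurable_fun_prod _ fun p _ => ?_
          exact (measurable_poissonMeasure_singleton _).comp
            ((measurable_edgeRate hg _ _ _).comp hWm)
    _ = ∫⁻ ω in {ω | (fun i => W i ω) ∈ B}, edgeLaw g (fun i => W i ω) (S (fun i => W i ω)) ∂μ := by
        refine lintegral_congr fun ω => ?_
        exact Measure.tsum_indicator_apply_singleton _ _ (Set.to_countable _).measurableSet
    _ ≤ ∫⁻ ω in {ω | (fun i => W i ω) ∈ B}, c ∂μ :=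
        setLIntegral_mono' (hWm hB) fun ω hω => hc _ hω
    _ ≤ c := by
        rw [setLIntegral_const]
        exact mul_le_of_le_one_right zero_le prob_le_one

lemma IsMIRG.degree_eq (hA : IsMIRG μ g W A) (i : Fin N) (l : Fin L) (ω : Ω) :
    degree (fun i j l => A i j l ω) i l =
      slotDegree i l (fun p : EdgeSlot N L => A p.1.1 p.1.2.1 p.1.2.2 ω) := by
  unfold degree slotDegree
  refine Finset.sum_congr rfl fun j _ => ?_
  rcases le_total i j with h | h
  · simp [edgeSlot, h]
  · simp [edgeSlot, h, hA.symm i j l ω]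

/-- A common exponential rate for both tails of a Poisson law at relative distance `c`. -/
noncomputable def poissonRate (c : ℝ) : ℝ :=
  min (Real.log (1 + c) - c / (1 + c)) (c - Real.log (1 + c))

lemma poissonRate_pos {c : ℝ} (hc : 0 < c) : 0 < poissonRate c := by
  refine lt_min ?_ ?_
  · have h1 : Real.log (1 + c)⁻¹ < (1 + c)⁻¹ - 1 :=
      Real.log_lt_sub_one_of_pos (by positivity) (by
        intro h; rw [inv_eq_one] at h; linarith)
    rw [Real.log_inv] at h1
    have : (1 + c)⁻¹ - 1 = - (c / (1 + c)) := by field_simp; ring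
    linarith
  · have := Real.log_lt_sub_one_of_pos (show (0 : ℝ) < 1 + c by linarith) (by linarith)
    linarith

/-- Separation of the conditional mean degrees from a threshold `κ` by the weights of layer `l`:
nodes of weight at most `u` have mean well below `κ`, nodes of weight above `v` well above. -/
def IsSeparated (g : Fin L → ℝ≥0 → ℝ≥0) (l : Fin L) (u v c kmin : ℝ) (κ : ℝ)
    (w : Fin N → Fin L → ℝ≥0) : Prop :=
  kmin ≤ κ ∧ ∀ i, ((w i l : ℝ) ≤ u → meanDegree g w i l * (1 + c) ≤ κ) ∧
    (v < (w i l : ℝ) → κ * (1 + c) ≤ meanDegree g w i l)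

/-- A node is misclassified when its degree and its weight disagree. -/
def IsMisclassified (l : Fin L) (u v κ : ℝ) (w : Fin N → Fin L → ℝ≥0)
    (a : Fin N → Fin N → Fin L → ℕ) (i : Fin N) : Prop :=
  ((w i l : ℝ) ≤ u ∧ κ < (degree a i l : ℝ)) ∨ (v < (w i l : ℝ) ∧ (degree a i l : ℝ) ≤ κ)

lemma measurableSet_isSeparated (hg : ∀ l, Measurable (g l)) (l : Fin L) (u v c kmin : ℝ)
    {κ : (Fin N → Fin L → ℝ≥0) → ℝ} (hκ : Measurable κ) :
    MeasurableSet {w | IsSeparated g l u v c kmin (κ w) w} := by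
  have hw : ∀ i : Fin N, Measurable fun w : Fin N → Fin L → ℝ≥0 => (w i l : ℝ) := fun i => by
    fun_prop
  have hm := fun i : Fin N => measurable_meanDegree (N := N) hg i l
  have e : {w | IsSeparated g l u v c kmin (κ w) w} = {w | kmin ≤ κ w} ∩
    ⋂ i, {w | ((w i l : ℝ) ≤ u → meanDegree g w i l * (1 + c) ≤ κ w)} ∩
      {w | (v < (w i l : ℝ) → κ w * (1 + c) ≤ meanDegree g w i l)} := by
    ext; simp [IsSeparated]
  rw [e]
  refine (measurableSet_le measurable_const hκ).inter ?_
  refine MeasurableSet.iInter fun i => MeasurableSet.inter ?_ ?_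
  · exact MeasurableSet.imp (measurableSet_le (hw i) measurable_const)
      (measurableSet_le ((hm i).mul_const _) hκ)
  · exact MeasurableSet.imp (measurableSet_lt measurable_const (hw i))
      (measurableSet_le (hκ.mul_const _) (hm i))

/-- On separating weights one of the two Chernoff bounds applies, with `κ ≥ kmin`; a node of weight
between `u` and `v` cannot be misclassified. -/
lemma IsMIRG.measure_isMisclassified_le [IsProbabilityMeasure μ] (hA : IsMIRG μ g W A) (hg : ∀ l, Measurable (g l))
    (hW : ∀ i, Measurable (W i)) (l : Fin L) {u v c kmin : ℝ} (hc : 0 < c) (huv : u ≤ v)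
    {κ : (Fin N → Fin L → ℝ≥0) → ℝ} (hκ : Measurable κ) (i : Fin N) :
    μ {ω | IsSeparated g l u v c kmin (κ fun i => W i ω) (fun i => W i ω) ∧
      IsMisclassified l u v (κ fun i => W i ω) (fun i => W i ω) (fun i j l => A i j l ω) i} ≤
      ENNReal.ofReal (Real.exp (-(kmin * poissonRate c))) := by
  let S : (Fin N → Fin L → ℝ≥0) → Set (EdgeSlot N L → ℕ) := fun w =>
    {k | ((w i l : ℝ) ≤ u ∧ κ w < (slotDegree i l k : ℝ)) ∨
      (v < (w i l : ℝ) ∧ (slotDegree i l k : ℝ) ≤ κ w)}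
  have hw : Measurable fun w : Fin N → Fin L → ℝ≥0 => (w i l : ℝ) := by fun_prop
  have hS : ∀ k, MeasurableSet {w | k ∈ S w} := fun k =>
    ((measurableSet_le hw measurable_const).inter (measurableSet_lt hκ measurable_const)).union
      ((measurableSet_lt measurable_const hw).inter (measurableSet_le measurable_const hκ))
  have key := hA.measure_le hg hW (measurableSet_isSeparated hg l u v c kmin hκ) S hS
    (ENNReal.ofReal (Real.exp (-(kmin * poissonRate c)))) ?_
  · refine (measure_mono ?_).trans key
    rintro ω ⟨h1, h2⟩
    refine ⟨h1, ?_⟩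
    simp only [IsMisclassified, hA.degree_eq] at h2
    exact h2
  · rintro w ⟨hk, hw⟩
    have hr := poissonRate_pos hc
    rcases le_or_gt ((w i l : ℝ)) u with h | h
    · have h1 := edgeLaw_slotDegree_ge_le g w i l hc ((hw i).1 h)
      rw [← ENNReal.ofReal_toReal (measure_ne_top (edgeLaw g w) (S w))]
      refine ENNReal.ofReal_le_ofReal ?_
      refine (measureReal_mono (μ := edgeLaw g w) (s₂ := {k | κ w ≤ (slotDegree i l k : ℝ)})
        ?_).trans (h1.trans ?_)
      · rintro k (hk | hk)
        · exact hk.2.le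
        · exact absurd (hk.1.trans_le (h.trans huv)) (lt_irrefl _)
      · rw [Real.exp_le_exp, neg_le_neg_iff]
        have h0 : 0 ≤ κ w := by
          refine le_trans ?_ ((hw i).1 h)
          unfold meanDegree
          positivity
        calc kmin * poissonRate c ≤ κ w * poissonRate c := by gcongr
          _ ≤ _ := by gcongr; exact min_le_left _ _
    · rcases le_or_gt ((w i l : ℝ)) v with h' | h'
      · have : S w = ∅ := by
          ext k
          simp [S, h, h']
        simp [this]
      have h1 := edgeLaw_slotDegree_le_le g w i l hc ((hw i).2 h')
      rw [← ENNReal.ofReal_toReal (measure_ne_top (edgeLaw g w) (S w))]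
      refine ENNReal.ofReal_le_ofReal ?_
      refine (measureReal_mono (μ := edgeLaw g w) (s₂ := {k | (slotDegree i l k : ℝ) ≤ κ w})
        ?_).trans ?_
      · rintro k (hk | hk)
        · exact absurd (hk.1.trans_lt h) (lt_irrefl _)
        · exact hk.2
      rcases le_or_gt 0 (κ w) with h0 | h0
      · refine h1.trans ?_
        rw [Real.exp_le_exp, neg_le_neg_iff]
        calc kmin * poissonRate c ≤ κ w * poissonRate c := by gcongr
          _ ≤ _ := by gcongr; exact min_le_right _ _
      -- Here `kmin ≤ κ w < 0`, so the claimed bound is at least one.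
      · refine measureReal_le_one.trans (Real.one_le_exp ?_)
        nlinarith

end Graph

/-! ### Chebyshev and Markov bounds for i.i.d. sums. -/

section Chebyshev

variable {Ω E : Type*} [MeasurableSpace Ω] [MeasurableSpace E] {μ : Measure Ω}
  {X : ℕ → Ω → E} {π : Measure E}

lemma integrable_of_bounded [IsProbabilityMeasure π] {f : E → ℝ} (hf : Measurable f) {b : ℝ} (h0 : ∀ x, 0 ≤ f x)
    (hb : ∀ x, f x ≤ b) : Integrable f π :=
  Integrable.of_bound hf.aestronglyMeasurable b
    (ae_of_all _ fun x => by rw [Real.norm_of_nonneg (h0 x)]; exact hb x)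

lemma integral_comp_of_law {Y : Ω → E} (hY : Measurable Y) (hlaw : μ.map Y = π) {f : E → ℝ}
    (hf : Measurable f) : ∫ ω, f (Y ω) ∂μ = ∫ x, f x ∂π := by
  rw [← hlaw, integral_map hY.aemeasurable hf.aestronglyMeasurable]

/-- The variance of a term is bounded by `E f² ≤ b · E f` and not by `b²`: the factor `E f` keeps
the bound sharp for rare events. -/
lemma measure_abs_sum_sub_ge_le [IsProbabilityMeasure μ] [IsProbabilityMeasure π]
    (hX : ∀ i, Measurable (X i)) (hind : iIndepFun X μ)
    (hlaw : ∀ i, μ.map (X i) = π) {f : E → ℝ} (hf : Measurable f) {b : ℝ} (h0 : ∀ x, 0 ≤ f x)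
    (hb : ∀ x, f x ≤ b) (N : ℕ) {r : ℝ} (hr : 0 < r) :
    μ.real {ω | r ≤ |∑ i : Fin N, f (X i ω) - N * ∫ x, f x ∂π|} ≤
      N * (b * ∫ x, f x ∂π) / r ^ 2 := by
  have hfi : Integrable f π := integrable_of_bounded hf h0 hb
  have hfX : ∀ i, Measurable fun ω => f (X i ω) := fun i => hf.comp (hX i)
  have hmem : ∀ i, MemLp (fun ω => f (X i ω)) 2 μ := fun i =>
    MemLp.of_bound (hfX i).aestronglyMeasurable b
      (ae_of_all _ fun ω => by rw [Real.norm_of_nonneg (h0 _)]; exact hb _)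
  have hint : ∀ i, Integrable (fun ω => f (X i ω)) μ := fun i => (hmem i).integrable (by simp)
  let S : Ω → ℝ := ∑ i : Fin N, fun ω => f (X i ω)
  have hS : MemLp S 2 μ := memLp_finsetSum' _ fun i _ => hmem i
  have hES : ∫ ω, S ω ∂μ = N * ∫ x, f x ∂π := by
    simp only [S, Finset.sum_apply]
    rw [integral_finsetSum _ fun (i : Fin N) _ => hint i]
    simp [integral_comp_of_law (hX _) (hlaw _) hf]
  have hvar : Var[S; μ] ≤ N * (b * ∫ x, f x ∂π) := by
    rw [show S = ∑ i : Fin N, fun ω => f (X i ω) from rfl,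
      IndepFun.variance_sum (fun (i : Fin N) _ => hmem i)]
    · calc ∑ i : Fin N, Var[fun ω => f (X i ω); μ] ≤ ∑ i : Fin N, b * ∫ x, f x ∂π := by
            refine Finset.sum_le_sum fun i _ => ?_
            refine (variance_le_expectation_sq (hfX i).aestronglyMeasurable).trans ?_
            rw [← integral_comp_of_law (hX i) (hlaw i) hf, ← integral_const_mul]
            refine integral_mono (hmem i).integrable_sq ((hint i).const_mul b) fun ω => ?_
            simp only [Pi.pow_apply, sq]
            exact mul_le_mul_of_nonneg_right (hb _) (h0 _)
        _ = _ := by simp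
    · intro i _ j _ hij
      exact (hind.indepFun (fun h => hij (Fin.ext h))).comp hf hf
  have := meas_ge_le_variance_div_sq hS hr
  rw [hES] at this
  have h2 : {ω | r ≤ |∑ i : Fin N, f (X i ω) - N * ∫ x, f x ∂π|} =
      {ω | r ≤ |S ω - N * ∫ x, f x ∂π|} := by simp [S]
  rw [h2]
  calc _ ≤ (ENNReal.ofReal (Var[S; μ] / r ^ 2)).toReal := ENNReal.toReal_mono (by simp) this
    _ = Var[S; μ] / r ^ 2 := ENNReal.toReal_ofReal (div_nonneg (variance_nonneg _ _) (sq_nonneg _))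
    _ ≤ _ := by gcongr

/-- A sum of nonnegative bounded i.i.d. variables is at least half its mean with high
probability. -/
lemma measure_sum_lt_half_le [IsProbabilityMeasure μ] [IsProbabilityMeasure π]
    (hX : ∀ i, Measurable (X i)) (hind : iIndepFun X μ)
    (hlaw : ∀ i, μ.map (X i) = π) {f : E → ℝ} (hf : Measurable f) {b : ℝ} (h0 : ∀ x, 0 ≤ f x)
    (hb : ∀ x, f x ≤ b) (N : ℕ) (hpos : 0 < N * ∫ x, f x ∂π) :
    μ.real {ω | ∑ i : Fin N, f (X i ω) < N * (∫ x, f x ∂π) / 2} ≤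
      4 * b / (N * ∫ x, f x ∂π) := by
  have h := measure_abs_sum_sub_ge_le hX hind hlaw hf h0 hb N (half_pos hpos)
  refine (measureReal_mono ?_).trans (h.trans (le_of_eq ?_))
  · intro ω hω
    simp only [Set.mem_ofPred_eq] at hω ⊢
    rw [abs_sub_comm]
    refine le_trans ?_ (le_abs_self _)
    linarith
  · field_simp
    ring

/-- Markov's inequality for a sum of nonnegative i.i.d. variables. -/
lemma measure_sum_gt_le [IsProbabilityMeasure μ] (hX : ∀ i, Measurable (X i)) (hlaw : ∀ i, μ.map (X i) = π) {f : E → ℝ}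
    (hf : Measurable f) (hfi : Integrable f π) (h0 : ∀ x, 0 ≤ f x) (N : ℕ) {r : ℝ} (hr : 0 < r) :
    μ.real {ω | r < ∑ i : Fin N, f (X i ω)} ≤ N * (∫ x, f x ∂π) / r := by
  have hint : ∀ i, Integrable (fun ω => f (X i ω)) μ := fun i => by
    have : Integrable f (μ.map (X i)) := by rw [hlaw]; exact hfi
    exact this.comp_measurable (hX i)
  have h := mul_meas_ge_le_integral_of_nonneg (μ := μ) (f := fun ω => ∑ i : Fin N, f (X i ω))
    (ae_of_all _ fun ω => Finset.sum_nonneg fun i _ => h0 _)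
    (integrable_finsetSum _ fun i _ => hint i) r
  rw [integral_finsetSum _ fun (i : Fin N) _ => hint i] at h
  simp only [integral_comp_of_law (hX _) (hlaw _) hf, Finset.sum_const, Finset.card_univ,
    Fintype.card_fin, nsmul_eq_mul] at h
  rw [le_div_iff₀ hr, mul_comm]
  refine le_trans (mul_le_mul_of_nonneg_left (measureReal_mono ?_) hr.le) h
  exact fun ω (hω : r < _) => hω.le

end Chebyshev

/-! ### Regularly varying tails. -/

section Tail

/-- The survival function of a law on `ℝ₊`. -/
noncomputable def tailFn (π : Measure ℝ≥0) (y : ℝ) : ℝ := π.real {w | y < (w : ℝ)}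

/-- The law `π` on `ℝ₊` has a regularly varying tail of index `-α`. -/
structure HasRVTail (π : Measure ℝ≥0) (α : ℝ) : Prop where
  pos : ∀ y, 0 < tailFn π y
  tendsto : ∀ x : ℝ, 0 < x → Tendsto (fun y => tailFn π (y * x) / tailFn π y) atTop (𝓝 (x ^ (-α)))

variable {π : Measure ℝ≥0} [IsProbabilityMeasure π] {α : ℝ}

lemma tailFn_antitone : Antitone (tailFn π) := fun a b hab =>
  measureReal_mono fun w (hw : b < (w : ℝ)) => lt_of_le_of_lt hab hw

lemma tailFn_le_one (y : ℝ) : tailFn π y ≤ 1 := measureReal_le_one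

lemma tailFn_tendsto_zero : Tendsto (tailFn π) atTop (𝓝 0) := by
  have h := tendsto_measure_iInter_atTop (μ := π) (s := fun y : ℝ => {w : ℝ≥0 | y < (w : ℝ)})
    (fun y => (measurableSet_lt measurable_const (by fun_prop)).nullMeasurableSet)
    (fun a b hab w (hw : b < (w : ℝ)) => lt_of_le_of_lt hab hw) ⟨0, measure_ne_top _ _⟩
  have e : ⋂ y : ℝ, {w : ℝ≥0 | y < (w : ℝ)} = ∅ := by
    ext w
    simp only [Set.mem_iInter, Set.mem_ofPred_eq, Set.mem_empty_iff_false, iff_false, not_forall]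
    exact ⟨w, lt_irrefl _⟩
  rw [e, measure_empty] at h
  exact (ENNReal.tendsto_toReal (by simp)).comp h

/-- If `f` is antitone and grows by a fixed factor when the argument is halved, then it has
polynomial growth towards the origin, down to a fixed argument. -/
lemma exists_mul_rpow_le_of_half {f : ℝ → ℝ} (hf : AntitoneOn f (Set.Ioi 0)) (h0 : ∀ y, 0 ≤ f y)
    {M c : ℝ} (hM : 0 < M) (hc : 0 < c) (h : ∀ y, M ≤ y → (1 + c) * f y ≤ f (y / 2)) :
    ∃ β : ℝ, 0 < β ∧ ∃ a : ℝ, 0 < a ∧ ∀ u : ℝ, 1 ≤ u → ∀ y, M * u ≤ y → a * u ^ β * f y ≤ f (y / u) := by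
  -- For `2 ^ k ≤ u < 2 ^ (k + 1)`, halving `k` times gains `(1 + c) ^ k`; the incomplete last step
  -- costs the constant `(1 + c)⁻¹`.
  refine ⟨Real.logb 2 (1 + c), Real.logb_pos (by norm_num) (by linarith), (1 + c)⁻¹,
    by positivity, fun u hu y hy => ?_⟩
  obtain ⟨k, hk1, hk2⟩ := exists_nat_pow_near hu (one_lt_two)
  have hypos : 0 < y := lt_of_lt_of_le (by positivity) hy
  have step : ∀ j ≤ k, (1 + c) ^ j * f y ≤ f (y / 2 ^ j) := by
    intro j
    induction j with
    | zero => simp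
    | succ j ih =>
      intro hj
      have h1 := ih (by omega)
      have h2 := h (y / 2 ^ j) (by
        rw [le_div_iff₀ (by positivity)]
        refine le_trans ?_ hy
        gcongr
        exact le_trans (pow_le_pow_right₀ (by norm_num) (by omega)) hk1)
      rw [pow_succ 2, ← div_div]
      calc (1 + c) ^ (j + 1) * f y = (1 + c) * ((1 + c) ^ j * f y) := by ring
        _ ≤ (1 + c) * f (y / 2 ^ j) := by gcongr
        _ ≤ _ := h2
  have h3 : u ^ Real.logb 2 (1 + c) ≤ (1 + c) ^ (k + 1) := by
    calc u ^ Real.logb 2 (1 + c) ≤ ((2 : ℝ) ^ (k + 1)) ^ Real.logb 2 (1 + c) := by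
          refine Real.rpow_le_rpow (by linarith) hk2.le (Real.logb_pos (by norm_num) (by linarith)).le
      _ = _ := by
          rw [← Real.rpow_natCast, ← Real.rpow_mul (by norm_num), mul_comm, Real.rpow_mul (by norm_num),
            Real.rpow_logb (by norm_num) (by norm_num) (by linarith), Real.rpow_natCast]
  calc (1 + c)⁻¹ * u ^ Real.logb 2 (1 + c) * f y ≤ (1 + c)⁻¹ * (1 + c) ^ (k + 1) * f y := by
        have := h0 y
        gcongr
    _ = (1 + c) ^ k * f y := by rw [pow_succ]; field_simp
    _ ≤ f (y / 2 ^ k) := step k le_rfl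
    _ ≤ f (y / u) := by
        refine hf ?_ ?_ ?_
        · exact div_pos hypos (by linarith)
        · exact div_pos hypos (by positivity)
        · gcongr

/-- Each doubling of a large argument multiplies the tail by at least a fixed `r > 0`, so the tail
decays at most polynomially. Exponentially small probabilities are thus negligible against it. -/
lemma HasRVTail.exists_poly_bound (h : HasRVTail π α) :
    ∃ A : ℝ, ∃ C > 0, ∀ᶠ y in atTop, 1 ≤ C * y ^ A * tailFn π y := by
  have h2 := h.tendsto 2 (by norm_num)
  -- The halving makes `r` strictly smaller than the limit ratio; the cap at one makes `logb 2 r`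
  -- nonpositive.
  set r : ℝ := min ((2 : ℝ) ^ (-α) / 2) 1 with hr
  have hr0 : 0 < r := lt_min (by positivity) one_pos
  have hr1 : r ≤ 1 := min_le_right _ _
  have hlt : r < (2 : ℝ) ^ (-α) :=
    (min_le_left _ _).trans_lt (half_lt_self (by positivity))
  obtain ⟨M, hM⟩ := eventually_atTop.1 (h2.eventually (lt_mem_nhds hlt))
  set K := max M 1
  have hK : 1 ≤ K := le_max_right _ _
  have step : ∀ k : ℕ, r ^ k * tailFn π K ≤ tailFn π (K * 2 ^ k) := by
    intro k
    induction k with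
    | zero => simp
    | succ k ih =>
      have h1 := hM (K * 2 ^ k) ((le_max_left _ _).trans
        (le_mul_of_one_le_right (by linarith) (one_le_pow₀ (by norm_num))))
      rw [lt_div_iff₀ (h.pos _)] at h1
      rw [pow_succ, pow_succ, ← mul_assoc K]
      nlinarith
  refine ⟨-Real.logb 2 r, (r * tailFn π K)⁻¹, by have := h.pos K; positivity, ?_⟩
  filter_upwards [eventually_ge_atTop K] with y hy
  obtain ⟨k, hk1, hk2⟩ := exists_nat_pow_near ((one_le_div (by linarith)).2 hy) (one_lt_two)
  rw [div_lt_iff₀ (by linarith)] at hk2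
  rw [le_div_iff₀ (by linarith)] at hk1
  have h3 : y ^ Real.logb 2 r ≤ r ^ k := by
    calc y ^ Real.logb 2 r ≤ ((2 : ℝ) ^ k) ^ Real.logb 2 r := by
          refine Real.rpow_le_rpow_of_nonpos (by positivity) ?_ ?_
          · exact le_trans (le_mul_of_one_le_right (by positivity) hK) hk1
          · exact Real.logb_nonpos (by norm_num) hr0.le hr1
      _ = _ := by
          rw [← Real.rpow_natCast, ← Real.rpow_mul (by norm_num), mul_comm, Real.rpow_mul (by norm_num),
            Real.rpow_logb (by norm_num) (by norm_num) hr0, Real.rpow_natCast]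
  have hy0 : 0 < y := by linarith
  have hKp := h.pos K
  have h4 : r ^ (k + 1) * tailFn π K ≤ tailFn π y :=
    (step (k + 1)).trans (tailFn_antitone (by rw [mul_comm]; exact hk2.le))
  have h5 : y ^ Real.logb 2 r * (r * tailFn π K) ≤ tailFn π y := by
    refine le_trans ?_ h4
    rw [pow_succ, mul_assoc]
    gcongr
  rw [Real.rpow_neg hy0.le]
  have h6 : 0 < y ^ Real.logb 2 r := by positivity
  rw [← mul_inv, inv_mul_eq_div, one_le_div (by positivity)]
  linarith

/-- A regularly varying tail strictly grows, by a fixed factor, when its argument shrinks. -/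
lemma HasRVTail.exists_growth (h : HasRVTail π α) (hα : 0 < α) {δ : ℝ} (hδ : 0 < δ) :
    ∃ c > 0, ∃ M > 0, ∀ y ≥ M, (1 + c) * π.real {w | y ≤ (w : ℝ)} ≤ tailFn π (y / (1 + δ)) := by
  -- One factor `s` gives the growth; the other passes from the closed event `y ≤ w` to the open
  -- event `y / s < w`.
  set s := Real.sqrt (1 + δ) with hs
  have hs2 : s * s = 1 + δ := Real.mul_self_sqrt (by linarith)
  have hs1 : 1 < s := by
    rw [hs]; exact Real.lt_sqrt_of_sq_lt (by linarith)
  have ht := h.tendsto s⁻¹ (by positivity)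
  have h1 : 1 < s⁻¹ ^ (-α) := by
    rw [Real.inv_rpow (by positivity), Real.rpow_neg (by positivity), inv_inv]
    exact Real.one_lt_rpow hs1 hα
  set c := (s⁻¹ ^ (-α) - 1) / 2 with hc
  obtain ⟨M, hM⟩ := eventually_atTop.1 (ht.eventually
    (lt_mem_nhds (show 1 + c < s⁻¹ ^ (-α) by linarith)))
  refine ⟨c, by linarith, s * max M 1, by positivity, fun y hy => ?_⟩
  have h3 := hM (y / s) (by
    rw [le_div_iff₀ (by positivity)]
    refine le_trans ?_ hy
    rw [mul_comm]; gcongr; exact le_max_left _ _)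
  rw [lt_div_iff₀ (h.pos _)] at h3
  have e : y / (1 + δ) = y / s * s⁻¹ := by rw [← hs2]; field_simp
  rw [e]
  refine le_trans ?_ h3.le
  have hy0 : 0 < y := lt_of_lt_of_le (by positivity) hy
  have : (0 : ℝ) < 1 + c := by linarith
  gcongr
  refine measureReal_mono fun w (hw : y ≤ (w : ℝ)) => ?_
  exact lt_of_lt_of_le (div_lt_self hy0 hs1) hw

/-- For `α > 1` a doubling shrinks the tail by a factor `r < 1/2`, so the dyadic sum `∑ 2 ^ k · P(W
> K 2 ^ k)` is geometric. Hence an infinite mean forces `α ≤ 1`, where connection functions are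
concave. -/
lemma lintegral_coe_lt_top_of_one_lt (h : HasRVTail π α) (hα : 1 < α) :
    ∫⁻ w, (w : ℝ≥0∞) ∂π < ∞ := by
  have ht := h.tendsto 2 (by norm_num)
  have h1 : (2 : ℝ) ^ (-α) < 2⁻¹ := by
    rw [Real.rpow_neg (by norm_num)]
    refine inv_strictAnti₀ (by norm_num) ?_
    nth_rw 1 [← Real.rpow_one 2]
    exact Real.rpow_lt_rpow_of_exponent_lt (by norm_num) hα
  obtain ⟨r, hr1, hr2⟩ := exists_between h1
  have hr0 : 0 < r := lt_trans (by positivity) hr1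
  obtain ⟨M, hM⟩ := eventually_atTop.1 (ht.eventually (gt_mem_nhds hr1))
  set K : ℝ≥0 := (max M 1).toNNReal with hKdef
  have hK : (K : ℝ) = max M 1 := Real.coe_toNNReal _ (by positivity)
  have hK1 : 1 ≤ (K : ℝ) := hK ▸ le_max_right _ _
  have step : ∀ k : ℕ, tailFn π (K * 2 ^ k) ≤ r ^ k := by
    intro k
    induction k with
    | zero => simpa using tailFn_le_one _
    | succ k ih =>
      have h1 := hM (K * 2 ^ k) ((hK ▸ le_max_left _ _ : M ≤ K).trans
        (le_mul_of_one_le_right (by linarith) (one_le_pow₀ (by norm_num))))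
      rw [div_lt_iff₀ (h.pos _)] at h1
      rw [pow_succ, pow_succ, ← mul_assoc]
      nlinarith
  -- Dyadic layers: for `K 2 ^ k < w ≤ K 2 ^ (k + 1)` the right side contains `K + K (1 + ⋯ + 2 ^ k)
  -- = K 2 ^ (k + 1)`.
  have hpt : ∀ w : ℝ≥0, (w : ℝ≥0∞) ≤ K + ∑' k : ℕ,
      {w : ℝ≥0 | (K * 2 ^ k : ℝ) < w}.indicator (fun _ => (K * 2 ^ k : ℝ≥0∞)) w := by
    intro w
    rcases le_or_gt w K with hw | hw
    · exact le_add_right (by exact_mod_cast hw)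
    · obtain ⟨k, hk1, hk2⟩ := exists_nat_pow_near (y := (2 : ℝ)) (x := (w : ℝ) / K)
        ((one_le_div (by linarith)).2 (by exact_mod_cast hw.le)) (one_lt_two)
      rw [div_lt_iff₀ (by linarith)] at hk2
      rw [le_div_iff₀ (by linarith)] at hk1
      have key : ∀ k : ℕ, (w : ℝ) ≤ 2 ^ (k + 1) * K → (w : ℝ≥0∞) ≤ K + ∑ k ∈ Finset.range (k + 1),
          {w : ℝ≥0 | (K * 2 ^ k : ℝ) < w}.indicator (fun _ => (K * 2 ^ k : ℝ≥0∞)) w := by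
        intro k
        induction k with
        | zero =>
          intro h
          have : (w : ℝ≥0∞) ≤ K + K := by
            norm_cast
            rw [← NNReal.coe_le_coe]; push_cast; norm_num at h; linarith
          have hw' : (K : ℝ) < w := by exact_mod_cast hw
          simpa [Set.indicator, hw'] using this
        | succ k ih =>
          intro h
          rcases le_or_gt (w : ℝ) (2 ^ (k + 1) * K) with h' | h'
          · rw [Finset.sum_range_succ, ← add_assoc]
            exact le_add_right (ih h')
          · have hall : ∀ j ∈ Finset.range (k + 1 + 1), {w : ℝ≥0 | (K * 2 ^ j : ℝ) < w}.indicator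
                (fun _ => (K * 2 ^ j : ℝ≥0∞)) w = K * 2 ^ j := by
              intro j hj
              rw [Set.indicator_of_mem]
              refine lt_of_le_of_lt ?_ h'
              rw [mul_comm]
              gcongr
              · norm_num
              · simp at hj; omega
            rw [Finset.sum_congr rfl hall, ← Finset.mul_sum]
            have : (w : ℝ≥0∞) ≤ ((2 ^ (k + 1 + 1) * K : ℝ≥0) : ℝ≥0∞) := by
              rw [ENNReal.coe_le_coe, ← NNReal.coe_le_coe]
              push_cast
              exact h
            refine this.trans ?_
            have e : (K : ℝ≥0∞) + K * ∑ j ∈ Finset.range (k + 1 + 1), (2 : ℝ≥0∞) ^ j =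
                ((K + K * ∑ j ∈ Finset.range (k + 1 + 1), (2 : ℝ≥0) ^ j : ℝ≥0) : ℝ≥0∞) := by
              push_cast; rfl
            rw [e]
            norm_cast
            rw [← NNReal.coe_le_coe]
            push_cast
            rw [geom_sum_eq (by norm_num)]
            apply le_of_eq
            ring
      refine (key k hk2.le).trans ?_
      gcongr
      exact ENNReal.sum_le_tsum _
  calc ∫⁻ w, (w : ℝ≥0∞) ∂π ≤ ∫⁻ w, (K + ∑' k : ℕ,
      {w : ℝ≥0 | (K * 2 ^ k : ℝ) < w}.indicator (fun _ => (K * 2 ^ k : ℝ≥0∞)) w) ∂π :=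
        lintegral_mono hpt
    _ = K + ∑' k : ℕ, (K * 2 ^ k : ℝ≥0∞) * π {w : ℝ≥0 | (K * 2 ^ k : ℝ) < w} := by
        have hms : ∀ k : ℕ, MeasurableSet {w : ℝ≥0 | (K * 2 ^ k : ℝ) < w} := fun k =>
          measurableSet_lt measurable_const (by fun_prop)
        rw [lintegral_add_left measurable_const, lintegral_tsum
          (fun k => (measurable_const.indicator (hms k)).aemeasurable)]
        simp only [lintegral_const, measure_univ, mul_one]
        congr 1
        refine tsum_congr fun k => ?_
        rw [lintegral_indicator (hms k), setLIntegral_const]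
    _ ≤ K + ∑' k : ℕ, K * ENNReal.ofReal (2 * r) ^ k := by
        refine add_le_add le_rfl (ENNReal.tsum_le_tsum fun k => ?_)
        have : π {w : ℝ≥0 | (K * 2 ^ k : ℝ) < w} ≤ ENNReal.ofReal (r ^ k) := by
          rw [← ENNReal.ofReal_toReal (measure_ne_top π _)]
          exact ENNReal.ofReal_le_ofReal (step k)
        calc (K * 2 ^ k : ℝ≥0∞) * π {w : ℝ≥0 | (K * 2 ^ k : ℝ) < w} ≤
            (K * 2 ^ k : ℝ≥0∞) * ENNReal.ofReal (r ^ k) := by gcongr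
          _ = _ := by
            rw [ENNReal.ofReal_mul (by norm_num), mul_pow, ENNReal.ofReal_pow hr0.le, mul_assoc]
            simp
    _ < ∞ := by
        rw [ENNReal.tsum_mul_left, ENNReal.tsum_geometric]
        have : ENNReal.ofReal (2 * r) < 1 := by
          rw [ENNReal.ofReal_lt_one]; linarith
        refine ENNReal.add_lt_top.2 ⟨ENNReal.coe_lt_top, ENNReal.mul_lt_top ENNReal.coe_lt_top ?_⟩
        rw [ENNReal.inv_lt_top]
        exact tsub_pos_of_lt this

end Tail

/-- The conditional mean degree of node `i` in a single layer with weights `x`. -/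
noncomputable def scalarMean {N : ℕ} (G : ℝ≥0 → ℝ≥0) (x : Fin N → ℝ≥0) (i : Fin N) : ℝ :=
  ∑ j, (G (x i * x j / ∑ k, x k) : ℝ)

/-- Single-layer version of `IsSeparated`. -/
def ScalarSeparated {N : ℕ} (G : ℝ≥0 → ℝ≥0) (u v c kmin κ : ℝ) (x : Fin N → ℝ≥0) : Prop :=
  kmin ≤ κ ∧ ∀ i, ((x i : ℝ) ≤ u → scalarMean G x i * (1 + c) ≤ κ) ∧
    (v < (x i : ℝ) → κ * (1 + c) ≤ scalarMean G x i)

/-! ### Separation of the mean degrees for weights of finite mean. -/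

section FiniteMean

/-- With `T = ∑ x_k` one has `∑ⱼ x_i x_j / T = x_i`. Partners of weight at most `M` give arguments
below `z₀`, where `G` is nearly the identity; the others enter through the crude bound `K`, and
together they weigh at most `η T`. -/
lemma abs_scalarMean_sub_le {N : ℕ} {G : ℝ≥0 → ℝ≥0} {x : Fin N → ℝ≥0} {η K M z₀ : ℝ}
    (hη : 0 ≤ η) (hK : 0 ≤ K)
    (h1 : ∀ z : ℝ≥0, (z : ℝ) ≤ z₀ → |(G z : ℝ) - z| ≤ η * z)
    (h2 : ∀ z : ℝ≥0, |(G z : ℝ) - z| ≤ K * z) (hT : 0 < ∑ k, (x k : ℝ))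
    (hM : ∀ i, (x i : ℝ) * M ≤ z₀ * ∑ k, (x k : ℝ))
    (hbig : ∑ j, {w : ℝ≥0 | M < (w : ℝ)}.indicator (fun w => (w : ℝ)) (x j) ≤
      η * ∑ k, (x k : ℝ)) (i : Fin N) :
    |scalarMean G x i - x i| ≤ (1 + K) * η * x i := by
  set T : ℝ := ∑ k, (x k : ℝ) with hTdef
  have hz : ∀ j, ((x i * x j / ∑ k, x k : ℝ≥0) : ℝ) = x i * x j / T := by
    intro j; push_cast; rfl
  have hxi : (x i : ℝ) = ∑ j, (x i * x j / T : ℝ) := by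
    rw [← Finset.sum_div, ← Finset.mul_sum, ← hTdef]; field_simp
  have hterm : ∀ j, |(G (x i * x j / ∑ k, x k) : ℝ) - x i * x j / T| ≤
      η * (x i * x j / T) +
        K * (x i / T) * {w : ℝ≥0 | M < (w : ℝ)}.indicator (fun w => (w : ℝ)) (x j) := by
    intro j
    by_cases hj : M < (x j : ℝ)
    · rw [Set.indicator_of_mem (by exact hj)]
      have := h2 (x i * x j / ∑ k, x k)
      rw [hz] at this
      refine this.trans ?_
      have h0 : 0 ≤ η * (x i * x j / T) := by positivity
      have : K * (x i / T) * x j = K * (x i * x j / T) := by ring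
      linarith
    · rw [Set.indicator_of_notMem (by exact hj), mul_zero, add_zero]
      have := h1 (x i * x j / ∑ k, x k)
      rw [hz] at this
      refine this ?_
      rw [div_le_iff₀ hT]
      refine le_trans ?_ (hM i)
      gcongr
      exact not_lt.1 hj
  calc |scalarMean G x i - x i|
      = |∑ j, ((G (x i * x j / ∑ k, x k) : ℝ) - x i * x j / T)| := by
        rw [Finset.sum_sub_distrib, ← hxi]; rfl
    _ ≤ ∑ j, |(G (x i * x j / ∑ k, x k) : ℝ) - x i * x j / T| := Finset.abs_sum_le_sum_abs _ _
    _ ≤ ∑ j, (η * (x i * x j / T) +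
        K * (x i / T) * {w : ℝ≥0 | M < (w : ℝ)}.indicator (fun w => (w : ℝ)) (x j)) :=
        Finset.sum_le_sum fun j _ => hterm j
    _ = η * x i + K * (x i / T) *
        ∑ j, {w : ℝ≥0 | M < (w : ℝ)}.indicator (fun w => (w : ℝ)) (x j) := by
        rw [Finset.sum_add_distrib, ← Finset.mul_sum, ← hxi, ← Finset.mul_sum]
    _ ≤ η * x i + K * (x i / T) * (η * T) := by gcongr
    _ = _ := by field_simp

lemma IsConnectionFun.exists_local {α : ℝ} {G : ℝ≥0 → ℝ≥0} (hG : IsConnectionFun α G) {η : ℝ}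
    (hη : 0 < η) : ∃ z₀ > 0, ∀ z : ℝ≥0, (z : ℝ) ≤ z₀ → |(G z : ℝ) - z| ≤ η * z := by
  obtain ⟨K, hK⟩ := hG.linear_bound
  have hG0 : G 0 = 0 := by simpa using hK 0
  have h := hG.tendsto_one
  have h' : Tendsto (fun x => ((G x / x : ℝ≥0) : ℝ)) (𝓝[>] 0) (𝓝 1) :=
    (NNReal.continuous_coe.tendsto 1).comp h
  have h2 := h'.eventually (Metric.ball_mem_nhds (1 : ℝ) hη)
  rw [eventually_nhdsWithin_iff, Metric.eventually_nhds_iff] at h2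
  obtain ⟨e, he, h2⟩ := h2
  refine ⟨e / 2, by positivity, fun z hz => ?_⟩
  rcases eq_or_ne z 0 with rfl | hz0
  · simp [hG0]
  · have hzp : 0 < z := pos_iff_ne_zero.2 hz0
    have h3 := h2 (y := z) (by
      rw [NNReal.dist_eq]; simp only [NNReal.coe_zero, sub_zero, NNReal.abs_eq]; linarith) hzp
    rw [Real.dist_eq] at h3
    have hzp' : (0 : ℝ) < z := by exact_mod_cast hzp
    push_cast at h3
    have : (G z : ℝ) - z = ((G z : ℝ) / z - 1) * z := by field_simp
    rw [this, abs_mul, abs_of_pos hzp']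
    gcongr

variable {Ω : Type*} [MeasurableSpace Ω] {μ : Measure Ω} [IsProbabilityMeasure μ]
  {X : ℕ → Ω → ℝ≥0} {π : Measure ℝ≥0} {α : ℝ} {G : ℝ≥0 → ℝ≥0}

lemma integrable_coe_of_lintegral (hfin : ∫⁻ w, (w : ℝ≥0∞) ∂π < ∞) :
    Integrable (fun w : ℝ≥0 => (w : ℝ)) π :=
  ⟨by fun_prop, by simpa [HasFiniteIntegral, enorm_eq_nnnorm] using hfin⟩

lemma measurableSet_coe_gt (y : ℝ) : MeasurableSet {w : ℝ≥0 | y < (w : ℝ)} :=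
  measurableSet_lt measurable_const (by fun_prop)

lemma tendsto_integral_indicator_gt (hint : Integrable (fun w : ℝ≥0 => (w : ℝ)) π) :
    Tendsto (fun y : ℝ => ∫ w, {w : ℝ≥0 | y < (w : ℝ)}.indicator (fun w => (w : ℝ)) w ∂π)
      atTop (𝓝 0) := by
  rw [show (0 : ℝ) = ∫ w : ℝ≥0, (0 : ℝ) ∂π by simp]
  refine tendsto_integral_filter_of_dominated_convergence (fun w => (w : ℝ)) ?_ ?_ hint ?_
  · exact .of_forall fun y => (Measurable.indicator (by fun_prop)
      (measurableSet_coe_gt y)).aestronglyMeasurable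
  · refine .of_forall fun y => ae_of_all _ fun w => ?_
    by_cases h : w ∈ {w : ℝ≥0 | y < (w : ℝ)} <;> simp [h]
  · refine ae_of_all _ fun w => tendsto_const_nhds.congr' ?_
    filter_upwards [eventually_ge_atTop (w : ℝ)] with y hy
    rw [Set.indicator_of_notMem]
    exact not_lt.2 hy

variable [IsProbabilityMeasure π]

/-- The expectation of `min (W, y)`. -/
noncomputable def truncMean (π : Measure ℝ≥0) (y : ℝ) : ℝ := ∫ w, min (w : ℝ) y ∂π

lemma integrable_min {y : ℝ} (hy : 0 ≤ y) : Integrable (fun w : ℝ≥0 => min (w : ℝ) y) π :=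
  integrable_of_bounded (by fun_prop) (fun w => le_min w.2 hy) (fun w => min_le_right _ _)

lemma mul_tailFn_le_truncMean {y : ℝ} (hy : 0 ≤ y) : y * tailFn π y ≤ truncMean π y := by
  have : y * tailFn π y = ∫ w, {w : ℝ≥0 | y < (w : ℝ)}.indicator (fun _ => y) w ∂π := by
    rw [integral_indicator_const _ (measurableSet_coe_gt y), tailFn, smul_eq_mul, mul_comm]
  rw [this]
  refine integral_mono_of_nonneg (ae_of_all _ fun w => Set.indicator_nonneg (fun _ _ => hy) w)
    (integrable_min hy) (ae_of_all _ fun w => ?_)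
  by_cases h : y < (w : ℝ)
  · rw [Set.indicator_of_mem (by exact h)]
    exact (min_eq_right h.le).ge
  · rw [Set.indicator_of_notMem (by exact h)]
    exact le_min w.2 hy

lemma truncMean_pos (hpos : ∀ y, 0 < tailFn π y) {y : ℝ} (hy : 0 < y) : 0 < truncMean π y :=
  lt_of_lt_of_le (mul_pos hy (hpos y)) (mul_tailFn_le_truncMean hy.le)

/-- With finite mean weights, all conditional mean degrees are uniformly close to the weights. -/
lemma eventually_scalarMean_close (hX : ∀ i, Measurable (X i)) (hind : iIndepFun X μ)
    (hlaw : ∀ i, μ.map (X i) = π) (hpos : ∀ y, 0 < tailFn π y)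
    (hint : Integrable (fun w : ℝ≥0 => (w : ℝ)) π) (hG : IsConnectionFun α G)
    {η ε : ℝ} (hη : 0 < η) (hε : 0 < ε) :
    ∀ᶠ N : ℕ in atTop, μ.real {ω | ¬ ∀ i : Fin N,
      |scalarMean G (fun i : Fin N => X i ω) i - X i ω| ≤ η * X i ω} ≤ ε := by
  obtain ⟨K₀, hK₀⟩ := hG.linear_bound
  set K : ℝ := K₀ + 1 with hK
  have hK1 : 1 ≤ K := by rw [hK]; linarith [K₀.2]
  have h2 : ∀ z : ℝ≥0, |(G z : ℝ) - z| ≤ K * z := by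
    intro z
    have h3 : (G z : ℝ) ≤ K₀ * z := by exact_mod_cast hK₀ z
    have h4 : (0 : ℝ) ≤ G z := (G z).2
    have h5 : (0 : ℝ) ≤ z := z.2
    have h6 : (0 : ℝ) ≤ K₀ := K₀.2
    rw [abs_le]; constructor <;> nlinarith
  set η₁ := η / (1 + K) with hη₁
  have hη₁0 : 0 < η₁ := by positivity
  obtain ⟨z₀, hz₀, h1⟩ := hG.exists_local hη₁0
  set m := truncMean π 1 with hm
  have hm0 : 0 < m := truncMean_pos hpos one_pos
  have hlim := tendsto_integral_indicator_gt hint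
  have hthr : 0 < ε / 3 * (η₁ * (m / 2)) := by positivity
  obtain ⟨M, hM0, hM⟩ := ((eventually_gt_atTop (0 : ℝ)).and (hlim.eventually
    (gt_mem_nhds hthr))).exists
  -- Chosen so that `x_i ≤ a N` and `T ≥ N m / 2` imply `x_i M ≤ z₀ T`.
  set a := z₀ * (m / 2) / M with ha
  have ha0 : 0 < a := by positivity
  have hlim2 : Tendsto (fun N : ℕ => ∫ w, {w : ℝ≥0 | a * N < (w : ℝ)}.indicator
      (fun w => (w : ℝ)) w ∂π) atTop (𝓝 0) :=
    hlim.comp (tendsto_natCast_atTop_atTop.const_mul_atTop ha0)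
  have hthr2 : 0 < ε / 3 * a := by positivity
  have hlim3 : Tendsto (fun N : ℕ => 4 * 1 / (N * m)) atTop (𝓝 0) :=
    tendsto_const_nhds.div_atTop (tendsto_natCast_atTop_atTop.atTop_mul_const hm0)
  filter_upwards [hlim2.eventually (gt_mem_nhds hthr2), eventually_gt_atTop 0,
    hlim3.eventually (gt_mem_nhds (show (0 : ℝ) < ε / 3 by positivity))] with N hN2 hN0 hN3
  have hN0' : (0 : ℝ) < N := by exact_mod_cast hN0
  -- Exceptional events: a small total weight, too much weight above `M`, and (contained in `E3`) a
  -- single weight above `a N`. By Markov `E3` has probability at most `E[W; W > a N] / a`, which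
  -- tends to zero.
  set E1 : Set Ω := {ω | ∑ i : Fin N, min (X i ω : ℝ) 1 < N * m / 2}
  set E2 : Set Ω := {ω | N * (η₁ * (m / 2)) < ∑ i : Fin N,
    {w : ℝ≥0 | M < (w : ℝ)}.indicator (fun w => (w : ℝ)) (X i ω)}
  set E3 : Set Ω := {ω | a * N < ∑ i : Fin N,
    {w : ℝ≥0 | a * N < (w : ℝ)}.indicator (fun w => (w : ℝ)) (X i ω)}
  have hp1 : μ.real E1 ≤ ε / 3 := by
    refine le_trans ?_ hN3.le
    exact measure_sum_lt_half_le hX hind hlaw (f := fun w : ℝ≥0 => min (w : ℝ) 1) (by fun_prop)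
      (fun w => le_min w.2 zero_le_one) (fun w => min_le_right _ _) N (mul_pos hN0' hm0)
  have hindi : ∀ y : ℝ, Measurable ({w : ℝ≥0 | y < (w : ℝ)}.indicator (fun w => (w : ℝ))) :=
    fun y => Measurable.indicator (by fun_prop) (measurableSet_coe_gt y)
  have hindn : ∀ (y : ℝ) (w : ℝ≥0), 0 ≤ {w : ℝ≥0 | y < (w : ℝ)}.indicator (fun w => (w : ℝ)) w :=
    fun y w => Set.indicator_nonneg (fun w _ => w.2) w
  have hp2 : μ.real E2 ≤ ε / 3 := by
    refine (measure_sum_gt_le hX hlaw (hindi M) (hint.indicator (measurableSet_coe_gt M))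
      (hindn M) N (by positivity)).trans ?_
    rw [div_le_iff₀ (by positivity)]
    nlinarith
  have hp3 : μ.real E3 ≤ ε / 3 := by
    refine (measure_sum_gt_le hX hlaw (hindi _) (hint.indicator (measurableSet_coe_gt _))
      (hindn _) N (by positivity)).trans ?_
    rw [div_le_iff₀ (by positivity)]
    nlinarith
  have hsub : {ω | ¬ ∀ i : Fin N,
      |scalarMean G (fun i : Fin N => X i ω) i - X i ω| ≤ η * X i ω} ⊆ E1 ∪ E2 ∪ E3 := by
    intro ω hω
    by_contra hcon
    simp only [Set.mem_union, not_or] at hcon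
    obtain ⟨⟨c1, c2⟩, c3⟩ := hcon
    simp only [E1, E2, E3, Set.mem_ofPred_eq, not_lt] at c1 c2 c3
    apply hω
    have hT : N * m / 2 ≤ ∑ k : Fin N, (X k ω : ℝ) :=
      c1.trans (Finset.sum_le_sum fun i _ => min_le_left _ _)
    have hT0 : 0 < ∑ k : Fin N, (X k ω : ℝ) := lt_of_lt_of_le (by positivity) hT
    have := abs_scalarMean_sub_le (x := fun i : Fin N => X i ω) hη₁0.le (by linarith) h1 h2 hT0
      (M := M) ?_ ?_
    · intro i
      refine (this i).trans (le_of_eq ?_)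
      rw [hη₁]; field_simp
    · intro i
      have hi : (X i ω : ℝ) ≤ a * N := by
        by_contra hlt
        push Not at hlt
        have : (X i ω : ℝ) ≤ ∑ i : Fin N,
            {w : ℝ≥0 | a * N < (w : ℝ)}.indicator (fun w => (w : ℝ)) (X i ω) := by
          have h5 := Finset.single_le_sum (f := fun i : Fin N =>
            {w : ℝ≥0 | a * N < (w : ℝ)}.indicator (fun w => (w : ℝ)) (X i ω))
            (fun i _ => hindn _ _) (Finset.mem_univ i)
          refine le_trans (le_of_eq ?_) h5
          rw [Set.indicator_of_mem (by exact hlt)]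
        linarith
      calc (X i ω : ℝ) * M ≤ a * N * M := by gcongr
        _ = z₀ * (N * m / 2) := by rw [ha]; field_simp
        _ ≤ _ := by gcongr
    · refine c2.trans ?_
      calc N * (η₁ * (m / 2)) = η₁ * (N * m / 2) := by ring
        _ ≤ _ := by gcongr
  calc _ ≤ μ.real (E1 ∪ E2 ∪ E3) := measureReal_mono hsub
    _ ≤ μ.real (E1 ∪ E2) + μ.real E3 := measureReal_union_le _ _
    _ ≤ μ.real E1 + μ.real E2 + μ.real E3 := by gcongr; exact measureReal_union_le _ _
    _ ≤ ε := by linarith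

/-- Mean degrees are weights up to a factor `1 ± η`, so the deterministic level `√(1 + δ) · u`
separates. -/
lemma exists_separation_of_integrable (hX : ∀ i, Measurable (X i)) (hind : iIndepFun X μ)
    (hlaw : ∀ i, μ.map (X i) = π) (hpos : ∀ y, 0 < tailFn π y)
    (hint : Integrable (fun w : ℝ≥0 => (w : ℝ)) π) (hG : IsConnectionFun α G)
    {u : ℕ → ℝ} (hu : Tendsto u atTop atTop) {δ ε : ℝ} (hδ : 0 < δ) (hε : 0 < ε) :
    ∃ c > 0, ∃ a > 0, ∃ β : ℝ, 0 < β ∧ ∀ᶠ N : ℕ in atTop, ∃ κ : (Fin N → ℝ≥0) → ℝ,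
      Measurable κ ∧ μ.real {ω | ¬ ScalarSeparated G (u N) ((1 + δ) * u N) c (a * u N ^ β)
        (κ fun i => X i ω) (fun i : Fin N => X i ω)} ≤ ε := by
  set s := Real.sqrt (1 + δ) with hs
  have hs2 : s * s = 1 + δ := Real.mul_self_sqrt (by linarith)
  have hs1 : 1 < s := by
    rw [hs]; exact Real.lt_sqrt_of_sq_lt (by linarith)
  -- With `c = (s - 1) / 3` this gives `(1 + η)(1 + c) ≤ s` and `1 + c ≤ (1 - η) s`.
  set η := (s - 1) / (3 * s) with hη
  have hη0 : 0 < η := div_pos (by linarith) (by linarith)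
  have hηs : η * s = (s - 1) / 3 := by rw [hη]; field_simp
  refine ⟨(s - 1) / 3, by linarith, 1, one_pos, 1, one_pos, ?_⟩
  filter_upwards [eventually_scalarMean_close hX hind hlaw hpos hint hG hη0 hε,
    hu.eventually_ge_atTop 0] with N hN huN
  refine ⟨fun _ => s * u N, measurable_const, le_trans (measureReal_mono ?_) hN⟩
  intro ω hω hcon
  apply hω
  refine ⟨by rw [Real.rpow_one, one_mul]; nlinarith, fun i => ⟨fun hi => ?_, fun hi => ?_⟩⟩
  · have h1 := abs_le.1 (hcon i)
    have h2 : scalarMean G (fun i : Fin N => X i ω) i ≤ (1 + η) * u N := by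
      have : (1 + η) * (X i ω : ℝ) ≤ (1 + η) * u N := by gcongr
      linarith [h1.2]
    calc _ ≤ (1 + η) * u N * (1 + (s - 1) / 3) := by gcongr
      _ ≤ s * u N := by
        have : (1 + η) * (1 + (s - 1) / 3) ≤ s := by nlinarith
        nlinarith
  · have h1 := abs_le.1 (hcon i)
    have h3 : 0 ≤ 1 - η := by nlinarith
    have h2 : (1 - η) * ((1 + δ) * u N) ≤ scalarMean G (fun i : Fin N => X i ω) i := by
      have : (1 - η) * ((1 + δ) * u N) ≤ (1 - η) * (X i ω : ℝ) := by gcongr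
      linarith [h1.1]
    refine le_trans ?_ h2
    rw [← hs2]
    have : 1 + (s - 1) / 3 ≤ (1 - η) * s := by nlinarith
    have h5 : 0 ≤ s * u N := by positivity
    nlinarith

end FiniteMean

/-! ### Concave rate functions. -/

/-- The properties of a concave connection function, extended by zero to `ℝ`, that are used. -/
structure IsConcaveRate (h : ℝ → ℝ) : Prop where
  mono : Monotone h
  zero : ∀ z ≤ 0, h z = 0
  continuous : Continuous h
  star : ∀ x y, 0 ≤ x → x ≤ y → x * h y ≤ y * h x
  le_self : ∀ z, 0 ≤ z → h z ≤ z
  half_le : ∃ z₀ > 0, ∀ z, 0 ≤ z → z ≤ z₀ → z / 2 ≤ h z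

namespace IsConcaveRate

variable {h : ℝ → ℝ}

lemma nonneg (hh : IsConcaveRate h) (z : ℝ) : 0 ≤ h z := by
  rcases le_total z 0 with hz | hz
  · rw [hh.zero z hz]
  · rw [← hh.zero 0 le_rfl]; exact hh.mono hz

lemma pos (hh : IsConcaveRate h) {z : ℝ} (hz : 0 < z) : 0 < h z := by
  obtain ⟨z₀, hz₀, h1⟩ := hh.half_le
  have h2 := h1 (min z z₀) (by positivity) (min_le_right _ _)
  have h3 := hh.mono (min_le_left z z₀)
  have : 0 < min z z₀ := by positivity
  linarith

lemma mul_le (hh : IsConcaveRate h) {s z : ℝ} (hs : 1 ≤ s) (hz : 0 ≤ z) : h (s * z) ≤ s * h z := by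
  rcases hz.eq_or_lt with rfl | hz
  · simp [hh.zero 0 le_rfl]
  · have := hh.star z (s * z) hz.le (le_mul_of_one_le_left hz.le hs)
    rw [mul_comm s z, mul_assoc, mul_comm z s] at this
    exact le_of_mul_le_mul_left this hz

/-- The Stieltjes function of a concave rate. -/
noncomputable def stieltjes (hh : IsConcaveRate h) : StieltjesFunction ℝ where
  toFun := h
  mono' := hh.mono
  right_continuous' := fun _ => hh.continuous.continuousWithinAt

lemma measure_Ioc (hh : IsConcaveRate h) (a b : ℝ) :
    hh.stieltjes.measure (Set.Ioc a b) = ENNReal.ofReal (h b - h a) :=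
  StieltjesFunction.measure_Ioc _ _ _

end IsConcaveRate

/-- Treating the truncated identity as a rate lets the sensitivity estimate for rates also give the
growth of `truncRatio`. -/
lemma isConcaveRate_min_one : IsConcaveRate (fun z => max 0 (min z 1)) where
  mono := fun a b hab => max_le_max le_rfl (min_le_min hab le_rfl)
  zero := fun z hz => max_eq_left ((min_le_left _ _).trans hz)
  continuous := by fun_prop
  star := by
    intro x y hx hxy
    have hy : 0 ≤ y := hx.trans hxy
    simp only [max_eq_right (le_min hx zero_le_one), max_eq_right (le_min hy zero_le_one)]
    rcases le_total y 1 with h1 | h1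
    · rw [min_eq_left h1, min_eq_left (hxy.trans h1), mul_comm]
    · rw [min_eq_right h1]
      rcases le_total x 1 with h2 | h2
      · rw [min_eq_left h2]; nlinarith
      · rw [min_eq_right h2]; linarith
  le_self := fun z hz => max_le hz (min_le_left _ _)
  half_le := ⟨1, one_pos, fun z h0 h1 => by
    rw [min_eq_left h1, max_eq_right h0]; linarith⟩

lemma ConcaveOn.nnreal_ineq {G : ℝ≥0 → ℝ≥0} (hG : ConcaveOn ℝ≥0 Set.univ G) (x y a b : ℝ≥0)
    (hab : a + b = 1) : a * G x + b * G y ≤ G (a * x + b * y) :=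
  hG.2 (Set.mem_univ x) (Set.mem_univ y) zero_le zero_le hab

/-- A concave function on a half-line that is bounded below cannot decrease: `y` lies at fraction `1
/ (n + 1)` of the segment from `x` to `x + (n + 1)(y - x)`, where `G ≥ 0`; then `n → ∞`. -/
lemma ConcaveOn.nnreal_mono {G : ℝ≥0 → ℝ≥0} (hG : ConcaveOn ℝ≥0 Set.univ G) : Monotone G := by
  intro x y hxy
  rcases hxy.eq_or_lt with rfl | hlt
  · exact le_rfl
  rw [← NNReal.coe_le_coe]
  have key : ∀ n : ℕ, (1 - 1 / ((n : ℝ) + 1)) * G x ≤ G y := by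
    intro n
    have hn1 : (1 / ((n : ℝ≥0) + 1)) ≤ 1 := by
      rw [div_le_one (by positivity)]; exact le_add_of_nonneg_left zero_le
    have h := hG.nnreal_ineq x (x + (n + 1) * (y - x)) (1 - 1 / ((n : ℝ≥0) + 1))
      (1 / ((n : ℝ≥0) + 1)) (tsub_add_cancel_of_le hn1)
    have e : (1 - 1 / ((n : ℝ≥0) + 1)) * x + 1 / ((n : ℝ≥0) + 1) * (x + (n + 1) * (y - x)) = y := by
      apply NNReal.coe_injective
      push_cast [NNReal.coe_sub hn1, NNReal.coe_sub hxy]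
      field_simp
      ring
    rw [e] at h
    have h' : (((1 - 1 / ((n : ℝ≥0) + 1)) * G x + 1 / ((n : ℝ≥0) + 1) *
      G (x + (n + 1) * (y - x)) : ℝ≥0) : ℝ) ≤ G y := by exact_mod_cast h
    rw [NNReal.coe_add, NNReal.coe_mul, NNReal.coe_sub hn1] at h'
    push_cast at h'
    have : (0 : ℝ) ≤ 1 / ((n : ℝ) + 1) * (G (x + (n + 1) * (y - x)) : ℝ) := by positivity
    linarith
  have hl : Tendsto (fun n : ℕ => (1 - 1 / ((n : ℝ) + 1)) * (G x : ℝ)) atTop (𝓝 ((1 - 0) * G x)) :=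
    (tendsto_const_nhds.sub tendsto_one_div_add_atTop_nhds_zero_nat).mul_const _
  have := le_of_tendsto' hl key
  simpa using this

/-- Concavity and `G 0 = 0` make `G z / z` nonincreasing; its limit at the origin is one, so `G z ≤
z`. Both facts together make `G` 1-Lipschitz, which gives continuity also at the origin. -/
lemma IsConnectionFun.isConcaveRate {α : ℝ} {G : ℝ≥0 → ℝ≥0} (hG : IsConnectionFun α G)
    (hα : α ≤ 1) : IsConcaveRate (fun z => (G z.toNNReal : ℝ)) := by
  have hc := hG.concave hα
  obtain ⟨K, hK⟩ := hG.linear_bound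
  have hG0 : G 0 = 0 := by simpa using hK 0
  have hm := hc.nnreal_mono
  have hstar : ∀ x y : ℝ≥0, x ≤ y → x * G y ≤ y * G x := by
    intro x y hxy
    rcases eq_or_ne y 0 with rfl | hy
    · simp [le_antisymm hxy zero_le]
    have h1 : x / y ≤ 1 := by rw [div_le_one (pos_iff_ne_zero.2 hy)]; exact hxy
    have h := hc.nnreal_ineq y 0 (x / y) (1 - x / y) (add_tsub_cancel_of_le h1)
    rw [hG0, mul_zero, add_zero, add_zero, div_mul_cancel₀ x hy] at h
    calc x * G y = y * (x / y * G y) := by field_simp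
      _ ≤ _ := by gcongr
  have hle : ∀ z : ℝ≥0, (G z : ℝ) ≤ z := by
    intro z
    rcases eq_or_ne z 0 with rfl | hz
    · simp [hG0]
    have hzp : (0 : ℝ) < z := by exact_mod_cast pos_iff_ne_zero.2 hz
    have key : ∀ η : ℝ, 0 < η → (G z : ℝ) ≤ z * (1 + η) := by
      intro η hη
      obtain ⟨z₀, hz₀, h1⟩ := hG.exists_local hη
      set w : ℝ≥0 := min z z₀.toNNReal with hw
      have hwp : 0 < w := lt_min (pos_iff_ne_zero.2 hz) (Real.toNNReal_pos.2 hz₀)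
      have hw1 : (w : ℝ) ≤ z₀ := by
        have : (w : ℝ) ≤ (z₀.toNNReal : ℝ) := by exact_mod_cast min_le_right _ _
        rwa [Real.coe_toNNReal _ hz₀.le] at this
      have h2 := (abs_le.1 (h1 w hw1)).2
      have h3 : (w : ℝ) * G z ≤ z * G w := by exact_mod_cast hstar w z (min_le_left _ _)
      have hwp' : (0 : ℝ) < w := by exact_mod_cast hwp
      have h4 : (w : ℝ) * G z ≤ w * (z * (1 + η)) := by nlinarith
      exact le_of_mul_le_mul_left h4 hwp'
    refine le_of_forall_pos_le_add fun e he => ?_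
    have := key (e / z) (by positivity)
    rwa [mul_add, mul_one, mul_div_cancel₀ _ hzp.ne'] at this
  refine ⟨?_, ?_, ?_, ?_, ?_, ?_⟩
  · exact fun a b hab => by exact_mod_cast hm (Real.toNNReal_mono hab)
  · intro z hz; simp [Real.toNNReal_of_nonpos hz, hG0]
  · have hlip : LipschitzWith 1 G := by
      have hone : ∀ x y : ℝ≥0, x ≤ y → (G y : ℝ) - G x ≤ y - x := by
        intro x y hxy
        rcases eq_or_ne x 0 with rfl | hx
        · simpa [hG0] using hle y
        have hxp : (0 : ℝ) < x := by exact_mod_cast pos_iff_ne_zero.2 hx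
        have h1 : (x : ℝ) * G y ≤ y * G x := by exact_mod_cast hstar x y hxy
        have h2 := hle x
        have h3 : (x : ℝ) ≤ y := by exact_mod_cast hxy
        have h4 : (x : ℝ) * (G y - G x) ≤ x * (y - x) := by nlinarith
        exact le_of_mul_le_mul_left h4 hxp
      refine LipschitzWith.of_dist_le_mul fun x y => ?_
      rw [NNReal.dist_eq, NNReal.dist_eq, NNReal.coe_one, one_mul]
      rcases le_total x y with hxy | hxy
      · have h1 := hone x y hxy
        have h2 : (G x : ℝ) ≤ G y := by exact_mod_cast hm hxy
        have h3 : (x : ℝ) ≤ y := by exact_mod_cast hxy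
        rw [abs_sub_comm, abs_of_nonneg (by linarith), abs_sub_comm, abs_of_nonneg (by linarith)]
        exact h1
      · have h1 := hone y x hxy
        have h2 : (G y : ℝ) ≤ G x := by exact_mod_cast hm hxy
        have h3 : (y : ℝ) ≤ x := by exact_mod_cast hxy
        rw [abs_of_nonneg (by linarith), abs_of_nonneg (by linarith)]
        exact h1
    exact NNReal.continuous_coe.comp (hlip.continuous.comp continuous_real_toNNReal)
  · intro x y hx hxy
    have := hstar x.toNNReal y.toNNReal (Real.toNNReal_mono hxy)
    have h2 : (x.toNNReal : ℝ) * G y.toNNReal ≤ y.toNNReal * G x.toNNReal := by exact_mod_cast this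
    rwa [Real.coe_toNNReal _ hx, Real.coe_toNNReal _ (hx.trans hxy)] at h2
  · intro z hz
    have := hle z.toNNReal
    rwa [Real.coe_toNNReal _ hz] at this
  · obtain ⟨z₀, hz₀, h1⟩ := hG.exists_local (show (0 : ℝ) < 1 / 2 by norm_num)
    refine ⟨z₀, hz₀, fun z hz hz1 => ?_⟩
    have h2 := (abs_le.1 (h1 z.toNNReal (by rwa [Real.coe_toNNReal _ hz]))).1
    rw [Real.coe_toNNReal _ hz] at h2
    linarith

lemma measurableSet_and {β : Type*} [MeasurableSpace β] {p q : β → Prop}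
    (hp : MeasurableSet {a | p a}) (hq : MeasurableSet {a | q a}) :
    MeasurableSet {a | p a ∧ q a} := hp.inter hq

/-! ### Sensitivity of the expected rate to scaling. -/

section Sensitivity

variable {π : Measure ℝ≥0} [IsProbabilityMeasure π] {α : ℝ} {h : ℝ → ℝ}

lemma exists_truncMean_ge (hinf : ∫⁻ w, (w : ℝ≥0∞) ∂π = ∞) (R : ℝ) :
    ∃ M > 0, R ≤ truncMean π M := by
  have h1 : ∫⁻ w, (w : ℝ≥0∞) ∂π = ⨆ n : ℕ, ∫⁻ w, ((min w n : ℝ≥0) : ℝ≥0∞) ∂π := by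
    rw [← lintegral_iSup]
    · refine lintegral_congr fun w => le_antisymm ?_ ?_
      · obtain ⟨n, hn⟩ := exists_nat_ge w
        refine le_trans ?_ (le_iSup _ n)
        rw [min_eq_left hn]
      · exact iSup_le fun n => by exact_mod_cast min_le_left _ _
    · intro n; fun_prop
    · intro a b hab w
      simp only
      have : (a : ℝ≥0) ≤ b := by exact_mod_cast hab
      exact_mod_cast min_le_min le_rfl this
  rw [hinf] at h1
  have h2 : ENNReal.ofReal R < ⨆ n : ℕ, ∫⁻ w, ((min w n : ℝ≥0) : ℝ≥0∞) ∂π := by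
    rw [← h1]; exact ENNReal.ofReal_lt_top
  obtain ⟨n, hn⟩ := lt_iSup_iff.1 h2
  have key : ∀ k : ℕ, truncMean π k = (∫⁻ w, ((min w k : ℝ≥0) : ℝ≥0∞) ∂π).toReal := by
    intro k
    rw [truncMean, integral_eq_lintegral_of_nonneg_ae]
    · congr 1
      refine lintegral_congr fun w => ?_
      rw [← NNReal.coe_natCast, ← NNReal.coe_min, ENNReal.ofReal_coe_nnreal]
    · exact ae_of_all _ fun w => le_min w.2 (by positivity)
    · fun_prop
  have hfin : ∀ k : ℕ, ∫⁻ w, ((min w k : ℝ≥0) : ℝ≥0∞) ∂π ≠ ∞ := by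
    intro k
    refine ne_top_of_le_ne_top (b := ((k : ℝ≥0) : ℝ≥0∞)) ENNReal.coe_ne_top ?_
    refine (lintegral_mono (g := fun _ => ((k : ℝ≥0) : ℝ≥0∞)) fun w => ?_).trans (by simp)
    exact ENNReal.coe_le_coe.2 (min_le_right _ _)
  refine ⟨(n + 1 : ℕ), by positivity, ?_⟩
  rw [key, ← ENNReal.ofReal_le_iff_le_toReal (hfin _)]
  refine hn.le.trans (lintegral_mono fun w => ?_)
  have : (n : ℝ≥0) ≤ (n + 1 : ℕ) := by exact_mod_cast Nat.le_succ n
  exact ENNReal.coe_le_coe.2 (min_le_min le_rfl this)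

lemma IsConcaveRate.integrable (hh : IsConcaveRate h) (x : ℝ) (hx : 0 ≤ x) (Y : ℝ) :
    Integrable (fun w : ℝ≥0 => h (x * min (w : ℝ) Y)) π := by
  refine integrable_of_bounded ?_ (fun w => hh.nonneg _) (b := h (x * Y)) (fun w => ?_)
  · exact hh.continuous.measurable.comp (by fun_prop)
  · exact hh.mono (by gcongr; exact min_le_right _ _)

/-- The truncated increment `h (s x w) - h (x w)` for `w ≤ Y`. -/
noncomputable def rateIncr (h : ℝ → ℝ) (s x Y : ℝ) (w : ℝ≥0) : ℝ :=
  {w : ℝ≥0 | (w : ℝ) ≤ Y}.indicator (fun w => h (s * (x * w)) - h (x * w)) w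

lemma IsConcaveRate.measurable_rateIncr (hh : IsConcaveRate h) (s x Y : ℝ) :
    Measurable (rateIncr h s x Y) := by
  refine Measurable.indicator (Measurable.sub ?_ ?_)
    (measurableSet_le (by fun_prop) measurable_const)
  · exact hh.continuous.measurable.comp (by fun_prop)
  · exact hh.continuous.measurable.comp (by fun_prop)

lemma IsConcaveRate.rateIncr_nonneg (hh : IsConcaveRate h) {s x : ℝ} (hs : 1 ≤ s) (hx : 0 ≤ x)
    (Y : ℝ) (w : ℝ≥0) : 0 ≤ rateIncr h s x Y w := by
  refine Set.indicator_nonneg (fun w _ => sub_nonneg.2 (hh.mono ?_)) w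
  exact le_mul_of_one_le_left (by positivity) hs

lemma IsConcaveRate.rateIncr_le (hh : IsConcaveRate h) {s x : ℝ} (hs : 1 ≤ s) (hx : 0 ≤ x)
    (Y : ℝ) (w : ℝ≥0) : rateIncr h s x Y w ≤ s * h (x * Y) := by
  unfold rateIncr
  by_cases hw : (w : ℝ) ≤ Y
  · rw [Set.indicator_of_mem (by exact hw)]
    have h1 := hh.mul_le hs (mul_nonneg hx w.coe_nonneg)
    have h2 := hh.nonneg (x * w)
    have h3 : h (x * w) ≤ h (x * Y) := hh.mono (mul_le_mul_of_nonneg_left hw hx)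
    have : s * h (x * w) ≤ s * h (x * Y) := by gcongr
    linarith
  · rw [Set.indicator_of_notMem (by exact hw)]
    exact mul_nonneg (by linarith) (hh.nonneg _)

lemma IsConcaveRate.integrable_rateIncr (hh : IsConcaveRate h) {s x : ℝ} (hs : 1 ≤ s) (hx : 0 ≤ x)
    (Y : ℝ) : Integrable (rateIncr h s x Y) π :=
  integrable_of_bounded (hh.measurable_rateIncr s x Y) (hh.rateIncr_nonneg hs hx Y)
    (hh.rateIncr_le hs hx Y)

/-- Layer-cake formula: `h (x min(w, Y))` is the Stieltjes mass of `(0, x min(w, Y)]`, and Tonelli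
applies. -/
lemma lintegral_rate_eq (hh : IsConcaveRate h) {x : ℝ} (hx : 0 < x) (Y : ℝ) :
    ∫⁻ w, ENNReal.ofReal (h (x * min (w : ℝ) Y)) ∂π =
      ∫⁻ z in Set.Ioc 0 (x * Y), π {w | z / x ≤ (w : ℝ)} ∂hh.stieltjes.measure := by
  have h1 : ∀ w : ℝ≥0, ENNReal.ofReal (h (x * min (w : ℝ) Y)) =
      ∫⁻ z in Set.Ioc 0 (x * Y), {p : ℝ≥0 × ℝ | p.2 / x ≤ (p.1 : ℝ)}.indicator 1 (w, z)
        ∂hh.stieltjes.measure := by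
    intro w
    have : (fun z => {p : ℝ≥0 × ℝ | p.2 / x ≤ (p.1 : ℝ)}.indicator (1 : ℝ≥0 × ℝ → ℝ≥0∞) (w, z)) =
      {z : ℝ | z / x ≤ w}.indicator 1 := rfl
    have hms : MeasurableSet {z : ℝ | z / x ≤ w} := measurableSet_le (by fun_prop) measurable_const
    rw [this, lintegral_indicator_one hms, Measure.restrict_apply hms]
    have e : {z : ℝ | z / x ≤ w} ∩ Set.Ioc 0 (x * Y) = Set.Ioc 0 (x * min (w : ℝ) Y) := by
      ext z
      simp only [Set.mem_inter_iff, Set.mem_ofPred_eq, Set.mem_Ioc, div_le_iff₀ hx]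
      rw [mul_min_of_nonneg _ _ hx.le, le_min_iff, mul_comm (w : ℝ) x]
      tauto
    rw [e, hh.measure_Ioc, hh.zero 0 le_rfl, sub_zero]
  simp only [h1]
  rw [lintegral_lintegral_swap]
  · refine lintegral_congr fun z => ?_
    have : (fun w => {p : ℝ≥0 × ℝ | p.2 / x ≤ (p.1 : ℝ)}.indicator (1 : ℝ≥0 × ℝ → ℝ≥0∞) (w, z)) =
      {w : ℝ≥0 | z / x ≤ w}.indicator 1 := rfl
    rw [this, lintegral_indicator_one (measurableSet_le measurable_const (by fun_prop))]
  · refine (Measurable.indicator measurable_one ?_).aemeasurable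
    exact measurableSet_le (by fun_prop) (by fun_prop)

/-- The same formula for increments: `z` lies in `(x w, s x w)` exactly when `z / (s x) < w < z /
x`, and `z ≤ x Y` then forces `w < Y`. -/
lemma lintegral_rateIncr_ge (hh : IsConcaveRate h) {x : ℝ} (hx : 0 < x) {s : ℝ} (hs : 1 < s)
    (M Y : ℝ) :
    ∫⁻ z in Set.Ioc (x * M) (x * Y), π {w | z / (s * x) < (w : ℝ) ∧ (w : ℝ) < z / x}
      ∂hh.stieltjes.measure ≤ ∫⁻ w, ENNReal.ofReal (rateIncr h s x Y w) ∂π := by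
  set S : Set (ℝ≥0 × ℝ) := {p | p.2 / (s * x) < (p.1 : ℝ) ∧ (p.1 : ℝ) < p.2 / x} with hS
  have hSm : MeasurableSet S := measurableSet_and (measurableSet_lt (by fun_prop) (by fun_prop))
    (measurableSet_lt (by fun_prop) (by fun_prop))
  have hsx : 0 < s * x := by positivity
  have e1 : ∀ z : ℝ, π {w | z / (s * x) < (w : ℝ) ∧ (w : ℝ) < z / x} =
      ∫⁻ w, S.indicator 1 (w, z) ∂π := by
    intro z
    have : (fun w => S.indicator (1 : ℝ≥0 × ℝ → ℝ≥0∞) (w, z)) =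
      {w : ℝ≥0 | z / (s * x) < (w : ℝ) ∧ (w : ℝ) < z / x}.indicator 1 := rfl
    rw [this, lintegral_indicator_one]
    exact measurableSet_and (measurableSet_lt measurable_const (by fun_prop))
      (measurableSet_lt (by fun_prop) measurable_const)
  simp only [e1]
  rw [lintegral_lintegral_swap]
  · refine lintegral_mono fun w => ?_
    have : (fun z => S.indicator (1 : ℝ≥0 × ℝ → ℝ≥0∞) (w, z)) =
      {z : ℝ | z / (s * x) < w ∧ w < z / x}.indicator 1 := rfl
    have hms : MeasurableSet {z : ℝ | z / (s * x) < w ∧ w < z / x} :=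
      measurableSet_and (measurableSet_lt (by fun_prop) measurable_const)
        (measurableSet_lt measurable_const (by fun_prop))
    rw [this, lintegral_indicator_one hms, Measure.restrict_apply hms]
    by_cases hw : (w : ℝ) ≤ Y
    · rw [rateIncr, Set.indicator_of_mem (by exact hw), ← hh.measure_Ioc]
      refine measure_mono fun z hz => ?_
      obtain ⟨⟨h1, h2⟩, -⟩ := hz
      rw [div_lt_iff₀ hsx] at h1
      rw [lt_div_iff₀ hx] at h2
      constructor <;> nlinarith
    · refine le_trans (le_of_eq ?_) (zero_le)
      convert measure_empty (μ := hh.stieltjes.measure)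
      refine Set.eq_empty_of_forall_notMem ?_
      rintro z ⟨⟨h1, h2⟩, h3, h4⟩
      rw [lt_div_iff₀ hx] at h2
      apply hw
      nlinarith
  · exact (Measurable.indicator measurable_one (measurable_swap hSm)).aemeasurable

/-- Scaling the argument by `s > 1` increases the expected rate by a fixed factor, and already
the bounded weights account for this. -/
lemma IsConcaveRate.exists_sensitivity (hh : IsConcaveRate h) (hRV : HasRVTail π α) (hα : 0 < α)
    (hinf : ∫⁻ w, (w : ℝ≥0∞) ∂π = ∞) {s : ℝ} (hs : 1 < s) :
    ∃ c > 0, ∃ x₀ > 0, ∃ M₁ > 0, ∀ x, 0 < x → x ≤ x₀ → ∀ Y ≥ M₁,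
      c * ∫ w, h (x * min (w : ℝ) Y) ∂π ≤ ∫ w, rateIncr h s x Y w ∂π := by
  obtain ⟨c, hc, M, hM, hgrow⟩ := hRV.exists_growth hα (show 0 < s - 1 by linarith)
  -- The tail growth fails to control `z ≤ x M`, a part worth at most `h (x M) ≤ x M`. The infinite
  -- mean makes this at most `I / 2`, since `I ≥ (x / 2) E min(W, M₁) ≥ 2 x M`; the bound `x ≤ z₀ /
  -- M₁` below allows `h z ≥ z / 2` here.
  obtain ⟨M₁, hM₁, hbig⟩ := exists_truncMean_ge hinf (4 * M)
  obtain ⟨z₀, hz₀, hhalf⟩ := hh.half_le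
  refine ⟨c / 2, by positivity, z₀ / M₁, by positivity, M₁, hM₁, fun x hx hx0 Y hY => ?_⟩
  set I := ∫ w, h (x * min (w : ℝ) Y) ∂π with hI
  set J := ∫ w, rateIncr h s x Y w ∂π with hJ
  have hIe : ENNReal.ofReal I = ∫⁻ w, ENNReal.ofReal (h (x * min (w : ℝ) Y)) ∂π :=
    ofReal_integral_eq_lintegral_ofReal (hh.integrable x hx.le Y) (ae_of_all _ fun w => hh.nonneg _)
  have hJe : ENNReal.ofReal J = ∫⁻ w, ENNReal.ofReal (rateIncr h s x Y w) ∂π :=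
    ofReal_integral_eq_lintegral_ofReal (hh.integrable_rateIncr hs.le hx.le Y)
      (ae_of_all _ fun w => hh.rateIncr_nonneg hs.le hx.le Y w)
  have hJ0 : 0 ≤ J := integral_nonneg fun w => hh.rateIncr_nonneg hs.le hx.le Y w
  have hgrow' : ∀ z ∈ Set.Ioc (x * M) (x * Y), ENNReal.ofReal c * π {w | z / x ≤ (w : ℝ)} ≤
      π {w | z / (s * x) < (w : ℝ) ∧ (w : ℝ) < z / x} := by
    intro z hz
    have hz1 : M ≤ z / x := by rw [le_div_iff₀ hx]; nlinarith [hz.1]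
    have h1 := hgrow (z / x) hz1
    have h2 : tailFn π (z / x / (1 + (s - 1))) ≤
        π.real {w | z / (s * x) < (w : ℝ) ∧ (w : ℝ) < z / x} + π.real {w | z / x ≤ (w : ℝ)} := by
      refine (measureReal_mono ?_).trans (measureReal_union_le _ _)
      intro w hw
      have hw' : z / x / (1 + (s - 1)) < (w : ℝ) := hw
      rw [show 1 + (s - 1) = s by ring, div_div, mul_comm x s] at hw'
      rcases lt_or_ge (w : ℝ) (z / x) with h3 | h3
      · exact Or.inl ⟨hw', h3⟩
      · exact Or.inr h3
    rw [← ENNReal.ofReal_toReal (measure_ne_top π {w | z / x ≤ (w : ℝ)}),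
      ← ENNReal.ofReal_mul hc.le, ← ENNReal.ofReal_toReal (measure_ne_top π
        {w | z / (s * x) < (w : ℝ) ∧ (w : ℝ) < z / x})]
    refine ENNReal.ofReal_le_ofReal ?_
    change c * π.real _ ≤ π.real _
    linarith
  have hxM : 0 < x * M := by positivity
  have key : ENNReal.ofReal c * ENNReal.ofReal I ≤
      ENNReal.ofReal c * ENNReal.ofReal (h (x * M)) + ENNReal.ofReal J := by
    rw [hIe, lintegral_rate_eq hh hx, hJe]
    have hsplit : ∫⁻ z in Set.Ioc 0 (x * Y), π {w | z / x ≤ (w : ℝ)} ∂hh.stieltjes.measure ≤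
        ∫⁻ z in Set.Ioc 0 (x * M), π {w | z / x ≤ (w : ℝ)} ∂hh.stieltjes.measure +
        ∫⁻ z in Set.Ioc (x * M) (x * Y), π {w | z / x ≤ (w : ℝ)} ∂hh.stieltjes.measure := by
      refine (lintegral_mono_set ?_).trans (lintegral_union_le _ _ _)
      intro z hz
      rcases le_or_gt z (x * M) with h1 | h1
      · exact Or.inl ⟨hz.1, h1⟩
      · exact Or.inr ⟨h1, hz.2⟩
    refine (mul_le_mul_right hsplit _).trans ?_
    rw [mul_add]
    refine add_le_add ?_ ?_
    · gcongr
      calc _ ≤ ∫⁻ z in Set.Ioc 0 (x * M), 1 ∂hh.stieltjes.measure :=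
            lintegral_mono fun z => prob_le_one
        _ = _ := by rw [setLIntegral_one, hh.measure_Ioc, hh.zero 0 le_rfl, sub_zero]
    · refine le_trans ?_ (lintegral_rateIncr_ge hh hx hs M Y)
      rw [← lintegral_const_mul' _ _ ENNReal.ofReal_ne_top]
      exact setLIntegral_mono' measurableSet_Ioc hgrow'
  have hI0 : 0 ≤ I := integral_nonneg fun w => hh.nonneg _
  rw [← ENNReal.ofReal_mul hc.le, ← ENNReal.ofReal_mul hc.le, ← ENNReal.ofReal_add
    (mul_nonneg hc.le (hh.nonneg _)) hJ0, ENNReal.ofReal_le_ofReal_iff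
    (add_nonneg (mul_nonneg hc.le (hh.nonneg _)) hJ0)] at key
  have h1 : h (x * M) ≤ x * M := hh.le_self _ hxM.le
  have h2 : 2 * (x * M) ≤ I := by
    have h3 : x / 2 * truncMean π M₁ ≤ I := by
      rw [truncMean, ← integral_const_mul]
      refine integral_mono ((integrable_min hM₁.le).const_mul _) (hh.integrable x hx.le Y)
        fun w => ?_
      have hm0 : 0 ≤ min (w : ℝ) M₁ := le_min w.2 hM₁.le
      have h4 : h (x * min (w : ℝ) M₁) ≤ h (x * min (w : ℝ) Y) :=
        hh.mono (by gcongr)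
      have h5 := hhalf (x * min (w : ℝ) M₁) (by positivity) (by
        calc x * min (w : ℝ) M₁ ≤ z₀ / M₁ * M₁ := by gcongr; exact min_le_right _ _
          _ = z₀ := by field_simp)
      change x / 2 * min (w : ℝ) M₁ ≤ h (x * min (w : ℝ) Y)
      linarith
    have : x / 2 * (4 * M) ≤ x / 2 * truncMean π M₁ := by gcongr
    linarith
  have h3 : c * h (x * M) ≤ c * (I / 2) := by gcongr; linarith
  linarith

end Sensitivity

/-! ### Weights of infinite mean: the scale of the total weight and sums of rates. -/

section InfiniteMean

variable {Ω : Type*} [MeasurableSpace Ω] {μ : Measure Ω} [IsProbabilityMeasure μ]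
  {X : ℕ → Ω → ℝ≥0} {π : Measure ℝ≥0} [IsProbabilityMeasure π] {α : ℝ} {h : ℝ → ℝ}

/-- The normalized truncated mean `E min (W / y, 1)`. -/
noncomputable def truncRatio (π : Measure ℝ≥0) (y : ℝ) : ℝ := truncMean π y / y

lemma truncMean_mono {y y' : ℝ} (hy : 0 ≤ y) (hyy : y ≤ y') : truncMean π y ≤ truncMean π y' :=
  integral_mono (integrable_min hy) (integrable_min (hy.trans hyy)) fun w => by
    change min (w : ℝ) y ≤ min (w : ℝ) y'
    gcongr

lemma truncRatio_antitoneOn : AntitoneOn (truncRatio π) (Set.Ioi 0) := by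
  intro y hy y' hy' hyy
  simp only [Set.mem_Ioi] at hy hy'
  rw [truncRatio, truncRatio, div_le_div_iff₀ hy' hy, truncMean, truncMean, ← integral_mul_const,
    ← integral_mul_const]
  refine integral_mono ((integrable_min hy'.le).mul_const _) ((integrable_min hy.le).mul_const _)
    fun w => ?_
  change min (w : ℝ) y' * y ≤ min (w : ℝ) y * y'
  have hw : (0 : ℝ) ≤ w := w.coe_nonneg
  rcases le_total (w : ℝ) y with h1 | h1
  · rw [min_eq_left h1, min_eq_left (h1.trans hyy)]; gcongr
  · rw [min_eq_right h1, mul_comm y]; gcongr; exact min_le_right _ _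

lemma truncRatio_nonneg {π : Measure ℝ≥0} (y : ℝ) : 0 ≤ truncRatio π y := by
  rcases le_total 0 y with hy | hy
  · exact div_nonneg (integral_nonneg fun w => le_min w.coe_nonneg hy) hy
  · refine div_nonneg_of_nonpos ?_ hy
    exact integral_nonpos fun w => (min_le_right _ _).trans hy

lemma tailFn_le_truncRatio {y : ℝ} (hy : 0 < y) : tailFn π y ≤ truncRatio π y := by
  rw [truncRatio, le_div_iff₀ hy, mul_comm]
  exact mul_tailFn_le_truncMean hy.le

/-- Sensitivity of `min(z, 1)` at `x = 1 / y`, `s = 2`, `Y = y`: the increment is `min(w, y/2) /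
(y/2) - min(w, y) / y`, and for `w > y` both terms of this difference equal one. -/
lemma exists_truncRatio_growth (hRV : HasRVTail π α) (hα : 0 < α)
    (hinf : ∫⁻ w, (w : ℝ≥0∞) ∂π = ∞) :
    ∃ c > 0, ∃ M > 0, ∀ y ≥ M, (1 + c) * truncRatio π y ≤ truncRatio π (y / 2) := by
  obtain ⟨c, hc, x₀, hx₀, M₁, hM₁, hsens⟩ :=
    isConcaveRate_min_one.exists_sensitivity hRV hα hinf (one_lt_two)
  refine ⟨c, hc, max M₁ x₀⁻¹, by positivity, fun y hy => ?_⟩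
  have hy1 : M₁ ≤ y := (le_max_left _ _).trans hy
  have hy2 : x₀⁻¹ ≤ y := (le_max_right _ _).trans hy
  have hy0 : 0 < y := hM₁.trans_le hy1
  have key := hsens y⁻¹ (by positivity) (inv_le_of_inv_le₀ hx₀ hy2) y hy1
  have e1 : ∫ w : ℝ≥0, max 0 (min (y⁻¹ * min (w : ℝ) y) 1) ∂π = truncRatio π y := by
    rw [truncRatio, truncMean, ← integral_div]
    congr with w
    have h1 : y⁻¹ * min (w : ℝ) y ≤ 1 := by
      rw [inv_mul_le_iff₀ hy0, mul_one]; exact min_le_right _ _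
    rw [min_eq_left h1, max_eq_right, inv_mul_eq_div]
    have := le_min w.coe_nonneg hy0.le
    positivity
  have e2 : ∫ w, rateIncr (fun z => max 0 (min z 1)) 2 y⁻¹ y w ∂π ≤
      truncRatio π (y / 2) - truncRatio π y := by
    rw [truncRatio, truncRatio, truncMean, truncMean, ← integral_div, ← integral_div,
      ← integral_sub ((integrable_min (by positivity)).div_const _)
        ((integrable_min hy0.le).div_const _)]
    refine integral_mono (isConcaveRate_min_one.integrable_rateIncr one_le_two (by positivity) _)
      (((integrable_min (by positivity)).div_const _).sub
        ((integrable_min hy0.le).div_const _)) fun w => ?_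
    change rateIncr (fun z => max 0 (min z 1)) 2 y⁻¹ y w ≤
      min (w : ℝ) (y / 2) / (y / 2) - min (w : ℝ) y / y
    have hw : (0 : ℝ) ≤ w := w.coe_nonneg
    by_cases hwy : (w : ℝ) ≤ y
    · rw [rateIncr, Set.indicator_of_mem (by exact hwy)]
      have h1 : y⁻¹ * w ≤ 1 := by rw [inv_mul_le_iff₀ hy0, mul_one]; exact hwy
      rw [max_eq_right (by positivity), max_eq_right (by positivity), min_eq_left h1,
        min_eq_left hwy]
      apply le_of_eq
      rcases le_total (w : ℝ) (y / 2) with h2 | h2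
      · rw [min_eq_left h2, min_eq_left]
        · field_simp
        · rw [← mul_assoc, mul_comm 2, mul_assoc, inv_mul_le_iff₀ hy0]; linarith
      · rw [min_eq_right h2, min_eq_right]
        · field_simp
        · rw [← mul_assoc, mul_comm 2, mul_assoc, le_inv_mul_iff₀ hy0]; linarith
    · rw [rateIncr, Set.indicator_of_notMem (by exact hwy)]
      push Not at hwy
      rw [min_eq_right hwy.le, min_eq_right (by linarith), div_self (by positivity),
        div_self (by positivity), sub_self]
  rw [e1] at key
  linarith

lemma tendsto_truncRatio : Tendsto (truncRatio π) atTop (𝓝 0) := by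
  have h1 : Tendsto (fun y : ℝ => ∫ w : ℝ≥0, min (w : ℝ) y / y ∂π) atTop
      (𝓝 (∫ _ : ℝ≥0, (0 : ℝ) ∂π)) := by
    refine tendsto_integral_filter_of_dominated_convergence (fun _ => 1) ?_ ?_
      (integrable_const _) ?_
    · exact .of_forall fun y => Measurable.aestronglyMeasurable (by fun_prop)
    · filter_upwards [eventually_gt_atTop 0] with y hy
      refine ae_of_all _ fun w => ?_
      rw [Real.norm_of_nonneg (div_nonneg (le_min w.coe_nonneg hy.le) hy.le), div_le_one hy]
      exact min_le_right _ _
    · refine ae_of_all _ fun w => ?_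
      refine squeeze_zero' ?_ ?_ (tendsto_const_nhds.div_atTop tendsto_id : Tendsto
        (fun y : ℝ => (w : ℝ) / y) atTop (𝓝 0))
      · filter_upwards [eventually_gt_atTop 0] with y hy
        exact div_nonneg (le_min w.coe_nonneg hy.le) hy.le
      · filter_upwards [eventually_gt_atTop 0] with y hy
        gcongr
        exact min_le_left _ _
  simp only [integral_zero, integral_div] at h1
  exact h1

/-- The scale of the total weight. -/
lemma exists_scale (N : ℕ) (y₀ : ℝ) (hy₀ : 0 < y₀) (hN : 1 < N * truncRatio π y₀) :
    ∃ τ ≥ y₀, 1 / 2 ≤ N * truncRatio π τ ∧ N * truncRatio π τ ≤ 1 := by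
  have hlim : Tendsto (fun k : ℕ => N * truncRatio π (y₀ * 2 ^ k)) atTop (𝓝 (N * 0)) :=
    (tendsto_truncRatio.comp ((tendsto_pow_atTop_atTop_of_one_lt one_lt_two).const_mul_atTop
      hy₀)).const_mul _
  rw [mul_zero] at hlim
  -- The first such `k` is taken: one step earlier the value exceeds one, and doubling the argument
  -- at most halves `truncRatio`.
  have hex : ∃ k : ℕ, N * truncRatio π (y₀ * 2 ^ k) ≤ 1 :=
    (hlim.eventually (ge_mem_nhds one_pos)).exists
  classical
  set k := Nat.find hex with hk
  have hk1 := Nat.find_spec hex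
  have hk0 : k ≠ 0 := by
    intro h0
    rw [← hk, h0] at hk1
    simp only [pow_zero, mul_one] at hk1
    linarith
  have hk2 := Nat.find_min hex (Nat.sub_one_lt hk0)
  rw [← hk] at hk1
  push Not at hk2
  set z := y₀ * 2 ^ (k - 1) with hz
  have hz0 : 0 < z := by positivity
  have e : y₀ * 2 ^ k = 2 * z := by
    obtain ⟨j, hj⟩ := Nat.exists_eq_succ_of_ne_zero hk0
    rw [hz, hj]; simp [pow_succ]; ring
  refine ⟨y₀ * 2 ^ k, le_mul_of_one_le_right hy₀.le (one_le_pow₀ one_le_two), ?_, hk1⟩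
  have hhalf : truncRatio π z / 2 ≤ truncRatio π (2 * z) := by
    rw [truncRatio, truncRatio, div_div, div_le_div_iff₀ (by positivity) (by positivity)]
    have := truncMean_mono (π := π) hz0.le (show z ≤ 2 * z by linarith)
    nlinarith
  rw [e]
  have hN0 : (0 : ℝ) ≤ N := by positivity
  nlinarith

/-- The total weight is of the order of its scale. -/
lemma measure_total_gt_le (hX : ∀ i, Measurable (X i)) (hlaw : ∀ i, μ.map (X i) = π) (N : ℕ)
    {y : ℝ} (hy : 0 < y) :
    μ.real {ω | y < ∑ i : Fin N, (X i ω : ℝ)} ≤ 2 * (N * truncRatio π y) := by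
  have := measure_sum_gt_le hX hlaw (f := fun w : ℝ≥0 => min (w : ℝ) y) (by fun_prop)
    (integrable_min hy.le) (fun w => le_min w.coe_nonneg hy.le) N (half_pos hy)
  refine (measureReal_mono ?_).trans (this.trans (le_of_eq ?_))
  · intro ω hω
    have hω' : y < ∑ i : Fin N, (X i ω : ℝ) := hω
    change y / 2 < ∑ i : Fin N, min (X i ω : ℝ) y
    -- Either nothing is truncated, or one truncated term already equals `y`.
    by_cases hall : ∀ i : Fin N, (X i ω : ℝ) ≤ y
    · have : ∑ i : Fin N, min (X i ω : ℝ) y = ∑ i : Fin N, (X i ω : ℝ) :=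
        Finset.sum_congr rfl fun i _ => min_eq_left (hall i)
      rw [this]; linarith
    · push Not at hall
      obtain ⟨i, hi⟩ := hall
      have := Finset.single_le_sum (f := fun i : Fin N => min (X i ω : ℝ) y)
        (fun i _ => le_min (X i ω).coe_nonneg hy.le) (Finset.mem_univ i)
      simp only [min_eq_right hi.le] at this
      linarith
  · rw [truncRatio, truncMean]; field_simp

/-- The sum of the weights truncated at `y` has mean `y · N truncRatio π y ≥ y / 2`, so a total
below `y / 4` puts it below half its mean. -/
lemma measure_total_lt_le (hX : ∀ i, Measurable (X i)) (hind : iIndepFun X μ)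
    (hlaw : ∀ i, μ.map (X i) = π) (N : ℕ) {y : ℝ} (hy : 0 < y)
    (hq : 1 / 2 ≤ N * truncRatio π y) :
    μ.real {ω | ∑ i : Fin N, (X i ω : ℝ) < y / 4} ≤ 4 / (N * truncRatio π y) := by
  have hr : truncMean π y = y * truncRatio π y := by rw [truncRatio]; field_simp
  have hpos : 0 < N * ∫ w, min (w : ℝ) y ∂π := by
    change 0 < N * truncMean π y
    rw [hr]; nlinarith
  have := measure_sum_lt_half_le hX hind hlaw (f := fun w : ℝ≥0 => min (w : ℝ) y) (by fun_prop)
    (fun w => le_min w.coe_nonneg hy.le) (fun w => min_le_right _ _) N hpos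
  refine (measureReal_mono ?_).trans (this.trans (le_of_eq ?_))
  · intro ω hω
    have hω' : ∑ i : Fin N, (X i ω : ℝ) < y / 4 := hω
    change ∑ i : Fin N, min (X i ω : ℝ) y < N * truncMean π y / 2
    have h1 : ∑ i : Fin N, min (X i ω : ℝ) y ≤ ∑ i : Fin N, (X i ω : ℝ) :=
      Finset.sum_le_sum fun i _ => min_le_left _ _
    rw [hr]
    nlinarith
  · change 4 * y / (N * truncMean π y) = _
    have hq0 : N * truncRatio π y ≠ 0 := by linarith
    rw [hr, show N * (y * truncRatio π y) = y * (N * truncRatio π y) by ring, mul_comm 4 y,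
      mul_div_mul_left _ _ hy.ne']

/-- The sum of the rates at scaling `y`. -/
noncomputable def rateSum {N : ℕ} (h : ℝ → ℝ) (y : ℝ) (x : Fin N → ℝ≥0) : ℝ :=
  ∑ j, h (y * x j)

lemma IsConcaveRate.rateSum_mono (hh : IsConcaveRate h) {N : ℕ} (x : Fin N → ℝ≥0) :
    Monotone fun y => rateSum h y x := fun a b hab =>
  Finset.sum_le_sum fun j _ => hh.mono (by gcongr)

/-- The expected truncated rate. -/
noncomputable def rateMean (π : Measure ℝ≥0) (h : ℝ → ℝ) (y Y : ℝ) : ℝ :=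
  ∫ w, h (y * min (w : ℝ) Y) ∂π

/-- The function lies above its chord on `[0, y Y]`. Since `h (y Y)` bounds one truncated term, `N
truncRatio π Y` bounds from below the mean of the sum measured in such terms, which is what
Chebyshev needs. -/
lemma IsConcaveRate.mul_truncRatio_le (hh : IsConcaveRate h) {y Y : ℝ} (hy : 0 ≤ y) (hY : 0 < Y) :
    h (y * Y) * truncRatio π Y ≤ rateMean π h y Y := by
  rw [truncRatio, truncMean, mul_div_assoc', ← integral_const_mul, ← integral_div, rateMean]
  refine integral_mono (((integrable_min hY.le).const_mul _).div_const _) (hh.integrable y hy Y)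
    fun w => ?_
  change h (y * Y) * min (w : ℝ) Y / Y ≤ h (y * min (w : ℝ) Y)
  have hm : 0 ≤ min (w : ℝ) Y := le_min w.coe_nonneg hY.le
  rcases hy.eq_or_lt with rfl | hy
  · simp [hh.zero 0 le_rfl]
  have := hh.star (y * min (w : ℝ) Y) (y * Y) (by positivity) (by gcongr; exact min_le_right _ _)
  rw [div_le_iff₀ hY]
  rw [mul_assoc, mul_assoc] at this
  have := le_of_mul_le_mul_left this hy
  linarith

/-- The exceptional event at scaling `y`. -/
def nodeBad (X : ℕ → Ω → ℝ≥0) (π : Measure ℝ≥0) (h : ℝ → ℝ) (N : ℕ) (s c R y Y : ℝ) : Set Ω :=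
  {ω | ∑ j : Fin N, rateIncr h s y Y (X j ω) < N * (c * rateMean π h y Y) / 2} ∪
    {ω | R * (N * rateMean π h y Y) < ∑ j : Fin N, h (y * min (X j ω : ℝ) Y)}

/-- Chebyshev for the increments, with terms at most `s h (y Y)` and mean at least `c h (y Y) · N
truncRatio π Y`; Markov for the truncated rates. -/
lemma measure_nodeBad_le (hX : ∀ i, Measurable (X i)) (hind : iIndepFun X μ)
    (hlaw : ∀ i, μ.map (X i) = π) (hh : IsConcaveRate h) {N : ℕ} {s c R y Y : ℝ} (hs : 1 ≤ s)
    (hc : 0 < c) (hR : 0 < R) (hy : 0 < y) (hY : 0 < Y)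
    (hsens : c * rateMean π h y Y ≤ ∫ w, rateIncr h s y Y w ∂π)
    (hq : 0 < N * truncRatio π Y) :
    μ.real (nodeBad X π h N s c R y Y) ≤ 4 * s / (c * (N * truncRatio π Y)) + 1 / R := by
  have hpos : 0 < h (y * Y) := hh.pos (by positivity)
  have hI : h (y * Y) * (N * truncRatio π Y) ≤ N * rateMean π h y Y := by
    have := hh.mul_truncRatio_le (π := π) hy.le hY
    have hN0 : (0 : ℝ) ≤ N := by positivity
    nlinarith
  have hNI : 0 < N * rateMean π h y Y := lt_of_lt_of_le (by positivity) hI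
  have hN : 0 ≤ (N : ℝ) := by positivity
  have hJ : c * (N * rateMean π h y Y) ≤ N * ∫ w, rateIncr h s y Y w ∂π := by nlinarith
  refine (measureReal_union_le _ _).trans (add_le_add ?_ ?_)
  · have := measure_sum_lt_half_le hX hind hlaw (hh.measurable_rateIncr s y Y)
      (hh.rateIncr_nonneg hs hy.le Y) (hh.rateIncr_le hs hy.le Y) N
      (lt_of_lt_of_le (by positivity) hJ)
    refine (measureReal_mono ?_).trans (this.trans ?_)
    · intro ω hω
      simp only [Set.mem_ofPred_eq] at hω ⊢
      linarith
    · calc 4 * (s * h (y * Y)) / (N * ∫ w, rateIncr h s y Y w ∂π) ≤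
          4 * (s * h (y * Y)) / (c * (h (y * Y) * (N * truncRatio π Y))) := by
            refine div_le_div_of_nonneg_left (by positivity) (by positivity) ?_
            exact (mul_le_mul_of_nonneg_left hI hc.le).trans hJ
        _ = _ := by
            have := hq.ne'
            rw [show c * (h (y * Y) * (N * truncRatio π Y)) =
              (c * (N * truncRatio π Y)) * h (y * Y) by ring,
              show 4 * (s * h (y * Y)) = 4 * s * h (y * Y) by ring,
              mul_div_mul_right _ _ hpos.ne']
  · have := measure_sum_gt_le hX hlaw (f := fun w : ℝ≥0 => h (y * min (w : ℝ) Y))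
      (hh.continuous.measurable.comp (by fun_prop)) (hh.integrable y hy.le Y)
      (fun w => hh.nonneg _) N (mul_pos hR hNI)
    refine this.trans (le_of_eq ?_)
    change N * rateMean π h y Y / (R * (N * rateMean π h y Y)) = _
    have := hNI.ne'
    rw [div_mul_eq_div_div_swap, div_self this]

/-- With `I = rateMean π h y Y`, the increment is at least `c N I / 2`, while the whole sum is at
most `(R + 2 B / Y) N I`: truncated rates give `R`, and a weight `w > Y` has `h (y w) ≤ (w / Y) h (y
Y)`, where `h (y Y) ≤ 2 N I` and the weights sum to at most `B`. -/
lemma rateSum_growth {Ω : Type*} {X : ℕ → Ω → ℝ≥0} (hh : IsConcaveRate h) {N : ℕ}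
    {s c R y Y B : ℝ} {ω : Ω} (hs : 1 ≤ s)
    (hc : 0 < c) (hR : 0 < R) (hy : 0 < y) (hY : 0 < Y)
    (hq : 1 / 2 ≤ N * truncRatio π Y) (hT : ∑ j : Fin N, (X j ω : ℝ) ≤ B)
    (hω : ω ∉ nodeBad X π h N s c R y Y) :
    rateSum h y (fun j : Fin N => X j ω) * (1 + c / (2 * (R + 2 * B / Y))) ≤
      rateSum h (s * y) (fun j : Fin N => X j ω) ∧
    c * (N * rateMean π h y Y) / 2 ≤ rateSum h (s * y) (fun j : Fin N => X j ω) := by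
  simp only [nodeBad, Set.mem_union, Set.mem_ofPred_eq, not_or, not_lt] at hω
  obtain ⟨h1, h2⟩ := hω
  set I := rateMean π h y Y with hIdef
  have hB : 0 ≤ B := le_trans (Finset.sum_nonneg fun (i : Fin N) _ => (X i ω).coe_nonneg) hT
  have hIq : h (y * Y) ≤ 2 * (N * I) := by
    have h3 := hh.mul_truncRatio_le (π := π) hy.le hY
    have h4 := hh.nonneg (y * Y)
    have hN0 : (0 : ℝ) ≤ N := by positivity
    nlinarith
  have hdiff : ∑ j : Fin N, rateIncr h s y Y (X j ω) ≤
      rateSum h (s * y) (fun j : Fin N => X j ω) - rateSum h y (fun j : Fin N => X j ω) := by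
    rw [rateSum, rateSum, ← Finset.sum_sub_distrib]
    refine Finset.sum_le_sum fun j _ => ?_
    unfold rateIncr
    by_cases hw : (X j ω : ℝ) ≤ Y
    · rw [Set.indicator_of_mem (by exact hw), mul_assoc]
    · rw [Set.indicator_of_notMem (by exact hw), sub_nonneg]
      exact hh.mono (by gcongr; exact le_mul_of_one_le_left hy.le hs)
  have hsum : rateSum h y (fun j : Fin N => X j ω) ≤ (R + 2 * B / Y) * (N * I) := by
    have h3 : rateSum h y (fun j : Fin N => X j ω) ≤
        ∑ j : Fin N, (h (y * min (X j ω : ℝ) Y) + h (y * Y) / Y * X j ω) := by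
      refine Finset.sum_le_sum fun j _ => ?_
      have hx : (0 : ℝ) ≤ X j ω := (X j ω).coe_nonneg
      have hn := hh.nonneg (y * Y)
      rcases le_or_gt (X j ω : ℝ) Y with hw | hw
      · rw [min_eq_left hw]
        have : 0 ≤ h (y * Y) / Y * X j ω := by positivity
        linarith
      · have h4 := hh.mul_le (s := X j ω / Y) (z := y * Y)
          ((one_le_div hY).2 hw.le) (by positivity)
        rw [show (X j ω : ℝ) / Y * (y * Y) = y * X j ω by field_simp] at h4
        have h5 := hh.nonneg (y * min (X j ω : ℝ) Y)
        have : h (y * Y) / Y * X j ω = X j ω / Y * h (y * Y) := by ring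
        linarith
    rw [Finset.sum_add_distrib, ← Finset.mul_sum] at h3
    have h4 : h (y * Y) / Y * ∑ j : Fin N, (X j ω : ℝ) ≤ 2 * (N * I) / Y * B := by
      have : (0 : ℝ) ≤ ∑ j : Fin N, (X j ω : ℝ) := Finset.sum_nonneg fun i _ => (X i ω).coe_nonneg
      have hn := hh.nonneg (y * Y)
      have : 0 ≤ 2 * (N * I) := hn.trans hIq
      gcongr
    calc _ ≤ R * (N * I) + 2 * (N * I) / Y * B := by linarith
      _ = _ := by ring
  have hpos : 0 < R + 2 * B / Y := by positivity
  have hs0 : 0 ≤ rateSum h y (fun j : Fin N => X j ω) := Finset.sum_nonneg fun j _ => hh.nonneg _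
  constructor
  · have : rateSum h y (fun j : Fin N => X j ω) * (c / (2 * (R + 2 * B / Y))) ≤
        c * (N * I) / 2 := by
      calc _ ≤ (R + 2 * B / Y) * (N * I) * (c / (2 * (R + 2 * B / Y))) := by gcongr
        _ = _ := by field_simp
    linarith
  · linarith

/-- Node `i` enters only through its weight, as the argument of a function common to all nodes. -/
lemma scalarMean_eq {N : ℕ} (G : ℝ≥0 → ℝ≥0) (x : Fin N → ℝ≥0) (i : Fin N) :
    scalarMean G x i = rateSum (fun z => (G z.toNNReal : ℝ)) (x i / ∑ k, (x k : ℝ)) x := by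
  unfold scalarMean rateSum
  refine Finset.sum_congr rfl fun j _ => ?_
  have : (x i / ∑ k, (x k : ℝ)) * x j = ((x i * x j / ∑ k, x k : ℝ≥0) : ℝ) := by
    push_cast; ring
  simp only [this, Real.toNNReal_coe]

/-- Chord bound on `[0, 1]`; it serves to bound the separating level from below. -/
lemma IsConcaveRate.mul_truncRatio_inv_le (hh : IsConcaveRate h) {y Y : ℝ} (hy : 0 < y)
    (hyY : 1 ≤ y * Y) : h 1 * truncRatio π y⁻¹ ≤ rateMean π h y Y := by
  rw [truncRatio, truncMean, mul_div_assoc', ← integral_const_mul, ← integral_div, rateMean]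
  refine integral_mono (((integrable_min (by positivity)).const_mul _).div_const _)
    (hh.integrable y hy.le Y) fun w => ?_
  change h 1 * min (w : ℝ) y⁻¹ / y⁻¹ ≤ h (y * min (w : ℝ) Y)
  have hw : (0 : ℝ) ≤ w := w.coe_nonneg
  have hY : y⁻¹ ≤ Y := by rwa [inv_le_iff_one_le_mul₀ hy, mul_comm]
  have h1 : h (y * min (w : ℝ) y⁻¹) ≤ h (y * min (w : ℝ) Y) := hh.mono (by gcongr)
  refine le_trans ?_ h1
  have h2 : y * min (w : ℝ) y⁻¹ ≤ 1 := by
    calc y * min (w : ℝ) y⁻¹ ≤ y * y⁻¹ := by gcongr; exact min_le_right _ _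
      _ = 1 := mul_inv_cancel₀ hy.ne'
  have h3 := hh.star (y * min (w : ℝ) y⁻¹) 1 (by positivity) h2
  rw [div_inv_eq_mul]
  linarith

end InfiniteMean

/-! ### Separation of the mean degrees in general. -/

section Separation

variable {Ω : Type*} [MeasurableSpace Ω] {μ : Measure Ω} [IsProbabilityMeasure μ]
  {X : ℕ → Ω → ℝ≥0} {π : Measure ℝ≥0} [IsProbabilityMeasure π] {α : ℝ} {G : ℝ≥0 → ℝ≥0}

lemma exists_const_div_rpow_le {β : ℝ} (hβ : 0 < β) (A : ℝ) {ε : ℝ} (hε : 0 < ε) :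
    ∃ K : ℝ, 1 ≤ K ∧ A / K ^ β ≤ ε := by
  have h : Tendsto (fun K : ℝ => A / K ^ β) atTop (𝓝 0) :=
    tendsto_const_nhds.div_atTop (tendsto_rpow_atTop hβ)
  exact ((eventually_ge_atTop (1 : ℝ)).and (h.eventually (ge_mem_nhds hε))).exists

/-- A geometric grid point next to `u / T`. -/
lemma exists_grid_point {s K τ u T : ℝ} {J : ℕ} (hs : 1 < s) (hK : 0 < K) (hτ : 0 < τ)
    (hu : 0 < u) (hJ : 16 * K ^ 2 < s ^ J) (h1 : τ / K / 4 ≤ T) (h2 : T ≤ 4 * K * τ) :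
    ∃ k ≤ J, u / T ≤ s ^ (k + 1) * (u / (4 * K * τ)) ∧
      s ^ (k + 1) * (u / (4 * K * τ)) ≤ s * (u / T) := by
  have hT : 0 < T := lt_of_lt_of_le (by positivity) h1
  have hb : 0 < u / (4 * K * τ) := by positivity
  -- The ratio of `u / T` to the base of the grid lies in `[1, 16 K²]`, so `J` steps of ratio `s`
  -- suffice.
  have hr1 : 1 ≤ u / T / (u / (4 * K * τ)) := by
    rw [one_le_div hb]
    gcongr
  have hr2 : u / T / (u / (4 * K * τ)) ≤ 16 * K ^ 2 := by
    rw [div_le_iff₀ hb, div_le_iff₀ hT]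
    calc u = 16 * K ^ 2 * (u / (4 * K * τ)) * (τ / K / 4) := by field_simp; norm_num
      _ ≤ _ := by gcongr
  obtain ⟨k, hk1, hk2⟩ := exists_nat_pow_near hr1 hs
  refine ⟨k, ?_, ?_, ?_⟩
  · by_contra hlt
    push Not at hlt
    have : s ^ J ≤ s ^ k := pow_le_pow_right₀ hs.le hlt.le
    linarith
  · exact ((div_lt_iff₀ hb).1 hk2).le
  · rw [pow_succ, mul_comm (s ^ k) s, mul_assoc]
    exact mul_le_mul_of_nonneg_left ((le_div_iff₀ hb).1 hk1) (by linarith)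

/-- The ratio grows polynomially below its argument. -/
def HasRatioGrowth (π : Measure ℝ≥0) (M a β : ℝ) : Prop :=
  ∀ u : ℝ, 1 ≤ u → ∀ y, M * u ≤ y → a * u ^ β * truncRatio π y ≤ truncRatio π (y / u)

lemma HasRatioGrowth.half_le {π : Measure ℝ≥0} {M a β : ℝ} (hr : HasRatioGrowth π M a β)
    (ha : 0 < a) {N : ℕ}
    {τ K : ℝ} (hτ : 1 / 2 ≤ N * truncRatio π τ) (hK : 1 ≤ K) (hM : M * K ≤ τ) :
    a * K ^ β / 2 ≤ N * truncRatio π (τ / K) := by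
  have h2 : 0 ≤ a * K ^ β := by positivity
  calc a * K ^ β / 2 = a * K ^ β * (1 / 2) := by ring
    _ ≤ a * K ^ β * (N * truncRatio π τ) := by gcongr
    _ = N * (a * K ^ β * truncRatio π τ) := by ring
    _ ≤ _ := by gcongr; exact hr K hK τ hM

lemma HasRatioGrowth.measure_total_gt_le {M a β : ℝ} (hr : HasRatioGrowth π M a β) (ha : 0 < a)
    (hX : ∀ i, Measurable (X i)) (hlaw : ∀ i, μ.map (X i) = π) {N : ℕ}
    {τ K : ℝ} (hτ : N * truncRatio π τ ≤ 1) (hτ0 : 0 < τ) (hK : 1 ≤ K) (hM : M ≤ τ) :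
    μ.real {ω | 4 * K * τ < ∑ i : Fin N, (X i ω : ℝ)} ≤ 2 / (a * K ^ β) := by
  have hK0 : 0 < K := by linarith
  refine (_root_.measure_total_gt_le hX hlaw N (by positivity)).trans ?_
  have h4 : truncRatio π (4 * K * τ) ≤ truncRatio π (K * τ) := by
    refine truncRatio_antitoneOn (show 0 < K * τ by positivity)
      (show 0 < 4 * K * τ by positivity) ?_
    rw [mul_assoc]
    exact le_mul_of_one_le_left (by positivity) (by norm_num)
  have h5 := hr K hK (K * τ) (by rw [mul_comm]; gcongr)
  rw [mul_div_cancel_left₀ _ hK0.ne'] at h5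
  have hpos : 0 < a * K ^ β := by positivity
  rw [le_div_iff₀ hpos]
  calc 2 * (N * truncRatio π (4 * K * τ)) * (a * K ^ β)
      ≤ 2 * (N * truncRatio π (K * τ)) * (a * K ^ β) := by gcongr
    _ = 2 * (N * (a * K ^ β * truncRatio π (K * τ))) := by ring
    _ ≤ 2 * (N * truncRatio π τ) := by gcongr
    _ ≤ 2 := by linarith

lemma truncRatio_div_ge {τ K : ℝ} (hτ : 0 < τ) (hK : 1 ≤ K) (N : ℕ) :
    N * truncRatio π τ ≤ N * truncRatio π (τ / K) := by
  gcongr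
  exact truncRatio_antitoneOn (show 0 < τ / K by positivity) hτ (div_le_self hτ.le hK)

/-- Lower bound for the expected rate at a grid point. -/
lemma HasRatioGrowth.le_rateMean {M a β : ℝ} (hr : HasRatioGrowth π M a β) (ha : 0 < a)
    {h : ℝ → ℝ} (hh : IsConcaveRate h) {N : ℕ} {τ u K K' y : ℝ} (hτ : 1 / 2 ≤ N * truncRatio π τ)
    (hτ0 : 0 < τ) (hK : 1 ≤ K) (hK' : 1 ≤ K') (hM : 0 < M) (hu : 4 * K ≤ u)
    (huM : u * M ≤ τ) (huK : 4 * K * K' ≤ u) (hy : u / (4 * K * τ) ≤ y) :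
    h 1 * (a * (u / (4 * K)) ^ β / 2) ≤ N * rateMean π h y (τ / K') := by
  have hK0 : 0 < K := by linarith
  have hu0 : 0 < u := by linarith
  have hb : 0 < u / (4 * K * τ) := by positivity
  have hy0 : 0 < y := hb.trans_le hy
  have h8 : 1 ≤ y * (τ / K') := by
    calc 1 ≤ u / (4 * K * K') := by rwa [one_le_div (by positivity)]
      _ = u / (4 * K * τ) * (τ / K') := by field_simp
      _ ≤ _ := by gcongr
  have h9 := hh.mul_truncRatio_inv_le (π := π) hy0 h8
  have h10 : truncRatio π (τ / (u / (4 * K))) ≤ truncRatio π y⁻¹ := by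
    refine truncRatio_antitoneOn (show 0 < y⁻¹ from inv_pos.2 hy0)
      (show 0 < τ / (u / (4 * K)) by positivity) ?_
    have : τ / (u / (4 * K)) = (u / (4 * K * τ))⁻¹ := by rw [inv_div]; field_simp
    rw [this]
    gcongr
  have h11 := hr.half_le (K := u / (4 * K)) ha hτ (by rwa [one_le_div (by positivity)]) (by
    calc M * (u / (4 * K)) ≤ M * u := by
          gcongr; exact div_le_self hu0.le (by linarith)
      _ ≤ τ := by rwa [mul_comm])
  have hh1 := hh.nonneg 1
  calc h 1 * (a * (u / (4 * K)) ^ β / 2) ≤ h 1 * (N * truncRatio π y⁻¹) := by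
        gcongr
        exact h11.trans (by gcongr)
    _ = N * (h 1 * truncRatio π y⁻¹) := by ring
    _ ≤ _ := by gcongr

/-- Union bound over `J + 1` grid points: `R` is tuned so that the Markov part of each costs `ε / (4
(J + 1))`, and `Q` is large enough for the Chebyshev part to cost no more. -/
lemma measure_biUnion_nodeBad_le (hX : ∀ i, Measurable (X i)) (hind : iIndepFun X μ)
    (hlaw : ∀ i, μ.map (X i) = π) {h : ℝ → ℝ} (hh : IsConcaveRate h) {N J : ℕ}
    {s c R Y ε Q : ℝ} {node : ℕ → ℝ} (hs : 1 ≤ s) (hc : 0 < c) (hε : 0 < ε)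
    (hR : R = 4 * (J + 1) / ε) (hnode : ∀ k, 0 < node k) (hY : 0 < Y)
    (hsens : ∀ k ≤ J, c * rateMean π h (node k) Y ≤ ∫ w, rateIncr h s (node k) Y w ∂π)
    (hQ0 : 0 < Q) (hQ : Q ≤ N * truncRatio π Y) (hQε : 4 * s / (c * Q) ≤ ε / (4 * (J + 1))) :
    μ.real (⋃ k ∈ Finset.range (J + 1), nodeBad X π h N s c R (node k) Y) ≤ ε / 2 := by
  have hR0 : 0 < R := by rw [hR]; positivity
  refine (measureReal_biUnion_finset_le _ _).trans ?_
  have : ∀ k ∈ Finset.range (J + 1), μ.real (nodeBad X π h N s c R (node k) Y) ≤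
      ε / (2 * (J + 1)) := by
    intro k hk
    have hkJ : k ≤ J := by simpa [Nat.lt_succ_iff] using hk
    refine (measure_nodeBad_le hX hind hlaw hh hs hc hR0 (hnode k) hY (hsens k hkJ)
      (hQ0.trans_le hQ)).trans ?_
    have h4 : 4 * s / (c * (N * truncRatio π Y)) ≤ ε / (4 * (J + 1)) := by
      refine le_trans ?_ hQε
      refine div_le_div_of_nonneg_left (by positivity) (by positivity) ?_
      exact mul_le_mul_of_nonneg_left hQ hc.le
    have h5 : 1 / R = ε / (4 * (J + 1)) := by rw [hR]; field_simp
    rw [h5]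
    refine (add_le_add h4 le_rfl).trans (le_of_eq ?_)
    field_simp
    norm_num
  refine (Finset.sum_le_sum this).trans (le_of_eq ?_)
  rw [Finset.sum_const, Finset.card_range, nsmul_eq_mul]
  push_cast
  field_simp

/-- Separation on the complement of the exceptional events. -/
lemma scalarSeparated_of_growth (hh : IsConcaveRate fun z => (G z.toNNReal : ℝ)) {N : ℕ}
    {x : Fin N → ℝ≥0} {s q u T y kmin : ℝ} (hq : 0 < q) (hT : T = ∑ i, (x i : ℝ)) (hT0 : 0 < T)
    (hs : 0 < s) (h1 : u / T ≤ y) (h2 : y ≤ s * (u / T))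
    (hgrow : rateSum (fun z => (G z.toNNReal : ℝ)) y x * (q * q) ≤
      rateSum (fun z => (G z.toNNReal : ℝ)) (s * y) x)
    (hk : kmin * q ≤ rateSum (fun z => (G z.toNNReal : ℝ)) (s * y) x) :
    ScalarSeparated G u (s * s * u) (q - 1) kmin
      (rateSum (fun z => (G z.toNNReal : ℝ)) (s * s * (u / T)) x / q) x := by
  -- The grid point satisfies `u / T ≤ y` and `s y ≤ s² u / T`, so the growth `q²` from `y` to `s y`
  -- passes to these end points. The level `κ` is the upper value divided by `q`, leaving a factor
  -- `q` on either side.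
  have m1 := hh.rateSum_mono x h1
  have m2 := hh.rateSum_mono x (show s * y ≤ s * s * (u / T) by rw [mul_assoc]; gcongr)
  simp only at m1 m2
  have hcq : 1 + (q - 1) = q := by ring
  refine ⟨?_, fun i => ⟨fun hi => ?_, fun hi => ?_⟩⟩
  · rw [le_div_iff₀ hq]
    exact hk.trans m2
  · rw [hcq, scalarMean_eq, ← hT, le_div_iff₀ hq, mul_assoc]
    have m3 := hh.rateSum_mono x (show (x i : ℝ) / T ≤ u / T by gcongr)
    simp only at m3
    refine le_trans ?_ (hgrow.trans m2)
    gcongr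
    exact m3.trans m1
  · rw [hcq, scalarMean_eq, ← hT, div_mul_cancel₀ _ hq.ne']
    refine hh.rateSum_mono x ?_
    rw [mul_div_assoc']
    gcongr

/-- Separation for weights of infinite mean, at a fixed number of nodes. -/
lemma exists_separation_of_scale (hX : ∀ i, Measurable (X i)) (hind : iIndepFun X μ)
    (hlaw : ∀ i, μ.map (X i) = π) (hRV : HasRVTail π α) (hα : 0 < α)
    (hinf : ∫⁻ w, (w : ℝ≥0∞) ∂π = ∞)
    (hh : IsConcaveRate fun z => (G z.toNNReal : ℝ)) {δ ε : ℝ} (hδ : 0 < δ) (hε : 0 < ε) :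
    ∃ c > 0, ∃ a > 0, ∃ β : ℝ, 0 < β ∧ ∃ R₀ > 0, ∀ (N : ℕ) (τ u : ℝ),
      1 / 2 ≤ N * truncRatio π τ → N * truncRatio π τ ≤ 1 → R₀ ≤ τ → R₀ ≤ u → u * R₀ ≤ τ →
      ∃ κ : (Fin N → ℝ≥0) → ℝ,
      Measurable κ ∧ μ.real {ω | ¬ ScalarSeparated G u ((1 + δ) * u) c (a * u ^ β)
        (κ fun i => X i ω) (fun i : Fin N => X i ω)} ≤ ε := by
  obtain ⟨s, hs1, hs2⟩ : ∃ s, 1 < s ∧ s * s = 1 + δ :=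
    ⟨Real.sqrt (1 + δ), Real.lt_sqrt_of_sq_lt (by linarith), Real.mul_self_sqrt (by linarith)⟩
  have hs0 : 0 < s := by linarith
  obtain ⟨c₁, hc₁, M₂, hM₂, hgrow⟩ := exists_truncRatio_growth hRV hα hinf
  obtain ⟨β, hβ, a₁, ha₁, hpoly⟩ := exists_mul_rpow_le_of_half truncRatio_antitoneOn
    truncRatio_nonneg hM₂ hc₁ hgrow
  have hr : HasRatioGrowth π M₂ a₁ β := hpoly
  obtain ⟨c₀, hc₀, x₀, hx₀, M₁, hM₁, hsens⟩ := hh.exists_sensitivity hRV hα hinf hs1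
  -- `K₁` confines the total weight to `[τ / (4 K₁), 4 K₁ τ]` up to probability `ε / 2`; this fixes
  -- the number of grid points.
  obtain ⟨K₁, hK₁, hK₁ε⟩ := exists_const_div_rpow_le hβ (10 / a₁) (half_pos hε)
  obtain ⟨J, hJ⟩ := pow_unbounded_of_one_lt (16 * K₁ ^ 2) hs1
  obtain ⟨R, hR⟩ : ∃ R : ℝ, R = 4 * (J + 1) / ε := ⟨_, rfl⟩
  have hR0 : 0 < R := by rw [hR]; positivity
  -- Truncation happens at `Y = τ / K₂`, below the scale, so that `N truncRatio π Y ≥ a₁ K₂ ^ β / 2`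
  -- is as large as the union bound requires.
  obtain ⟨K₂, hK₂, hK₂ε⟩ := exists_const_div_rpow_le hβ (8 * s / (c₀ * a₁))
    (show 0 < ε / (4 * (J + 1)) by positivity)
  have hK₁0 : 0 < K₁ := by linarith
  have hK₂0 : 0 < K₂ := by linarith
  -- The growth of `rateSum_growth` for `B = 4 K₁ τ` and `Y = τ / K₂`: it depends neither on `N` nor
  -- on `τ`.
  obtain ⟨c', hc'0, hc'⟩ : ∃ c' : ℝ, 0 < c' ∧ c' = c₀ / (2 * (R + 8 * K₁ * K₂)) :=
    ⟨_, by positivity, rfl⟩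
  obtain ⟨q, hq1, hq2⟩ : ∃ q, 1 < q ∧ q * q = 1 + c' :=
    ⟨Real.sqrt (1 + c'), Real.lt_sqrt_of_sq_lt (by linarith), Real.mul_self_sqrt (by linarith)⟩
  have hq0 : 0 < q := by linarith
  have hh1 : 0 < (G (1 : ℝ).toNNReal : ℝ) := hh.pos one_pos
  have p1 : 0 < M₂ * K₁ := by positivity
  have p2 : 0 < M₂ * K₂ := by positivity
  have p3 : 0 < M₁ * K₂ := by positivity
  have p4 : 0 < s ^ (J + 1) / (4 * K₁ * x₀) := by positivity
  have p5 : 0 < 4 * K₁ * K₂ := by positivity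
  refine ⟨q - 1, by linarith, c₀ * G (1 : ℝ).toNNReal * a₁ / (4 * q * (4 * K₁) ^ β),
    by positivity, β, hβ,
    M₂ + M₂ * K₁ + M₂ * K₂ + M₁ * K₂ + s ^ (J + 1) / (4 * K₁ * x₀) + 4 * K₁ + 4 * K₁ * K₂,
    by positivity, fun N τ u hτ1 hτ2 hRτ hRu huτ => ?_⟩
  have hu0 : 0 < u := by linarith
  have hτ0 : 0 < τ := by linarith
  have hY0 : 0 < τ / K₂ := by positivity
  have hYM : M₁ ≤ τ / K₂ := by rw [le_div_iff₀ hK₂0]; linarith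
  have hqY := hτ1.trans (truncRatio_div_ge hτ0 hK₂ N)
  have hqY2 := hr.half_le ha₁ hτ1 hK₂ (by linarith)
  have hxb0 : 0 < u / (4 * K₁ * τ) := by positivity
  have hnode0 : ∀ k : ℕ, 0 < s ^ (k + 1) * (u / (4 * K₁ * τ)) := fun k => by positivity
  have huM : u * M₂ ≤ τ := le_trans (by gcongr; linarith) huτ
  have hnodele : ∀ k ≤ J, s ^ (k + 1) * (u / (4 * K₁ * τ)) ≤ x₀ := by
    intro k hk
    calc _ ≤ s ^ (J + 1) * (u / (4 * K₁ * τ)) := by gcongr; exact hs1.le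
      _ = u * (s ^ (J + 1) / (4 * K₁ * x₀)) * (x₀ / τ) := by field_simp
      _ ≤ τ * (x₀ / τ) := by
          gcongr
          exact le_trans (by gcongr; linarith) huτ
      _ = x₀ := by field_simp
  have hP1 := hr.measure_total_gt_le ha₁ hX hlaw hτ2 hτ0 hK₁ (by linarith)
  have hP2 : μ.real {ω | ∑ i : Fin N, (X i ω : ℝ) < τ / K₁ / 4} ≤ 8 / (a₁ * K₁ ^ β) := by
    refine (measure_total_lt_le hX hind hlaw N (by positivity)
      (hτ1.trans (truncRatio_div_ge hτ0 hK₁ N))).trans ?_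
    have h4 := hr.half_le ha₁ hτ1 hK₁ (by linarith)
    calc 4 / (N * truncRatio π (τ / K₁)) ≤ 4 / (a₁ * K₁ ^ β / 2) := by gcongr
      _ = _ := by field_simp; norm_num
  have hP3 := measure_biUnion_nodeBad_le hX hind hlaw hh hs1.le hc₀ hε hR hnode0 hY0
    (fun k hk => hsens _ (hnode0 k) (hnodele k hk) _ hYM) (by positivity) hqY2 (by
      refine le_trans (le_of_eq ?_) hK₂ε
      field_simp; norm_num)
  refine ⟨fun x => rateSum (fun z => (G z.toNNReal : ℝ)) (s * s * (u / ∑ k, (x k : ℝ))) x / q,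
    ?_, ?_⟩
  · refine Measurable.div_const ?_ _
    unfold rateSum
    refine Finset.measurable_fun_sum _ fun j _ => ?_
    exact hh.continuous.measurable.comp (by fun_prop)
  refine (measureReal_mono (s₂ := {ω | 4 * K₁ * τ < ∑ i : Fin N, (X i ω : ℝ)} ∪
    {ω | ∑ i : Fin N, (X i ω : ℝ) < τ / K₁ / 4} ∪ _) ?_).trans
    ((measureReal_union_le _ _).trans ((add_le_add ((measureReal_union_le _ _).trans
      (add_le_add hP1 hP2)) hP3).trans ?_))
  · intro ω hω
    by_contra hcon
    apply hω
    simp only [Set.mem_union, not_or] at hcon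
    obtain ⟨⟨g1, g2⟩, g3⟩ := hcon
    simp only [Set.mem_ofPred_eq, not_lt] at g1 g2
    simp only [Set.mem_iUnion, not_exists, Finset.mem_range, Nat.lt_succ_iff] at g3
    obtain ⟨k, hkJ, hn1, hn2⟩ := exists_grid_point hs1 hK₁0 hτ0 hu0 hJ g2 g1
    have hn3 : u / (4 * K₁ * τ) ≤ s ^ (k + 1) * (u / (4 * K₁ * τ)) :=
      le_mul_of_one_le_left hxb0.le (one_le_pow₀ hs1.le)
    obtain ⟨f1, f2⟩ := rateSum_growth hh hs1.le hc₀ hR0 (hnode0 k) hY0 hqY g1 (g3 k hkJ)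
    have hDeq : R + 2 * (4 * K₁ * τ) / (τ / K₂) = R + 8 * K₁ * K₂ := by field_simp; ring
    rw [hDeq, ← hc', ← hq2] at f1
    have hT0 : 0 < ∑ i : Fin N, (X i ω : ℝ) := lt_of_lt_of_le (by positivity) g2
    rw [← hs2]
    refine scalarSeparated_of_growth hh hq0 rfl hT0 hs0 hn1 hn2 f1 (le_trans ?_ f2)
    have h12 := hr.le_rateMean ha₁ hh hτ1 hτ0 hK₁ hK₂ hM₂ (by linarith) huM (by linarith) hn3
    calc _ = c₀ * (G (1 : ℝ).toNNReal * (a₁ * (u / (4 * K₁)) ^ β / 2)) / 2 := by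
          rw [Real.div_rpow hu0.le (by positivity)]
          field_simp
          norm_num
      _ ≤ _ := by gcongr
  · calc 2 / (a₁ * K₁ ^ β) + 8 / (a₁ * K₁ ^ β) + ε / 2 = 10 / a₁ / K₁ ^ β + ε / 2 := by
          field_simp; ring
      _ ≤ ε := by linarith

/-- The conditional mean degrees in a layer separate the nodes of weight at most `u` from those of
weight above `(1 + δ) u`. -/
theorem exists_separation (hX : ∀ i, Measurable (X i)) (hind : iIndepFun X μ)
    (hlaw : ∀ i, μ.map (X i) = π) (hRV : HasRVTail π α) (hα : 0 < α)
    (hG : IsConnectionFun α G) {u : ℕ → ℝ} (hu : Tendsto u atTop atTop)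
    (hNu : Tendsto (fun N : ℕ => N * tailFn π (u N)) atTop atTop)
    {δ ε : ℝ} (hδ : 0 < δ) (hε : 0 < ε) :
    ∃ c > 0, ∃ a > 0, ∃ β : ℝ, 0 < β ∧ ∀ᶠ N : ℕ in atTop, ∃ κ : (Fin N → ℝ≥0) → ℝ,
      Measurable κ ∧ μ.real {ω | ¬ ScalarSeparated G (u N) ((1 + δ) * u N) c (a * u N ^ β)
        (κ fun i => X i ω) (fun i : Fin N => X i ω)} ≤ ε := by
  by_cases hfin : ∫⁻ w, (w : ℝ≥0∞) ∂π < ∞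
  · exact exists_separation_of_integrable hX hind hlaw hRV.pos (integrable_coe_of_lintegral hfin)
      hG hu hδ hε
  have hinf : ∫⁻ w, (w : ℝ≥0∞) ∂π = ∞ := not_lt_top_iff.1 hfin
  -- The infinite mean is what makes the concavity of `G` available.
  have hα1 : α ≤ 1 := by
    by_contra hlt
    exact hfin (lintegral_coe_lt_top_of_one_lt hRV (not_le.1 hlt))
  obtain ⟨c, hc, a, ha, β, hβ, R₀, hR₀, hsep⟩ := exists_separation_of_scale hX hind hlaw hRV hα
    hinf (hG.isConcaveRate hα1) hδ hε
  refine ⟨c, hc, a, ha, β, hβ, ?_⟩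
  have hN : Tendsto (fun N : ℕ => N * truncRatio π R₀) atTop atTop :=
    tendsto_natCast_atTop_atTop.atTop_mul_const
      (lt_of_lt_of_le (hRV.pos R₀) (tailFn_le_truncRatio hR₀))
  filter_upwards [hN.eventually_gt_atTop 1, hu.eventually_ge_atTop R₀,
    hNu.eventually_gt_atTop (max R₀ 1)] with N h1 h2 h3
  obtain ⟨τ, hτ, hτ1, hτ2⟩ := exists_scale N R₀ hR₀ h1
  refine hsep N τ (u N) hτ1 hτ2 hτ h2 ?_
  have hu0 : 0 < u N := hR₀.trans_le h2
  have hτ0 : 0 < τ := hR₀.trans_le hτ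
  -- `N · truncMean` is monotone, is at least `u · N P(W > u) ≥ u R₀` at `u`, and is at most `τ` at
  -- `τ`; hence `u R₀ ≤ τ`.
  have h4 : N * tailFn π (u N) ≤ N * truncRatio π (u N) := by
    gcongr; exact tailFn_le_truncRatio hu0
  have huτ : u N ≤ τ := by
    by_contra hlt
    push Not at hlt
    have h5 : N * truncRatio π (u N) ≤ N * truncRatio π τ := by
      gcongr; exact truncRatio_antitoneOn hτ0 hu0 hlt.le
    linarith [le_max_right R₀ 1]
  have e1 : N * truncMean π (u N) = u N * (N * truncRatio π (u N)) := by
    rw [truncRatio]; field_simp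
  have e2 : N * truncMean π τ = τ * (N * truncRatio π τ) := by
    rw [truncRatio]; field_simp
  have h6 : N * truncMean π (u N) ≤ N * truncMean π τ := by
    gcongr; exact truncMean_mono hu0.le huτ
  calc u N * R₀ ≤ u N * (N * truncRatio π (u N)) := by
        gcongr; exact (le_max_left _ _).trans (h3.le.trans h4)
    _ ≤ τ * (N * truncRatio π τ) := by rw [← e1, ← e2]; exact h6
    _ ≤ τ := by nlinarith

end Separation

/-! ### Generalized inverses. -/

section Quantile

/-- The hypothesis on `b` keeps the set in `quantile` bounded below; otherwise its `sInf` would be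
the default value zero. -/
lemma lt_of_lt_quantile {F : ℝ → ℝ} {q b x : ℝ} (hb : ∀ y < b, F y < q) (hx : x < quantile F q) :
    F x < q := by
  by_contra hlt
  push Not at hlt
  refine absurd (csInf_le ⟨b, fun y hy => ?_⟩ (show x ∈ {x | q ≤ F x} from hlt)) (not_le.2 hx)
  by_contra hyb
  exact absurd (hb y (not_le.1 hyb)) (not_lt.2 hy)

lemma le_apply_quantile {F : ℝ → ℝ} (hF : Monotone F)
    (hrc : ∀ x, ContinuousWithinAt F (Set.Ici x) x) {q : ℝ} (hne : ∃ x, q ≤ F x) :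
    q ≤ F (quantile F q) := by
  have h1 : ∀ y, quantile F q < y → q ≤ F y := by
    intro y hy
    obtain ⟨z, hz, hzy⟩ := exists_lt_of_csInf_lt hne hy
    exact le_trans hz (hF hzy.le)
  have h2 : Tendsto F (𝓝[>] (quantile F q)) (𝓝 (F (quantile F q))) :=
    (hrc _).mono Set.Ioi_subset_Ici_self
  exact ge_of_tendsto h2 (eventually_nhdsWithin_of_forall h1)

end Quantile

/-! ### Margins of the weight law and their quantiles. -/

section Margins

variable {L : ℕ} {ρ : Measure (Fin L → ℝ≥0)} {α : ℝ}

/-- The law of the `l`-th coordinate. -/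
noncomputable def margin (ρ : Measure (Fin L → ℝ≥0)) (l : Fin L) : Measure ℝ≥0 :=
  ρ.map fun w => w l

instance [IsProbabilityMeasure ρ] (l : Fin L) : IsProbabilityMeasure (margin ρ l) :=
  Measure.isProbabilityMeasure_map (measurable_pi_apply l).aemeasurable

lemma tailFn_margin (l : Fin L) (y : ℝ) : tailFn (margin ρ l) y = ρ.real {w | y < (w l : ℝ)} := by
  rw [tailFn, margin, map_measureReal_apply (by fun_prop) (measurableSet_coe_gt y)]
  rfl

variable [IsProbabilityMeasure ρ]

lemma marginalCDF_eq (l : Fin L) (y : ℝ) :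
    marginalCDF ρ l y = 1 - tailFn (margin ρ l) y := by
  have hm : Measurable fun w : Fin L → ℝ≥0 => (w l : ℝ) := by fun_prop
  have : IsProbabilityMeasure (ρ.map fun w => (w l : ℝ)) :=
    Measure.isProbabilityMeasure_map hm.aemeasurable
  rw [marginalCDF, cdf_eq_real, map_measureReal_apply hm measurableSet_Iic, tailFn_margin,
    ← probReal_compl_eq_one_sub (measurableSet_lt measurable_const hm)]
  congr 1
  ext w
  simp

lemma coe_marginalTail {ρ : Measure (Fin L → ℝ≥0)} (l : Fin L) {y : ℝ} (hy : 0 ≤ y) :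
    (marginalTail ρ l y.toNNReal : ℝ) = tailFn (margin ρ l) y := by
  rw [tailFn_margin, marginalTail]
  change (ρ _).toReal = _
  rw [measureReal_def]
  congr 2
  ext w
  simp only [Set.mem_ofPred_eq]
  rw [← NNReal.coe_lt_coe, Real.coe_toNNReal _ hy]

lemma hasRVTail_margin {l : Fin L} (h : IsRegularlyVarying (marginalTail ρ l) (-α)) :
    HasRVTail (margin ρ l) α := by
  constructor
  · intro y
    obtain ⟨t, ht⟩ := eventually_atTop.1 h.eventually_pos
    set z : ℝ := max y t
    have hz : 0 ≤ z := le_max_of_le_right t.coe_nonneg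
    have h1 := ht z.toNNReal (by
      rw [← NNReal.coe_le_coe, Real.coe_toNNReal _ hz]; exact le_max_right _ _)
    have h2 : 0 < tailFn (margin ρ l) z := by
      rw [← coe_marginalTail l hz]; exact_mod_cast h1
    exact h2.trans_le (tailFn_antitone (le_max_left _ _))
  · intro x hx
    have h1 := h.tendsto x.toNNReal (Real.toNNReal_pos.2 hx)
    have h2 := (NNReal.continuous_coe.tendsto _).comp
      (h1.comp Real.tendsto_toNNReal_atTop)
    rw [NNReal.coe_rpow, Real.coe_toNNReal _ hx.le] at h2
    refine h2.congr' ?_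
    filter_upwards [eventually_ge_atTop 0] with y hy
    simp only [Function.comp_apply]
    rw [NNReal.coe_div, coe_marginalTail l hy, ← coe_marginalTail l (by positivity : 0 ≤ y * x),
      Real.toNNReal_mul hy]

lemma marginalCDF_neg (l : Fin L) {y : ℝ} (hy : y < 0) : marginalCDF ρ l y = 0 := by
  rw [marginalCDF_eq, tailFn_margin]
  have : {w : Fin L → ℝ≥0 | y < (w l : ℝ)} = Set.univ := by
    ext w
    simp only [Set.mem_ofPred_eq, Set.mem_univ, iff_true]
    exact hy.trans_le (w l).coe_nonneg
  rw [this, probReal_univ, sub_self]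

lemma exists_le_marginalCDF (l : Fin L) {q : ℝ} (hq : q < 1) : ∃ x, q ≤ marginalCDF ρ l x := by
  have h := tailFn_tendsto_zero (π := margin ρ l)
  obtain ⟨x, hx⟩ := (h.eventually (gt_mem_nhds (show 0 < 1 - q by linarith))).exists
  exact ⟨x, by rw [marginalCDF_eq]; linarith⟩

/-- The quantile function of the `l`-th coordinate. -/
noncomputable def marginQuantile (ρ : Measure (Fin L → ℝ≥0)) (l : Fin L) (q : ℝ) : ℝ :=
  quantile (marginalCDF ρ l) q

lemma tailFn_marginQuantile_le (l : Fin L) {q : ℝ} (hq : q < 1) :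
    tailFn (margin ρ l) (marginQuantile ρ l q) ≤ 1 - q := by
  have := le_apply_quantile (F := marginalCDF ρ l) (monotone_cdf _)
    (fun x => (cdf _).right_continuous x) (exists_le_marginalCDF l hq)
  rw [marginalCDF_eq] at this
  change tailFn (margin ρ l) (quantile (marginalCDF ρ l) q) ≤ _
  linarith

lemma lt_tailFn_of_lt_marginQuantile (l : Fin L) {q x : ℝ} (hq : 0 < q)
    (hx : x < marginQuantile ρ l q) : 1 - q < tailFn (margin ρ l) x := by
  have := lt_of_lt_quantile (b := 0) (fun y hy => by rw [marginalCDF_neg l hy]; exact hq) hx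
  rw [marginalCDF_eq] at this
  linarith

lemma tendsto_marginQuantile {l : Fin L} (h : HasRVTail (margin ρ l) α) :
    Tendsto (marginQuantile ρ l) (𝓝[<] 1) atTop := by
  rw [tendsto_atTop]
  intro B
  have h1 : ∀ᶠ q in 𝓝[<] (1 : ℝ), 1 - tailFn (margin ρ l) B < q :=
    nhdsWithin_le_nhds (lt_mem_nhds (by linarith [h.pos B]))
  filter_upwards [h1, self_mem_nhdsWithin] with q hq hq1
  by_contra hlt
  have h2 := tailFn_antitone (π := margin ρ l) (not_le.1 hlt).le
  have h3 := tailFn_marginQuantile_le (ρ := ρ) l hq1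
  linarith

/-- The tail at the quantile is asymptotically exact. -/
lemma tendsto_tailFn_marginQuantile {l : Fin L} (h : HasRVTail (margin ρ l) α) (hα : 0 < α) :
    Tendsto (fun q => tailFn (margin ρ l) (marginQuantile ρ l q) / (1 - q)) (𝓝[<] 1) (𝓝 1) := by
  have hQ := tendsto_marginQuantile h
  rw [tendsto_order]
  constructor
  · intro r hr
    set r' := max r (1 / 2) with hr'
    have hr1 : r' < 1 := max_lt hr (by norm_num)
    have hr0 : 0 < r' := lt_max_of_lt_right (by norm_num)
    obtain ⟨p, hp1, hp2⟩ := exists_between hr1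
    have hp0 : 0 < p := hr0.trans hp1
    -- Atoms are allowed, so the tail at the quantile may be less than `1 - q`. At `η` times the
    -- quantile it exceeds `1 - q`, and the two tails differ asymptotically by the factor `η ^ (-α)
    -- = p⁻¹`, with `p` arbitrarily near one.
    set η := p ^ (1 / α) with hη
    have hη0 : 0 < η := by positivity
    have hη1 : η < 1 := Real.rpow_lt_one hp0.le hp2 (by positivity)
    have hηα : η ^ (-α) = p⁻¹ := by
      rw [hη, ← Real.rpow_mul hp0.le, show 1 / α * -α = -1 by field_simp, Real.rpow_neg_one]
    have ht := (h.tendsto η hη0).comp hQ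
    rw [hηα] at ht
    have hlt : p⁻¹ < r'⁻¹ := inv_strictAnti₀ hr0 hp1
    filter_upwards [ht.eventually (gt_mem_nhds hlt), self_mem_nhdsWithin,
      nhdsWithin_le_nhds (lt_mem_nhds (show (0 : ℝ) < 1 by norm_num)),
      hQ.eventually_gt_atTop 0] with q hq hq1 hq0 hQ0
    simp only [Function.comp_apply] at hq
    have hq1' : 0 < 1 - q := by
      have : q < 1 := hq1
      linarith
    have h3 := lt_tailFn_of_lt_marginQuantile (ρ := ρ) l hq0
      (show marginQuantile ρ l q * η < marginQuantile ρ l q from mul_lt_of_lt_one_right hQ0 hη1)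
    have hpos := h.pos (marginQuantile ρ l q)
    rw [div_lt_iff₀ hpos] at hq
    have h4 : r' < tailFn (margin ρ l) (marginQuantile ρ l q) / (1 - q) := by
      rw [lt_div_iff₀ hq1']
      have h5 : 1 - q < r'⁻¹ * tailFn (margin ρ l) (marginQuantile ρ l q) := h3.trans hq
      rwa [lt_inv_mul_iff₀ hr0] at h5
    exact (le_max_left _ _).trans_lt h4
  · intro r hr
    filter_upwards [self_mem_nhdsWithin] with q hq1
    have hq1' : 0 < 1 - q := by
      have : q < 1 := hq1
      linarith
    exact lt_of_le_of_lt ((div_le_one hq1').2 (tailFn_marginQuantile_le l hq1)) hr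

lemma tendsto_tailFn_mul_marginQuantile {l : Fin L} (h : HasRVTail (margin ρ l) α) (hα : 0 < α)
    {x : ℝ} (hx : 0 < x) :
    Tendsto (fun q => tailFn (margin ρ l) (x * marginQuantile ρ l q) / (1 - q)) (𝓝[<] 1)
      (𝓝 (x ^ (-α))) := by
  have h1 := ((h.tendsto x hx).comp (tendsto_marginQuantile h)).mul
    (tendsto_tailFn_marginQuantile h hα)
  rw [mul_one] at h1
  refine h1.congr fun q => ?_
  simp only [Function.comp_apply]
  rw [div_mul_div_cancel₀ (h.pos _).ne', mul_comm]

end Margins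

/-! ### Counting exceedances. -/

section Counting

variable {Ω : Type*} [MeasurableSpace Ω] {μ : Measure Ω}

/-- Markov's inequality for the number of events that occur. -/
lemma measure_card_ge_le {ι : Type*} [Fintype ι] (E : ι → Set Ω) {p : ℝ}
    (hE : ∀ i, μ (E i) ≤ ENNReal.ofReal p) {r : ℝ} (hr : 0 < r) (P : Ω → ι → Prop)
    [∀ ω, DecidablePred (P ω)] (hP : ∀ ω i, P ω i → ω ∈ E i) :
    μ {ω | r ≤ ((Finset.univ.filter (P ω)).card : ℝ)} ≤
      ENNReal.ofReal (Fintype.card ι * p / r) := by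
  classical
  -- Measurability of the events is not required: measurable hulls have the same measure.
  let E' : ι → Set Ω := fun i => toMeasurable μ (E i)
  have hE'm : ∀ i, MeasurableSet (E' i) := fun i => measurableSet_toMeasurable _ _
  let f : Ω → ℝ≥0∞ := fun ω => ∑ i, (E' i).indicator 1 ω
  have hf : Measurable f :=
    Finset.measurable_fun_sum _ fun i _ => measurable_one.indicator (hE'm i)
  have hfint : ∫⁻ ω, f ω ∂μ ≤ ENNReal.ofReal (Fintype.card ι * p) := by
    rw [lintegral_finsetSum _ fun i _ => measurable_one.indicator (hE'm i)]
    calc ∑ i, ∫⁻ ω, (E' i).indicator 1 ω ∂μ ≤ ∑ i : ι, ENNReal.ofReal p := by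
          refine Finset.sum_le_sum fun i _ => ?_
          rw [lintegral_indicator_one (hE'm i), measure_toMeasurable]
          exact hE i
      _ = _ := by
          rw [Finset.sum_const, Finset.card_univ, nsmul_eq_mul, ENNReal.ofReal_mul (by positivity),
            ENNReal.ofReal_natCast]
  have hsub : {ω | r ≤ ((Finset.univ.filter (P ω)).card : ℝ)} ⊆
      {ω | ENNReal.ofReal r ≤ f ω} := by
    intro ω hω
    have hω' : r ≤ ((Finset.univ.filter (P ω)).card : ℝ) := hω
    change ENNReal.ofReal r ≤ f ω
    refine (ENNReal.ofReal_le_ofReal hω').trans ?_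
    rw [ENNReal.ofReal_natCast, Finset.card_filter]
    push_cast
    refine Finset.sum_le_sum fun i _ => ?_
    by_cases h : P ω i
    · rw [if_pos h, Set.indicator_of_mem (subset_toMeasurable μ (E i) (hP ω i h))]
      rfl
    · rw [if_neg h]; exact zero_le
  calc _ ≤ μ {ω | ENNReal.ofReal r ≤ f ω} := measure_mono hsub
    _ ≤ (∫⁻ ω, f ω ∂μ) / ENNReal.ofReal r :=
        meas_ge_le_lintegral_div hf.aemeasurable (by simpa using hr) ENNReal.ofReal_ne_top
    _ ≤ ENNReal.ofReal (Fintype.card ι * p) / ENNReal.ofReal r := by gcongr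
    _ = _ := (ENNReal.ofReal_div_of_pos hr).symm

variable [IsProbabilityMeasure μ] {E : Type*} [MeasurableSpace E] {X : ℕ → Ω → E} {π : Measure E}
  [IsProbabilityMeasure π]

/-- Law of large numbers for intermediate counts. -/
lemma tendsto_measure_count (hX : ∀ i, Measurable (X i)) (hind : iIndepFun X μ)
    (hlaw : ∀ i, μ.map (X i) = π) {t : ℕ → ℕ} (ht : Tendsto t atTop atTop) {B : ℕ → Set E}
    (hB : ∀ N, MeasurableSet (B N)) {x : ℝ}
    (hlim : Tendsto (fun N : ℕ => N * π.real (B N) / t N) atTop (𝓝 x)) {ε : ℝ} (hε : 0 < ε)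
    [∀ N, DecidablePred (· ∈ B N)] :
    Tendsto (fun N : ℕ => μ.real {ω | ε * t N ≤
      |((Finset.univ.filter fun i : Fin N => X i ω ∈ B N).card : ℝ) - x * t N|}) atTop (𝓝 0) := by
  have htR : Tendsto (fun N => (t N : ℝ)) atTop atTop := tendsto_natCast_atTop_atTop.comp ht
  -- The Chebyshev bound `N π(B) / (ε t / 2)²`, of order `1 / t`; half of `ε` is kept for the error
  -- of the mean.
  have hub : Tendsto (fun N : ℕ => N * π.real (B N) / t N * (4 / ε ^ 2) * (t N : ℝ)⁻¹) atTop
      (𝓝 (x * (4 / ε ^ 2) * 0)) := (hlim.mul_const _).mul htR.inv_tendsto_atTop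
  rw [mul_zero] at hub
  refine squeeze_zero' (.of_forall fun N => measureReal_nonneg) ?_ hub
  filter_upwards [htR.eventually_gt_atTop 0,
    hlim.eventually (Metric.ball_mem_nhds x (half_pos hε))] with N hN hN2
  rw [Real.dist_eq] at hN2
  have hf : Measurable ((B N).indicator (1 : E → ℝ)) := measurable_one.indicator (hB N)
  have h1 := measure_abs_sum_sub_ge_le hX hind hlaw hf
    (fun y => Set.indicator_nonneg (fun _ _ => zero_le_one) y)
    (fun y => Set.indicator_le_self' (fun _ _ => zero_le_one) y) N
    (show 0 < ε / 2 * t N by positivity) (b := 1)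
  rw [integral_indicator_one (hB N), one_mul] at h1
  refine (measureReal_mono ?_).trans (h1.trans (le_of_eq ?_))
  · intro ω hω
    simp only [Set.mem_ofPred_eq] at hω ⊢
    have e : ((Finset.univ.filter fun i : Fin N => X i ω ∈ B N).card : ℝ) =
        ∑ i : Fin N, (B N).indicator (1 : E → ℝ) (X i ω) := by
      rw [Finset.card_filter]
      push_cast
      refine Finset.sum_congr rfl fun i _ => ?_
      by_cases h : X i ω ∈ B N <;> simp [h]
    rw [e] at hω
    have h3 : |N * π.real (B N) - x * t N| ≤ ε / 2 * t N := by
      have : N * π.real (B N) - x * t N = (N * π.real (B N) / t N - x) * t N := by field_simp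
      rw [this, abs_mul, abs_of_pos hN]
      gcongr
    have h4 := abs_sub_le (∑ i : Fin N, (B N).indicator (1 : E → ℝ) (X i ω)) (N * π.real (B N))
      (x * t N)
    linarith
  · field_simp
    norm_num

end Counting

/-! ### The empirical degree threshold. -/

section EmpiricalThreshold

variable {L N : ℕ}

/-- The number of nodes with degree above `x` in layer `l`. -/
noncomputable def degreeCount (a : Fin N → Fin N → Fin L → ℕ) (l : Fin L) (x : ℝ) : ℕ :=
  (Finset.univ.filter fun i => x < (degree a i l : ℝ)).card

lemma empiricalCDF_eq (a : Fin N → Fin N → Fin L → ℕ) (l : Fin L) (x : ℝ) (hN : 0 < N) :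
    empiricalCDF a l x = 1 - degreeCount a l x / N := by
  have h := Finset.card_filter_add_card_filter_not (s := (Finset.univ : Finset (Fin N)))
    (fun i => (degree a i l : ℝ) ≤ x)
  simp only [not_le, Finset.card_univ, Fintype.card_fin] at h
  have hN' : (N : ℝ) ≠ 0 := by exact_mod_cast hN.ne'
  have h' : ((Finset.univ.filter fun i => (degree a i l : ℝ) ≤ x).card : ℝ) +
    degreeCount a l x = N := by exact_mod_cast h
  rw [empiricalCDF, eq_sub_iff_add_eq, ← add_div, h', div_self hN']

lemma empiricalCDF_mono (a : Fin N → Fin N → Fin L → ℕ) (l : Fin L) :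
    Monotone (empiricalCDF a l) := by
  intro x y hxy
  unfold empiricalCDF
  gcongr

lemma empiricalCDF_rightContinuous (a : Fin N → Fin N → Fin L → ℕ) (l : Fin L) (x : ℝ) :
    ContinuousWithinAt (empiricalCDF a l) (Set.Ici x) x := by
  have h : ∀ᶠ y in 𝓝[≥] x, ∀ i, ((degree a i l : ℝ) ≤ x ↔ (degree a i l : ℝ) ≤ y) := by
    rw [eventually_all]
    intro i
    rcases le_or_gt (degree a i l : ℝ) x with h1 | h1
    · filter_upwards [self_mem_nhdsWithin] with y hy
      exact ⟨fun _ => h1.trans hy, fun _ => h1⟩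
    · filter_upwards [nhdsWithin_le_nhds (gt_mem_nhds h1)] with y hy
      exact ⟨fun h => absurd h (not_le.2 h1), fun h => absurd h (not_le.2 hy)⟩
  refine tendsto_const_nhds.congr' ?_
  filter_upwards [h] with y hy
  simp only [empiricalCDF, hy]

/-- Right-continuity makes the quantile attained. Ties may leave strictly fewer than `t` nodes. -/
lemma degreeCount_degreeThreshold_le (a : Fin N → Fin N → Fin L → ℕ) (l : Fin L) (t : ℕ)
    (hN : 0 < N) : (degreeCount a l (degreeThreshold a t l) : ℝ) ≤ t := by
  have hN' : (0 : ℝ) < N := by exact_mod_cast hN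
  have hne : ∃ x, 1 - (t : ℝ) / N ≤ empiricalCDF a l x := by
    obtain ⟨x, hx⟩ := (Set.finite_range fun i => (degree a i l : ℝ)).bddAbove
    refine ⟨x, ?_⟩
    have : degreeCount a l x = 0 := by
      rw [degreeCount, Finset.card_eq_zero, Finset.filter_eq_empty_iff]
      intro i _
      exact not_lt.2 (hx ⟨i, rfl⟩)
    rw [empiricalCDF_eq a l x hN, this]
    have : 0 ≤ (t : ℝ) / N := by positivity
    simp; linarith
  have h := le_apply_quantile (empiricalCDF_mono a l) (empiricalCDF_rightContinuous a l) hne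
  rw [empiricalCDF_eq a l _ hN] at h
  have h2 : (degreeCount a l (degreeThreshold a t l) : ℝ) / N ≤ t / N := by
    change (degreeCount a l (quantile (empiricalCDF a l) (1 - (t : ℝ) / N)) : ℝ) / N ≤ t / N
    linarith
  exact (div_le_div_iff_of_pos_right hN').1 h2

/-- `t < N` makes the level positive, so that no negative number enters the infimum. -/
lemma lt_degreeCount_of_lt (a : Fin N → Fin N → Fin L → ℕ) (l : Fin L) {t : ℕ} (htN : t < N)
    {x : ℝ} (hx : x < degreeThreshold a t l) : (t : ℝ) < degreeCount a l x := by
  have hN : 0 < N := by omega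
  have hN' : (0 : ℝ) < N := by exact_mod_cast hN
  have h := lt_of_lt_quantile (b := 0) (fun y hy => by
    have : empiricalCDF a l y = 0 := by
      rw [empiricalCDF, Finset.filter_eq_empty_iff.2]
      · simp
      · intro i _ h
        have : (0 : ℝ) ≤ degree a i l := by positivity
        linarith
    rw [this, sub_pos, div_lt_one hN']
    exact_mod_cast htN) hx
  rw [empiricalCDF_eq a l _ hN] at h
  have h2 : (t : ℝ) / N < degreeCount a l x / N := by linarith
  exact (div_lt_div_iff_of_pos_right hN').1 h2

open Classical in
/-- Few misclassified nodes force the nodes of large degree to be essentially those of large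
weight. -/
lemma card_symmDiff_le {a : Fin N → Fin N → Fin L → ℕ} {w : Fin N → Fin L → ℝ≥0} {l : Fin L}
    {t : ℕ} (htN : t < N) {u₀ u v κ e : ℝ} (hu : u₀ ≤ u) (huv : u ≤ v)
    (hmis : ((Finset.univ.filter fun i => IsMisclassified l u v κ w a i).card : ℝ) ≤ e)
    (hlt : ((Finset.univ.filter fun i => u < (w i l : ℝ)).card : ℝ) + e < t) :
    ((symmDiff (Finset.univ.filter fun i => u₀ < (w i l : ℝ))
      (Finset.univ.filter fun i => degreeThreshold a t l < (degree a i l : ℝ))).card : ℝ) ≤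
      t - (Finset.univ.filter fun i => u₀ < (w i l : ℝ)).card +
      2 * ((Finset.univ.filter fun i => u₀ < (w i l : ℝ)).card -
        (Finset.univ.filter fun i => v < (w i l : ℝ)).card + e) := by
  set S := Finset.univ.filter fun i => u₀ < (w i l : ℝ)
  set V := Finset.univ.filter fun i => v < (w i l : ℝ)
  set D := Finset.univ.filter fun i => degreeThreshold a t l < (degree a i l : ℝ)
  set M := Finset.univ.filter fun i => IsMisclassified l u v κ w a i
  -- A node of degree above `κ` has weight above `u` or is misclassified; there are fewer than `t`
  -- such nodes.
  have hκ : degreeThreshold a t l ≤ κ := by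
    by_contra hcon
    have h1 := lt_degreeCount_of_lt a l htN (not_le.1 hcon)
    have h2 : degreeCount a l κ ≤ (Finset.univ.filter fun i => u < (w i l : ℝ)).card + M.card := by
      refine (Finset.card_le_card ?_).trans (Finset.card_union_le _ _)
      intro i hi
      simp only [Finset.mem_filter, Finset.mem_univ, true_and] at hi
      simp only [M, Finset.mem_union, Finset.mem_filter, Finset.mem_univ, true_and]
      rcases lt_or_ge u (w i l : ℝ) with h | h
      · exact Or.inl h
      · exact Or.inr (Or.inl ⟨h, hi⟩)
    have h2' : (degreeCount a l κ : ℝ) ≤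
        (Finset.univ.filter fun i => u < (w i l : ℝ)).card + M.card := by exact_mod_cast h2
    linarith
  have hVS : V ⊆ S := by
    intro i hi
    simp only [V, S, Finset.mem_filter, Finset.mem_univ, true_and] at hi ⊢
    linarith
  have h1 : (S \ D).card ≤ (S \ V).card + M.card := by
    refine (Finset.card_le_card ?_).trans (Finset.card_union_le _ _)
    intro i hi
    simp only [S, D, V, M, Finset.mem_sdiff, Finset.mem_union, Finset.mem_filter, Finset.mem_univ,
      true_and, not_lt] at hi ⊢
    rcases lt_or_ge v (w i l : ℝ) with h | h
    · exact Or.inr (Or.inr ⟨h, hi.2.trans hκ⟩)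
    · exact Or.inl ⟨hi.1, h⟩
  have h2 : (S \ V).card + V.card = S.card := Finset.card_sdiff_add_card_eq_card hVS
  -- No lower bound on the threshold is needed: `|D \ S| = |D| - |S| + |S \ D|` and `|D| ≤ t`.
  have h3 : (D.card : ℝ) ≤ t := degreeCount_degreeThreshold_le a l t (by omega)
  have h4 := Finset.card_sdiff_add_card_inter S D
  have h5 := Finset.card_sdiff_add_card_inter D S
  rw [Finset.inter_comm] at h5
  have h6 : (symmDiff S D).card ≤ (S \ D).card + (D \ S).card := by
    rw [symmDiff_def]; exact Finset.card_union_le _ _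
  have h1' : ((S \ D).card : ℝ) ≤ (S \ V).card + M.card := by exact_mod_cast h1
  have h2' : ((S \ V).card : ℝ) + V.card = S.card := by exact_mod_cast h2
  have h4' : ((S \ D).card : ℝ) + (S ∩ D).card = S.card := by exact_mod_cast h4
  have h5' : ((D \ S).card : ℝ) + (S ∩ D).card = D.card := by exact_mod_cast h5
  have h6' : ((symmDiff S D).card : ℝ) ≤ (S \ D).card + (D \ S).card := by exact_mod_cast h6
  linarith

end EmpiricalThreshold

/-! ### Large degrees against large weights in one layer. -/

section Layer

variable {Ω : Type*} [MeasurableSpace Ω] {μ : Measure Ω} [IsProbabilityMeasure μ] {L : ℕ} {α : ℝ}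
  {ρ : Measure (Fin L → ℝ≥0)} [IsProbabilityMeasure ρ] {W : ℕ → Ω → Fin L → ℝ≥0}
  {g : Fin L → ℝ≥0 → ℝ≥0} {A : (N : ℕ) → Fin N → Fin N → Fin L → Ω → ℕ} {t : ℕ → ℕ}

lemma tendsto_level (ht : Tendsto t atTop atTop)
    (htN : Tendsto (fun N : ℕ => (t N : ℝ) / N) atTop (𝓝 0)) :
    Tendsto (fun N : ℕ => 1 - (t N : ℝ) / N) atTop (𝓝[<] 1) := by
  refine tendsto_nhdsWithin_iff.2 ⟨by simpa using tendsto_const_nhds.sub htN, ?_⟩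
  filter_upwards [ht.eventually_gt_atTop 0, eventually_gt_atTop 0] with N h1 h2
  have : 0 < (t N : ℝ) / N := by positivity
  change 1 - (t N : ℝ) / N < 1
  linarith

lemma eventually_lt_of_tendsto (htN : Tendsto (fun N : ℕ => (t N : ℝ) / N) atTop (𝓝 0)) :
    ∀ᶠ N in atTop, t N < N := by
  filter_upwards [htN.eventually (gt_mem_nhds one_pos), eventually_gt_atTop 0] with N h1 h2
  rw [div_lt_one (by positivity)] at h1
  exact_mod_cast h1

/-- Passing from a limit as `q → 1` to the intermediate levels. -/
lemma tendsto_comp_level {f : ℝ → ℝ} {x : ℝ} (ht : Tendsto t atTop atTop)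
    (htN : Tendsto (fun N : ℕ => (t N : ℝ) / N) atTop (𝓝 0))
    (hf : Tendsto (fun q => f q / (1 - q)) (𝓝[<] 1) (𝓝 x)) :
    Tendsto (fun N : ℕ => N * f (1 - (t N : ℝ) / N) / t N) atTop (𝓝 x) := by
  refine (hf.comp (tendsto_level ht htN)).congr fun N => ?_
  simp only [Function.comp_apply, sub_sub_cancel]
  rw [div_div_eq_mul_div, mul_comm]

/-- Since `N P(W > u) / t` is bounded and the tail is at least polynomial, `N / t` is at most
polynomial in `u`. -/
lemma tendsto_mul_exp_neg {π : Measure ℝ≥0} [IsProbabilityMeasure π] (hRV : HasRVTail π α)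
    {u : ℕ → ℝ} (hu : Tendsto u atTop atTop) {x : ℝ}
    (hlim : Tendsto (fun N : ℕ => N * tailFn π (u N) / t N) atTop (𝓝 x)) {b β : ℝ} (hb : 0 < b)
    (hβ : 0 < β) :
    Tendsto (fun N : ℕ => N * Real.exp (-(b * u N ^ β)) / t N) atTop (𝓝 0) := by
  obtain ⟨A, C, hC, hpoly⟩ := hRV.exists_poly_bound
  have h1 : Tendsto (fun N : ℕ => (u N ^ β) ^ (A / β) * Real.exp (-b * (u N ^ β))) atTop (𝓝 0) :=
    (tendsto_rpow_mul_exp_neg_mul_atTop_nhds_zero (A / β) b hb).comp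
      ((tendsto_rpow_atTop hβ).comp hu)
  have h2 := (hlim.mul_const C).mul h1
  rw [mul_zero] at h2
  refine squeeze_zero' (.of_forall fun N => by positivity) ?_ h2
  filter_upwards [hu.eventually hpoly, hu.eventually_gt_atTop 0] with N h3 h4
  rw [← Real.rpow_mul h4.le, mul_div_cancel₀ _ hβ.ne', neg_mul]
  calc N * Real.exp (-(b * u N ^ β)) / t N = N * Real.exp (-(b * u N ^ β)) / t N * 1 := by ring
    _ ≤ N * Real.exp (-(b * u N ^ β)) / t N * (C * u N ^ A * tailFn π (u N)) := by gcongr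
    _ = _ := by ring

open Classical in
/-- The nodes above the empirical degree threshold are, up to `o(t)` exceptions, those above the
quantile of the weights. -/
theorem tendsto_measure_symmDiff (hα : 0 < α)
    (hmarg : ∀ l, IsRegularlyVarying (marginalTail ρ l) (-α)) (hW : ∀ i, Measurable (W i))
    (hind : iIndepFun W μ) (hlaw : ∀ i, μ.map (W i) = ρ) (hg : ∀ l, IsConnectionFun α (g l))
    (hA : ∀ N, IsMIRG μ g (fun i : Fin N => W i) (A N)) (ht : Tendsto t atTop atTop)
    (htN : Tendsto (fun N : ℕ => (t N : ℝ) / N) atTop (𝓝 0)) (l : Fin L) {ε : ℝ} (hε : 0 < ε) :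
    ∀ᶠ N : ℕ in atTop, μ.real {ω | ε * t N <
      ((symmDiff (Finset.univ.filter fun i : Fin N =>
          marginQuantile ρ l (1 - (t N : ℝ) / N) < (W i ω l : ℝ))
        (Finset.univ.filter fun i : Fin N => degreeThreshold (fun i j l => A N i j l ω) (t N) l <
          (degree (fun i j l => A N i j l ω) i l : ℝ))).card : ℝ)} ≤ ε := by
  have hRV := hasRVTail_margin (hmarg l)
  set π := margin ρ l with hπ
  set X : ℕ → Ω → ℝ≥0 := fun i ω => W i ω l with hX
  have hXm : ∀ i, Measurable (X i) := fun i => (measurable_pi_apply l).comp (hW i)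
  have hXind : iIndepFun X μ := hind.comp (fun _ w => w l) fun _ => measurable_pi_apply l
  have hXlaw : ∀ i, μ.map (X i) = π := fun i => by
    rw [hπ, margin, ← hlaw i, Measure.map_map (measurable_pi_apply l) (hW i)]; rfl
  have htR : Tendsto (fun N => (t N : ℝ)) atTop atTop := tendsto_natCast_atTop_atTop.comp ht
  -- The separation leaves a band up to `(1 + δ)² u₀`; this makes the number of weights between `u₀`
  -- and its end small against `ε t`.
  obtain ⟨δ, hδ, hδε⟩ : ∃ δ > 0, 1 - ε / 16 < (1 + δ) ^ (-(2 * α)) := by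
    have hc : Tendsto (fun δ : ℝ => (1 + δ) ^ (-(2 * α))) (𝓝[>] 0) (𝓝 ((1 + 0) ^ (-(2 * α)))) := by
      refine Tendsto.mono_left ?_ nhdsWithin_le_nhds
      refine ContinuousAt.rpow_const (by fun_prop) (Or.inl (by norm_num))
    rw [add_zero, Real.one_rpow] at hc
    obtain ⟨δ, h1, h2⟩ := ((hc.eventually (lt_mem_nhds (show 1 - ε / 16 < 1 by linarith))).and
      self_mem_nhdsWithin).exists
    exact ⟨δ, h2, h1⟩
  set u₀ : ℕ → ℝ := fun N => marginQuantile ρ l (1 - (t N : ℝ) / N) with hu₀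
  have hu₀top : Tendsto u₀ atTop atTop := (tendsto_marginQuantile hRV).comp (tendsto_level ht htN)
  set r := 1 + δ with hr
  have hr1 : 1 < r := by linarith
  have hr0 : 0 < r := by linarith
  -- The lower level lies strictly above `u₀`, so that only about `r ^ (-α) t < t` weights exceed
  -- it, with a margin for misclassified nodes.
  set u : ℕ → ℝ := fun N => r * u₀ N with hu
  have hutop : Tendsto u atTop atTop := hu₀top.const_mul_atTop hr0
  have hlimit : ∀ x : ℝ, 0 < x →
      Tendsto (fun N : ℕ => N * tailFn π (x * u₀ N) / t N) atTop (𝓝 (x ^ (-α))) := fun x hx =>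
    tendsto_comp_level (f := fun q => tailFn π (x * marginQuantile ρ l q)) ht htN
      (tendsto_tailFn_mul_marginQuantile hRV hα hx)
  have hcount : ∀ x : ℝ, 0 < x → ∀ e : ℝ, 0 < e → Tendsto (fun N : ℕ => μ.real {ω | e * t N ≤
      |((Finset.univ.filter fun i : Fin N => x * u₀ N < (W i ω l : ℝ)).card : ℝ) -
        x ^ (-α) * t N|}) atTop (𝓝 0) := by
    intro x hx e he
    exact tendsto_measure_count hXm hXind hXlaw ht (B := fun N => {w : ℝ≥0 | x * u₀ N < (w : ℝ)})
      (fun N => measurableSet_coe_gt _) (hlimit x hx) he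
  have hNu : Tendsto (fun N : ℕ => N * tailFn π (u N)) atTop atTop := by
    have h1 := (hlimit r hr0).pos_mul_atTop (by positivity) htR
    refine h1.congr' ?_
    filter_upwards [htR.eventually_gt_atTop 0] with N hN
    simp only [hu]
    field_simp
  have hra : r ^ (-α) < 1 := Real.rpow_lt_one_of_one_lt_of_neg hr1 (by linarith)
  -- The second bound fits the count error and the misclassified nodes into the gap between `r ^
  -- (-α) t` and `t`.
  set e := min (ε / 16) ((1 - r ^ (-α)) / 4) with he
  have he0 : 0 < e := lt_min (by positivity) (by linarith)
  have he1 : e ≤ ε / 16 := min_le_left _ _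
  have he2 : e ≤ (1 - r ^ (-α)) / 4 := min_le_right _ _
  obtain ⟨c, hc, a, ha, β, hβ, hsep⟩ := exists_separation hXm hXind hXlaw hRV hα (hg l) hutop hNu hδ
    (show 0 < ε / 8 by positivity)
  have hexp := tendsto_mul_exp_neg hRV hutop (hlimit r hr0)
    (show 0 < a * poissonRate c from mul_pos ha (poissonRate_pos hc)) hβ
  have hr20 : 0 < r * r := by positivity
  have hr2 : (r * r) ^ (-α) = r ^ (-(2 * α)) := by
    rw [← sq, ← Real.rpow_natCast, ← Real.rpow_mul hr0.le]; congr 1; push_cast; ring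
  have hε8 : 0 < ε / 8 := by positivity
  have h1 := hcount 1 one_pos e he0
  simp only [one_mul, Real.one_rpow] at h1
  filter_upwards [hsep, hexp.eventually (gt_mem_nhds (show 0 < ε / 8 * e by positivity)),
    h1.eventually (gt_mem_nhds hε8),
    (hcount r hr0 e he0).eventually (gt_mem_nhds hε8),
    (hcount (r * r) hr20 e he0).eventually (gt_mem_nhds hε8),
    eventually_lt_of_tendsto htN, htR.eventually_gt_atTop 0,
    hu₀top.eventually_gt_atTop 0] with N hsepN hexpN hc1 hc2 hc3 htN' htpos hu₀pos
  obtain ⟨κ, hκm, hκ⟩ := hsepN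
  set κ' : (Fin N → Fin L → ℝ≥0) → ℝ := fun w => κ fun i => w i l with hκ'
  have hκ'm : Measurable κ' := hκm.comp (by fun_prop)
  have huv : u N ≤ (1 + δ) * u N := by
    simp only [hu]
    have : 0 < r * u₀ N := by positivity
    exact le_mul_of_one_le_left this.le hr1.le
  set E0 : Set Ω := {ω | ¬ ScalarSeparated (g l) (u N) ((1 + δ) * u N) c (a * u N ^ β)
        (κ fun i => X i ω) (fun i : Fin N => X i ω)} with hE0
  set E1 : Set Ω := {ω | e * t N ≤ ((Finset.univ.filter fun i : Fin N =>
    IsSeparated g l (u N) ((1 + δ) * u N) c (a * u N ^ β) (κ' fun i => W i ω)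
      (fun i : Fin N => W i ω) ∧
    IsMisclassified l (u N) ((1 + δ) * u N) (κ' fun i => W i ω) (fun i : Fin N => W i ω)
      (fun i j l => A N i j l ω) i).card : ℝ)} with hE1
  have hp1 : μ.real E1 ≤ ε / 8 := by
    have hk := measure_card_ge_le (μ := μ) (ι := Fin N) (fun i => {ω |
      IsSeparated g l (u N) ((1 + δ) * u N) c (a * u N ^ β) (κ' fun i => W i ω)
        (fun i : Fin N => W i ω) ∧
      IsMisclassified l (u N) ((1 + δ) * u N) (κ' fun i => W i ω) (fun i : Fin N => W i ω)
        (fun i j l => A N i j l ω) i})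
      (fun i => (hA N).measure_isMisclassified_le (fun l => (hg l).measurable) (fun i => hW i) l hc
        huv hκ'm i) (show 0 < e * t N by positivity)
      (fun ω i => IsSeparated g l (u N) ((1 + δ) * u N) c (a * u N ^ β) (κ' fun i => W i ω)
        (fun i : Fin N => W i ω) ∧
      IsMisclassified l (u N) ((1 + δ) * u N) (κ' fun i => W i ω) (fun i : Fin N => W i ω)
        (fun i j l => A N i j l ω) i) (fun ω i h => h)
    have hk2 := ENNReal.toReal_mono ENNReal.ofReal_ne_top hk
    rw [ENNReal.toReal_ofReal (by positivity), Fintype.card_fin] at hk2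
    refine hk2.trans ?_
    rw [div_le_iff₀ (by positivity)]
    rw [div_lt_iff₀ htpos] at hexpN
    have e3 : a * u N ^ β * poissonRate c = a * poissonRate c * u N ^ β := by ring
    rw [e3]
    linarith
  refine (measureReal_mono (s₂ := E0 ∪ E1 ∪ ({ω | e * t N ≤
      |((Finset.univ.filter fun i : Fin N => u₀ N < (W i ω l : ℝ)).card : ℝ) - 1 * t N|} ∪
      {ω | e * t N ≤ |((Finset.univ.filter fun i : Fin N => r * u₀ N < (W i ω l : ℝ)).card : ℝ) -
        r ^ (-α) * t N|} ∪
      {ω | e * t N ≤ |((Finset.univ.filter fun i : Fin N => r * r * u₀ N < (W i ω l : ℝ)).card : ℝ) -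
        (r * r) ^ (-α) * t N|})) ?_).trans ((measureReal_union_le _ _).trans
        ((add_le_add ((measureReal_union_le _ _).trans (add_le_add hκ hp1))
        ((measureReal_union_le _ _).trans (add_le_add ((measureReal_union_le _ _).trans
          (add_le_add ?_ hc2.le)) hc3.le))).trans (?_ :
            ε / 8 + ε / 8 + (ε / 8 + ε / 8 + ε / 8) ≤ ε)))
  · intro ω hω
    by_contra hcon
    simp only [Set.mem_union, not_or] at hcon
    obtain ⟨⟨g0, g1⟩, ⟨g2, g3⟩, g4⟩ := hcon
    simp only [hE0, Set.mem_ofPred_eq, not_not] at g0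
    simp only [hE1, Set.mem_ofPred_eq, not_le] at g1
    simp only [Set.mem_ofPred_eq, not_le, abs_lt] at g2 g3 g4
    have hS : IsSeparated g l (u N) ((1 + δ) * u N) c (a * u N ^ β) (κ' fun i => W i ω)
      (fun i : Fin N => W i ω) := g0
    simp only [hS, true_and] at g1
    have key := card_symmDiff_le (a := fun i j l => A N i j l ω) (w := fun i : Fin N => W i ω)
      (l := l) htN' (u₀ := u₀ N) (u := u N) (v := (1 + δ) * u N) (e := e * t N)
      (le_mul_of_one_le_left hu₀pos.le hr1.le) huv g1.le (by
        have : e * t N ≤ (1 - r ^ (-α)) / 4 * t N := by gcongr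
        have hra0 : r ^ (-α) * t N < t N := mul_lt_of_lt_one_left htpos hra
        change ((Finset.univ.filter fun i : Fin N => r * u₀ N < (W i ω l : ℝ)).card : ℝ) + e * t N < _
        linarith [g3.2])
    have hω' : ε * t N < _ := hω
    refine absurd (hω'.trans_le key) (not_lt.2 ?_)
    have e4 : (1 + δ) * u N = r * r * u₀ N := by simp only [hu]; ring
    rw [e4]
    have h7 : e * t N ≤ ε / 16 * t N := by gcongr
    have h8 : (1 - ε / 16) * t N ≤ (r * r) ^ (-α) * t N := by rw [hr2]; gcongr
    change (t N : ℝ) - ((Finset.univ.filter fun i : Fin N => u₀ N < (W i ω l : ℝ)).card : ℝ) +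
      2 * (((Finset.univ.filter fun i : Fin N => u₀ N < (W i ω l : ℝ)).card : ℝ) -
        ((Finset.univ.filter fun i : Fin N => r * r * u₀ N < (W i ω l : ℝ)).card : ℝ) + e * t N) ≤ _
    linarith [g2.1, g2.2, g4.1]
  · rw [one_mul]; exact hc1.le
  · linarith

end Layer

/-! ### Tail dependence, copulas and the Gumbel family. -/

section TailDependence

variable {L : ℕ} {ρ : Measure (Fin L → ℝ≥0)} [IsProbabilityMeasure ρ] {α : ℝ}

/-- The probability of a joint exceedance. -/
noncomputable def jointTail (ρ : Measure (Fin L → ℝ≥0)) (s m : Fin L) (a c : ℝ) : ℝ :=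
  ρ.real {w | a < (w s : ℝ) ∧ c < (w m : ℝ)}

lemma measurableSet_coord_gt (l : Fin L) (y : ℝ) :
    MeasurableSet {w : Fin L → ℝ≥0 | y < (w l : ℝ)} :=
  measurableSet_lt measurable_const (by fun_prop)

lemma jointTail_self {ρ : Measure (Fin L → ℝ≥0)} (s : Fin L) (a : ℝ) :
    jointTail ρ s s a a = tailFn (margin ρ s) a := by
  rw [tailFn_margin, jointTail]; simp

/-- Moving the corner changes the joint tail by at most the mass of two marginal strips, and each
strip is a difference of tails. Thresholds thus matter only through their marginal tails. -/
lemma jointTail_le_add (s m : Fin L) (a c a' c' : ℝ) :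
    jointTail ρ s m a c ≤ jointTail ρ s m a' c' +
      |tailFn (margin ρ s) a - tailFn (margin ρ s) a'| +
      |tailFn (margin ρ m) c - tailFn (margin ρ m) c'| := by
  have hstrip : ∀ (l : Fin L) (x x' : ℝ), ρ.real {w | x < (w l : ℝ) ∧ (w l : ℝ) ≤ x'} ≤
      |tailFn (margin ρ l) x - tailFn (margin ρ l) x'| := by
    intro l x x'
    rcases le_total x x' with h | h
    · have hsub : {w : Fin L → ℝ≥0 | x' < (w l : ℝ)} ⊆ {w | x < (w l : ℝ)} :=
        fun w hw => lt_of_le_of_lt h hw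
      have e : {w : Fin L → ℝ≥0 | x < (w l : ℝ) ∧ (w l : ℝ) ≤ x'} =
          {w | x < (w l : ℝ)} \ {w | x' < (w l : ℝ)} := by ext w; simp
      rw [e, measureReal_sdiff hsub (measurableSet_coord_gt l x'), tailFn_margin, tailFn_margin]
      exact le_abs_self _
    · have e : {w : Fin L → ℝ≥0 | x < (w l : ℝ) ∧ (w l : ℝ) ≤ x'} = ∅ := by
        refine Set.eq_empty_of_forall_notMem fun w hw => ?_
        have := hw.1.trans_le (hw.2.trans h)
        exact lt_irrefl _ this
      rw [e, measureReal_empty]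
      exact abs_nonneg _
  calc jointTail ρ s m a c ≤ ρ.real (({w | a' < (w s : ℝ) ∧ c' < (w m : ℝ)} ∪
        {w | a < (w s : ℝ) ∧ (w s : ℝ) ≤ a'}) ∪ {w | c < (w m : ℝ) ∧ (w m : ℝ) ≤ c'}) := by
        refine measureReal_mono ?_
        rintro w ⟨h1, h2⟩
        rcases lt_or_ge a' (w s : ℝ) with h3 | h3
        · rcases lt_or_ge c' (w m : ℝ) with h4 | h4
          · exact Or.inl (Or.inl ⟨h3, h4⟩)
          · exact Or.inr ⟨h2, h4⟩
        · exact Or.inl (Or.inr ⟨h1, h3⟩)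
    _ ≤ _ := (measureReal_union_le _ _).trans (add_le_add ((measureReal_union_le _ _).trans
        (add_le_add le_rfl (hstrip s a a'))) (hstrip m c c'))

lemma abs_jointTail_sub_le (s m : Fin L) (a c a' c' : ℝ) :
    |jointTail ρ s m a c - jointTail ρ s m a' c'| ≤
      |tailFn (margin ρ s) a - tailFn (margin ρ s) a'| +
      |tailFn (margin ρ m) c - tailFn (margin ρ m) c'| := by
  rw [abs_sub_le_iff]
  have h1 := jointTail_le_add (ρ := ρ) s m a c a' c'
  have h2 := jointTail_le_add (ρ := ρ) s m a' c' a c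
  rw [abs_sub_comm (tailFn (margin ρ s) a'), abs_sub_comm (tailFn (margin ρ m) c')] at h2
  constructor <;> linarith

/-- The joint exceedance probability of the quantiles. -/
noncomputable def jointQuantileTail (ρ : Measure (Fin L → ℝ≥0)) (s m : Fin L) (q : ℝ) : ℝ :=
  jointTail ρ s m (marginQuantile ρ s q) (marginQuantile ρ m q)

lemma utd_eq {ρ : Measure (Fin L → ℝ≥0)} (s m : Fin L) (q : ℝ) :
    utd ρ s m q = jointQuantileTail ρ s m q / tailFn (margin ρ s) (marginQuantile ρ s q) := by
  rw [utd, measureReal_def, cond_apply (measurableSet_coord_gt s _), ENNReal.toReal_mul,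
    ENNReal.toReal_inv, inv_mul_eq_div, tailFn_margin]
  rfl

lemma tendsto_iff_of_sub_tendsto_zero {f g : ℝ → ℝ} {l : Filter ℝ} {x : ℝ}
    (h : Tendsto (fun q => f q - g q) l (𝓝 0)) : Tendsto f l (𝓝 x) ↔ Tendsto g l (𝓝 x) := by
  constructor
  · intro hf; simpa using hf.sub h
  · intro hg; simpa using h.add hg

/-- The probability of the conditioning event is asymptotically `1 - q`. -/
lemma isUTDCoeff_iff {s : Fin L} (hs : HasRVTail (margin ρ s) α) (hα : 0 < α) (m : Fin L)
    (lam : ℝ) : IsUTDCoeff ρ s m lam ↔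
      Tendsto (fun q => jointQuantileTail ρ s m q / (1 - q)) (𝓝[<] 1) (𝓝 lam) := by
  have h1 := tendsto_tailFn_marginQuantile hs hα
  constructor
  · intro h
    have h2 := h.mul h1
    rw [mul_one] at h2
    refine h2.congr fun q => ?_
    rw [utd_eq, div_mul_div_cancel₀ (hs.pos _).ne']
  · intro h
    have h2 := h.div h1 one_ne_zero
    rw [div_one] at h2
    refine h2.congr' ?_
    filter_upwards [self_mem_nhdsWithin] with q hq
    have : 1 - q ≠ 0 := by
      have : q < 1 := hq
      linarith
    simp only [Pi.div_apply]
    rw [utd_eq, div_div_div_cancel_right₀ this]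

/-- Monotonicity and the Lipschitz property come from the nonnegative mass of four rectangles with
one side on the boundary of the unit square. -/
lemma IsCopula.abs_sub_le {C : ℝ → ℝ → ℝ} (hC : IsCopula C) {u u' v v' : ℝ} (hu : 0 ≤ u)
    (huu : u ≤ u') (hu' : u' ≤ 1) (hv : 0 ≤ v) (hvv : v ≤ v') (hv' : v' ≤ 1) :
    0 ≤ C u' v' - C u v ∧ C u' v' - C u v ≤ (u' - u) + (v' - v) := by
  have mu : u ∈ Set.Icc (0 : ℝ) 1 := ⟨hu, huu.trans hu'⟩
  have mu' : u' ∈ Set.Icc (0 : ℝ) 1 := ⟨hu.trans huu, hu'⟩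
  have mv : v ∈ Set.Icc (0 : ℝ) 1 := ⟨hv, hvv.trans hv'⟩
  have mv' : v' ∈ Set.Icc (0 : ℝ) 1 := ⟨hv.trans hvv, hv'⟩
  have m0 : (0 : ℝ) ∈ Set.Icc (0 : ℝ) 1 := ⟨le_rfl, zero_le_one⟩
  have m1 : (1 : ℝ) ∈ Set.Icc (0 : ℝ) 1 := ⟨zero_le_one, le_rfl⟩
  have a1 := hC.two_increasing u mu u' mu' 0 m0 v' mv' huu mv'.1
  have a2 := hC.two_increasing u mu u' mu' v' mv' 1 m1 huu hv'
  have a3 := hC.two_increasing 0 m0 u mu v mv v' mv' hu hvv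
  have a4 := hC.two_increasing u mu 1 m1 v mv v' mv' mu.2 hvv
  rw [hC.zero_right u mu, hC.zero_right u' mu'] at a1
  rw [hC.one_right u mu, hC.one_right u' mu'] at a2
  rw [hC.zero_left v mv, hC.zero_left v' mv'] at a3
  rw [hC.one_left v mv, hC.one_left v' mv'] at a4
  constructor <;> linarith

lemma marginalCDF_mem {ρ : Measure (Fin L → ℝ≥0)} (l : Fin L) (y : ℝ) :
    0 ≤ marginalCDF ρ l y ∧ marginalCDF ρ l y ≤ 1 :=
  ⟨cdf_nonneg _ _, cdf_le_one _ _⟩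

lemma jointTail_eq_copula {s m : Fin L} {C : ℝ → ℝ → ℝ} (hC : IsPairCopula ρ s m C) (a c : ℝ) :
    jointTail ρ s m a c =
      1 - marginalCDF ρ s a - marginalCDF ρ m c + C (marginalCDF ρ s a) (marginalCDF ρ m c) := by
  rw [← hC.sklar]
  set A : Set (Fin L → ℝ≥0) := {w | (w s : ℝ) ≤ a}
  set B : Set (Fin L → ℝ≥0) := {w | (w m : ℝ) ≤ c}
  have hA : MeasurableSet A := measurableSet_le (by fun_prop) measurable_const
  have hB : MeasurableSet B := measurableSet_le (by fun_prop) measurable_const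
  have h1 : jointTail ρ s m a c = 1 - ρ.real (A ∪ B) := by
    rw [← probReal_compl_eq_one_sub (hA.union hB), jointTail]
    congr 1
    ext w
    simp [A, B]
  have hcdf : ∀ (l : Fin L) (y : ℝ), marginalCDF ρ l y = ρ.real {w | (w l : ℝ) ≤ y} := by
    intro l y
    have hm : Measurable fun w : Fin L → ℝ≥0 => (w l : ℝ) := by fun_prop
    have : IsProbabilityMeasure (ρ.map fun w => (w l : ℝ)) :=
      Measure.isProbabilityMeasure_map hm.aemeasurable
    rw [marginalCDF, cdf_eq_real, map_measureReal_apply hm measurableSet_Iic]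
    rfl
  have h2 := measureReal_union_add_inter (μ := ρ) (s := A) hB
  rw [h1, hcdf, hcdf]
  change _ = 1 - ρ.real A - ρ.real B + ρ.real (A ∩ B)
  linarith

/-- The upper tail dependence coefficient in terms of the copula. -/
lemma isUTDCoeff_iff_copula {s m : Fin L} (hs : HasRVTail (margin ρ s) α)
    (hm : HasRVTail (margin ρ m) α) (hα : 0 < α) {C : ℝ → ℝ → ℝ} (hC : IsPairCopula ρ s m C)
    (lam : ℝ) : IsUTDCoeff ρ s m lam ↔
      Tendsto (fun q : ℝ => (1 - 2 * q + C q q) / (1 - q)) (𝓝[<] 1) (𝓝 lam) := by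
  rw [isUTDCoeff_iff hs hα]
  refine tendsto_iff_of_sub_tendsto_zero ?_
  have h1 := (tendsto_tailFn_marginQuantile hs hα).add (tendsto_tailFn_marginQuantile hm hα)
  -- This is the sum of the gaps `F(F⁻¹(q)) - q` divided by `1 - q`. It bounds the error, since the
  -- two numerators differ by the increment of `C` minus these gaps.
  have h2 := h1.const_sub 2
  rw [show (2 : ℝ) - (1 + 1) = 0 by norm_num] at h2
  refine squeeze_zero_norm' ?_ h2
  filter_upwards [self_mem_nhdsWithin,
    nhdsWithin_le_nhds (lt_mem_nhds (show (0 : ℝ) < 1 by norm_num))] with q hq hq0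
  have hq1 : q < 1 := hq
  have hq' : 0 < 1 - q := by linarith
  have b1 := tailFn_marginQuantile_le (ρ := ρ) s hq1
  have b2 := tailFn_marginQuantile_le (ρ := ρ) m hq1
  rw [jointQuantileTail, jointTail_eq_copula hC]
  have c1 := marginalCDF_eq (ρ := ρ) s (marginQuantile ρ s q)
  have c2 := marginalCDF_eq (ρ := ρ) m (marginQuantile ρ m q)
  set a := marginalCDF ρ s (marginQuantile ρ s q)
  set c := marginalCDF ρ m (marginQuantile ρ m q)
  have ha : a ≤ 1 := (marginalCDF_mem _ _).2
  have hc : c ≤ 1 := (marginalCDF_mem _ _).2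
  obtain ⟨d1, d2⟩ := hC.copula.abs_sub_le hq0.le (show q ≤ a by linarith) ha hq0.le
    (show q ≤ c by linarith) hc
  rw [← sub_div, ← add_div, Real.norm_eq_abs, abs_div, abs_of_pos hq', div_le_iff₀ hq',
    sub_mul, div_mul_cancel₀ _ hq'.ne', abs_le]
  constructor <;> linarith

lemma gumbel_diag {θ q : ℝ} (hθ : 1 ≤ θ) (h0 : 0 < q) (h1 : q < 1) :
    gumbel θ q q = q ^ ((2 : ℝ) ^ (1 / θ)) := by
  have hl : 0 ≤ -Real.log q := by
    have := Real.log_neg h0 h1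
    linarith
  rw [gumbel, if_neg (by simp [h0.ne']), ← two_mul, Real.mul_rpow (by norm_num) (by positivity),
    ← Real.rpow_mul hl, mul_one_div_cancel (by linarith), Real.rpow_one, Real.rpow_def_of_pos h0]
  congr 1
  ring

/-- With `p = 2 ^ (1 / θ)` the quotient is `2 - (q ^ p - 1) / (q - 1)`, and the slope tends to the
derivative `p` of `x ^ p` at one. -/
lemma tendsto_gumbel {θ : ℝ} (hθ : 1 ≤ θ) :
    Tendsto (fun q : ℝ => (1 - 2 * q + gumbel θ q q) / (1 - q)) (𝓝[<] 1)
      (𝓝 (2 - 2 ^ (1 / θ))) := by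
  set p : ℝ := (2 : ℝ) ^ (1 / θ)
  have hd : HasDerivAt (fun x : ℝ => x ^ p) (p * 1 ^ (p - 1)) 1 :=
    Real.hasDerivAt_rpow_const (Or.inl one_ne_zero)
  rw [Real.one_rpow, mul_one] at hd
  have h2 := (hd.tendsto_slope.mono_left (nhdsWithin_mono 1
    (fun x (hx : x < 1) => hx.ne) : 𝓝[<] (1 : ℝ) ≤ 𝓝[≠] 1)).const_sub 2
  refine h2.congr' ?_
  filter_upwards [self_mem_nhdsWithin,
    nhdsWithin_le_nhds (lt_mem_nhds (show (0 : ℝ) < 1 by norm_num))] with q hq hq0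
  have hq1 : q < 1 := hq
  have hq' : 1 - q ≠ 0 := by linarith
  have hq'' : q - 1 ≠ 0 := by linarith
  rw [gumbel_diag hθ hq0 hq1, slope_def_field, Real.one_rpow]
  rw [eq_div_iff hq', sub_mul, div_mul_eq_mul_div, sub_eq_iff_eq_add, ← sub_eq_iff_eq_add', eq_div_iff hq'']
  ring

end TailDependence

/-! ### Consistency of the estimator. -/

section Estimator

variable {Ω : Type*} [MeasurableSpace Ω] {μ : Measure Ω} [IsProbabilityMeasure μ] {L : ℕ} {α : ℝ}
  {ρ : Measure (Fin L → ℝ≥0)} [IsProbabilityMeasure ρ] {W : ℕ → Ω → Fin L → ℝ≥0}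
  {g : Fin L → ℝ≥0 → ℝ≥0} {A : (N : ℕ) → Fin N → Fin N → Fin L → Ω → ℕ} {t : ℕ → ℕ}

lemma card_inter_le {ι : Type*} [DecidableEq ι] (A B A' B' : Finset ι) :
    (A ∩ B).card ≤ (A' ∩ B').card + (symmDiff A' A).card + (symmDiff B' B).card := by
  refine (Finset.card_le_card (t := (A' ∩ B' ∪ symmDiff A' A) ∪ symmDiff B' B) ?_).trans
    ((Finset.card_union_le _ _).trans (add_le_add (Finset.card_union_le _ _) le_rfl))
  intro i hi
  simp only [Finset.mem_union, Finset.mem_inter, Finset.mem_symmDiff] at hi ⊢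
  tauto

lemma abs_div_sub_le {n d t lam e : ℝ} (ht : 0 < t) (he : 0 < e) (he4 : e ≤ 1 / 4)
    (hn : |n - lam * t| ≤ 3 * e * t) (hd : |d - t| ≤ 2 * e * t) :
    |n / d - lam| ≤ (6 + 4 * |lam|) * e := by
  have hd' : t / 2 ≤ d := by
    have := (abs_le.1 hd).1
    nlinarith
  have hd0 : 0 < d := by linarith
  have : n / d - lam = ((n - lam * t) - lam * (d - t)) / d := by field_simp; ring
  rw [this, abs_div, abs_of_pos hd0, div_le_iff₀ hd0]
  calc |n - lam * t - lam * (d - t)| ≤ |n - lam * t| + |lam * (d - t)| := abs_sub _ _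
    _ ≤ 3 * e * t + |lam| * (2 * e * t) := by
        rw [abs_mul]; gcongr
    _ = (6 + 4 * |lam|) * e * (t / 2) := by ring
    _ ≤ _ := by gcongr

/-- The numerator has error `3 e t`, from its own count and both symmetric differences; the
denominator has error `2 e t`. -/
lemma abs_card_inter_div_sub_le {ι : Type*} [DecidableEq ι] {S M S' M' : Finset ι}
    {t lam e : ℝ} (ht : 0 < t) (he : 0 < e) (he4 : e ≤ 1 / 4)
    (h1 : |((S ∩ M).card : ℝ) - lam * t| < e * t) (h2 : |(S.card : ℝ) - 1 * t| < e * t)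
    (h3 : ((symmDiff S S').card : ℝ) ≤ e * t) (h4 : ((symmDiff M M').card : ℝ) ≤ e * t) :
    |((S' ∩ M').card : ℝ) / S'.card - lam| ≤ (6 + 4 * |lam|) * e := by
  have a1 : ((S' ∩ M').card : ℝ) ≤ (S ∩ M).card + (symmDiff S S').card + (symmDiff M M').card := by
    exact_mod_cast card_inter_le S' M' S M
  have a2 : ((S ∩ M).card : ℝ) ≤ (S' ∩ M').card + (symmDiff S' S).card + (symmDiff M' M).card := by
    exact_mod_cast card_inter_le S M S' M'
  have a3 : (S'.card : ℝ) ≤ S.card + (symmDiff S S').card := by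
    -- Intersecting with `S ∪ S'` turns the bound on intersections into one on single sets.
    have := card_inter_le S' (S ∪ S') S (S ∪ S')
    simp only [symmDiff_self, Finset.bot_eq_empty, Finset.card_empty,
      Finset.inter_eq_left.2 Finset.subset_union_left,
      Finset.inter_eq_left.2 Finset.subset_union_right] at this
    exact_mod_cast this
  have a4 : (S.card : ℝ) ≤ S'.card + (symmDiff S' S).card := by
    have := card_inter_le S (S ∪ S') S' (S ∪ S')
    simp only [symmDiff_self, Finset.bot_eq_empty, Finset.card_empty,
      Finset.inter_eq_left.2 Finset.subset_union_left,
      Finset.inter_eq_left.2 Finset.subset_union_right] at this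
    exact_mod_cast this
  rw [symmDiff_comm] at a2 a4
  rw [symmDiff_comm M' M] at a2
  obtain ⟨b1, b2⟩ := abs_lt.1 h1
  obtain ⟨b3, b4⟩ := abs_lt.1 h2
  refine abs_div_sub_le ht he he4 (abs_le.2 ⟨?_, ?_⟩) (abs_le.2 ⟨?_, ?_⟩) <;> linarith

/-- Consistency of the degree-based estimator. -/
theorem tendstoInMeasure_utdEstimator (hα : 0 < α)
    (hmarg : ∀ l, IsRegularlyVarying (marginalTail ρ l) (-α)) (hW : ∀ i, Measurable (W i))
    (hind : iIndepFun W μ) (hlaw : ∀ i, μ.map (W i) = ρ) (hg : ∀ l, IsConnectionFun α (g l))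
    (hA : ∀ N, IsMIRG μ g (fun i : Fin N => W i) (A N)) (ht : Tendsto t atTop atTop)
    (htN : Tendsto (fun N : ℕ => (t N : ℝ) / N) atTop (𝓝 0)) {s m : Fin L} {lam : ℝ}
    (hlam : IsUTDCoeff ρ s m lam) :
    TendstoInMeasure μ (fun N ω => utdEstimator (fun i j l => A N i j l ω) (t N) s m) atTop
      (fun _ => lam) := by
  classical
  have hRVs := hasRVTail_margin (hmarg s)
  have htR : Tendsto (fun N => (t N : ℝ)) atTop atTop := tendsto_natCast_atTop_atTop.comp ht
  rw [isUTDCoeff_iff hRVs hα] at hlam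
  have hjoint := tendsto_comp_level ht htN hlam
  have hsingle := tendsto_comp_level ht htN (tendsto_tailFn_marginQuantile hRVs hα)
  have hcj : ∀ e : ℝ, 0 < e → Tendsto (fun N : ℕ => μ.real {ω | e * t N ≤
      |((Finset.univ.filter fun i : Fin N =>
        marginQuantile ρ s (1 - (t N : ℝ) / N) < (W i ω s : ℝ) ∧
        marginQuantile ρ m (1 - (t N : ℝ) / N) < (W i ω m : ℝ)).card : ℝ) - lam * t N|})
      atTop (𝓝 0) := fun e he => tendsto_measure_count hW hind hlaw ht
    (B := fun N => {w | marginQuantile ρ s (1 - (t N : ℝ) / N) < (w s : ℝ) ∧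
      marginQuantile ρ m (1 - (t N : ℝ) / N) < (w m : ℝ)})
    (fun N => (measurableSet_coord_gt s _).inter (measurableSet_coord_gt m _)) hjoint he
  have hcs : ∀ e : ℝ, 0 < e → Tendsto (fun N : ℕ => μ.real {ω | e * t N ≤
      |((Finset.univ.filter fun i : Fin N =>
        marginQuantile ρ s (1 - (t N : ℝ) / N) < (W i ω s : ℝ)).card : ℝ) - 1 * t N|})
      atTop (𝓝 0) := fun e he => tendsto_measure_count hW hind hlaw ht
    (B := fun N => {w | marginQuantile ρ s (1 - (t N : ℝ) / N) < (w s : ℝ)})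
    (fun N => measurableSet_coord_gt s _) (by simpa only [tailFn_margin] using hsingle) he
  rw [tendstoInMeasure_iff_measureReal_dist]
  intro ε hε
  rw [tendsto_order]
  refine ⟨fun r hr => .of_forall fun N => hr.trans_le measureReal_nonneg, fun r hr => ?_⟩
  have hK : 0 < 6 + 4 * |lam| := by positivity
  obtain ⟨e, he, he'⟩ : ∃ e : ℝ, 0 < e ∧ e < min (1 / 4) (min (r / 4) (ε / (6 + 4 * |lam|))) :=
    exists_between (by positivity)
  have he4 : e < 1 / 4 := he'.trans_le (min_le_left _ _)
  have her : e < r / 4 := he'.trans_le ((min_le_right _ _).trans (min_le_left _ _))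
  have heε : (6 + 4 * |lam|) * e < ε := by
    rw [mul_comm]
    exact (lt_div_iff₀ hK).1 (he'.trans_le ((min_le_right _ _).trans (min_le_right _ _)))
  filter_upwards [htR.eventually_gt_atTop 0,
    tendsto_measure_symmDiff hα hmarg hW hind hlaw hg hA ht htN s he,
    tendsto_measure_symmDiff hα hmarg hW hind hlaw hg hA ht htN m he,
    (hcj e he).eventually (gt_mem_nhds he), (hcs e he).eventually (gt_mem_nhds he)]
    with N htpos p1 p2 p3 p4
  refine lt_of_le_of_lt ((measureReal_mono (fun ω hω => ?_)).trans
    ((measureReal_union_le _ _).trans (add_le_add ((measureReal_union_le _ _).trans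
      (add_le_add p1 p2)) ((measureReal_union_le _ _).trans (add_le_add p3.le p4.le))))) (by linarith)
  by_contra hcon
  simp only [Set.mem_union, Set.mem_ofPred_eq, not_or, not_lt, not_le] at hcon
  obtain ⟨⟨q1, q2⟩, q3, q4⟩ := hcon
  rw [Finset.filter_and] at q3
  have key := abs_card_inter_div_sub_le htpos he he4.le q3 q4 q1 q2
  rw [← Finset.filter_and] at key
  exact absurd (hω : ε ≤ |utdEstimator (fun i j l => A N i j l ω) (t N) s m - lam|)
    (not_le.2 (key.trans_lt heε))

end Estimator

/-! ### Existence of the coefficient under multivariate regular variation. -/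

section MultivariateRegularVariation

variable {L : ℕ} {ρ : Measure (Fin L → ℝ≥0)} [IsProbabilityMeasure ρ] {α : ℝ} {b : ℝ≥0 → ℝ≥0}
  {ν : Measure (Fin L → ℝ≥0)}

/-- A continuous approximation of the indicator of `{z | x < z s ∧ y < z m}`. -/
noncomputable def cornerBump (s m : Fin L) (x y η : ℝ≥0) (z : Fin L → ℝ≥0) : ℝ≥0 :=
  min 1 ((z s - x) / η) * min 1 ((z m - y) / η)

lemma continuous_cornerBump (s m : Fin L) (x y η : ℝ≥0) : Continuous (cornerBump s m x y η) := by
  unfold cornerBump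
  fun_prop

lemma cornerBump_le_one (s m : Fin L) (x y η : ℝ≥0) (z : Fin L → ℝ≥0) :
    cornerBump s m x y η z ≤ 1 :=
  mul_le_one' (min_le_left _ _) (min_le_left _ _)

lemma cornerBump_ne_zero_iff {s m : Fin L} {x y η : ℝ≥0} (hη : 0 < η) (z : Fin L → ℝ≥0) :
    cornerBump s m x y η z ≠ 0 ↔ x < z s ∧ y < z m := by
  have h : ∀ a c : ℝ≥0, min 1 ((a - c) / η) ≠ 0 ↔ c < a := by
    intro a c
    rw [← pos_iff_ne_zero, lt_min_iff, div_pos_iff_of_pos_right hη, tsub_pos_iff_lt]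
    simp
  rw [cornerBump, mul_ne_zero_iff, h, h]

lemma cornerBump_eq_one {s m : Fin L} {x y η : ℝ≥0} (hη : 0 < η) {z : Fin L → ℝ≥0}
    (hs : x + η < z s) (hm : y + η < z m) : cornerBump s m x y η z = 1 := by
  have h : ∀ a c : ℝ≥0, c + η < a → min 1 ((a - c) / η) = 1 := by
    intro a c h
    rw [min_eq_left_iff, one_le_div hη]
    exact le_tsub_of_add_le_left h.le
  rw [cornerBump, h _ _ hs, h _ _ hm, one_mul]

lemma le_dist_of_cornerBump_ne_zero {s m : Fin L} {x y η : ℝ≥0} (hη : 0 < η) {z : Fin L → ℝ≥0}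
    (h : cornerBump s m x y η z ≠ 0) : (x : ℝ) ≤ dist z 0 := by
  have h1 : (x : ℝ) < z s := ((cornerBump_ne_zero_iff hη z).1 h).1
  refine h1.le.trans (le_trans ?_ (dist_le_pi_dist z 0 s))
  rw [NNReal.dist_eq]
  simp

lemma isMTest_cornerBump (s m : Fin L) {x y η : ℝ≥0} (hx : 0 < x) (hη : 0 < η) :
    IsMTest (cornerBump s m x y η) where
  continuousOn := (continuous_cornerBump s m x y η).continuousOn
  bounded := ⟨1, cornerBump_le_one s m x y η⟩
  away := ⟨x, hx, fun _ h => le_dist_of_cornerBump_ne_zero hη h⟩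

/-- Rescaled joint tails are sandwiched by a convergent quantity. -/
lemma IsMRV.exists_jointTail_bounds (h : IsMRV ρ α b ν) (s m : Fin L) {x y η : ℝ≥0} (hx : 0 < x)
    (hη : 0 < η) : ∃ i : ℝ, (ν {z | x < z s ∧ y < z m} ≠ 0 → 0 < i) ∧ ∀ ε : ℝ, 0 < ε →
      ∀ᶠ t : ℝ≥0 in atTop,
        t * jointTail ρ s m ((x + η : ℝ≥0) * b t) ((y + η : ℝ≥0) * b t) ≤ i + ε ∧
        i - ε ≤ t * jointTail ρ s m (x * b t) (y * b t) := by
  set f := cornerBump s m x y η with hf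
  have hfm : Measurable f := (continuous_cornerBump s m x y η).measurable
  have hfin : ∫⁻ z, (f z : ℝ≥0∞) ∂ν ≠ ∞ := by
    have hmeas : MeasurableSet {z : Fin L → ℝ≥0 | (x : ℝ) ≤ dist z 0} :=
      (isClosed_le continuous_const (continuous_id.dist continuous_const)).measurableSet
    refine ne_top_of_le_ne_top (h.limit.finite_away x hx).ne ?_
    rw [← lintegral_indicator_one hmeas]
    refine lintegral_mono fun z => ?_
    by_cases hz : f z = 0
    · simp [hz]
    · rw [Set.indicator_of_mem (show z ∈ {z : Fin L → ℝ≥0 | (x : ℝ) ≤ dist z 0} from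
        le_dist_of_cornerBump_ne_zero hη hz)]
      exact ENNReal.coe_le_one_iff.2 (cornerBump_le_one s m x y η z)
  refine ⟨(∫⁻ z, (f z : ℝ≥0∞) ∂ν).toReal, fun hpos => ?_, fun ε hε => ?_⟩
  · refine ENNReal.toReal_pos ?_ hfin
    rw [← pos_iff_ne_zero, lintegral_pos_iff_support hfm.coe_nnreal_ennreal, pos_iff_ne_zero]
    convert hpos using 2
    ext z
    rw [Function.mem_support, ENNReal.coe_ne_zero]
    exact cornerBump_ne_zero_iff hη z
  · have hlim := (ENNReal.tendsto_toReal hfin).comp (h.tendsto f (isMTest_cornerBump s m hx hη))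
    filter_upwards [h.scaling.eventually_pos, hlim.eventually (Metric.ball_mem_nhds _ hε)]
      with t hb hball
    simp only [Function.comp_apply, Real.dist_eq, ENNReal.toReal_mul,
      ENNReal.coe_toReal] at hball
    obtain ⟨h1, h2⟩ := abs_lt.1 hball
    set I := ∫⁻ z, (f (fun l => z l / b t) : ℝ≥0∞) ∂ρ with hI
    have hset : ∀ (l : Fin L) (a : ℝ≥0) (z : Fin L → ℝ≥0),
        (a : ℝ) * b t < z l ↔ a < z l / b t := by
      intro l a z
      rw [lt_div_iff₀ hb, ← NNReal.coe_lt_coe, NNReal.coe_mul]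
    have hmeas : ∀ a c : ℝ, MeasurableSet {w : Fin L → ℝ≥0 | a < (w s : ℝ) ∧ c < (w m : ℝ)} :=
      fun a c => (measurableSet_coord_gt s _).inter (measurableSet_coord_gt m _)
    have hup : I ≤ ρ {w | x * b t < (w s : ℝ) ∧ y * b t < (w m : ℝ)} := by
      rw [← lintegral_indicator_one (hmeas _ _)]
      refine lintegral_mono fun z => ?_
      by_cases hz : f (fun l => z l / b t) = 0
      · simp [hz]
      · have := (cornerBump_ne_zero_iff hη _).1 hz
        rw [Set.indicator_of_mem (show z ∈ {w : Fin L → ℝ≥0 |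
          (x : ℝ) * b t < (w s : ℝ) ∧ (y : ℝ) * b t < (w m : ℝ)} from
          ⟨(hset s x z).2 this.1, (hset m y z).2 this.2⟩)]
        exact ENNReal.coe_le_one_iff.2 (cornerBump_le_one s m x y η _)
    have hlow : ρ {w | (x + η : ℝ≥0) * b t < (w s : ℝ) ∧ (y + η : ℝ≥0) * b t < (w m : ℝ)} ≤ I := by
      rw [← lintegral_indicator_one (hmeas _ _)]
      refine lintegral_mono fun z => ?_
      by_cases hz : z ∈ {w : Fin L → ℝ≥0 |
          ((x + η : ℝ≥0) : ℝ) * b t < (w s : ℝ) ∧ ((y + η : ℝ≥0) : ℝ) * b t < (w m : ℝ)}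
      · rw [Set.indicator_of_mem hz, hf, cornerBump_eq_one hη ((hset s _ z).1 hz.1)
          ((hset m _ z).1 hz.2)]
        simp
      · rw [Set.indicator_of_notMem hz]
        exact zero_le
    have hIfin : I ≠ ∞ := ne_top_of_le_ne_top (measure_ne_top _ _) hup
    have r1 : I.toReal ≤ jointTail ρ s m (x * b t) (y * b t) :=
      ENNReal.toReal_mono (measure_ne_top _ _) hup
    have r2 : jointTail ρ s m ((x + η : ℝ≥0) * b t) ((y + η : ℝ≥0) * b t) ≤ I.toReal :=
      ENNReal.toReal_mono hIfin hlow
    have r3 := mul_le_mul_of_nonneg_left r1 t.coe_nonneg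
    have r4 := mul_le_mul_of_nonneg_left r2 t.coe_nonneg
    constructor <;> linarith

lemma IsMRV.exists_tail_le (h : IsMRV ρ α b ν) (s : Fin L) :
    ∃ H : ℝ, ∀ᶠ t : ℝ≥0 in atTop, t * tailFn (margin ρ s) (2 * b t) ≤ H := by
  obtain ⟨i, -, hi⟩ := h.exists_jointTail_bounds s s (y := 1) one_pos (one_pos (α := ℝ≥0))
  refine ⟨i + 1, (hi 1 one_pos).mono fun t ht => ?_⟩
  have := ht.1
  rwa [jointTail_self, show ((1 + 1 : ℝ≥0) : ℝ) = 2 by norm_num] at this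

/-- If `b t ≤ K`, then `t P(W_s > 2 b(t)) ≥ t P(W_s > 2K)`, which exceeds any bound for large `t`
because the tail never vanishes. -/
lemma IsMRV.tendsto_scaling_atTop (h : IsMRV ρ α b ν) {s : Fin L}
    (hs : HasRVTail (margin ρ s) α) : Tendsto (fun t => (b t : ℝ)) atTop atTop := by
  obtain ⟨H, hH⟩ := h.exists_tail_le s
  rw [tendsto_atTop]
  intro K
  have hcoe : Tendsto (fun t : ℝ≥0 => (t : ℝ)) atTop atTop := NNReal.tendsto_coe_atTop.2 tendsto_id
  filter_upwards [hH, hcoe.eventually_gt_atTop (H / tailFn (margin ρ s) (2 * K))] with t h1 h2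
  by_contra hcon
  rw [div_lt_iff₀ (hs.pos _)] at h2
  have h3 : tailFn (margin ρ s) (2 * K) ≤ tailFn (margin ρ s) (2 * b t) :=
    tailFn_antitone (by linarith)
  have h4 := mul_le_mul_of_nonneg_left h3 t.coe_nonneg
  linarith

lemma IsMRV.tendsto_ratio (h : IsMRV ρ α b ν) {s : Fin L} (hs : HasRVTail (margin ρ s) α) {x : ℝ}
    (hx : 0 < x) : Tendsto (fun t => tailFn (margin ρ s) (x * b t) / tailFn (margin ρ s) (b t))
      atTop (𝓝 (x ^ (-α))) := by
  refine ((hs.tendsto x hx).comp (h.tendsto_scaling_atTop hs)).congr fun t => ?_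
  simp only [Function.comp_apply, mul_comm]

lemma IsMRV.exists_tail_scaling_le (h : IsMRV ρ α b ν) {s : Fin L}
    (hs : HasRVTail (margin ρ s) α) :
    ∃ H : ℝ, 0 < H ∧ ∀ᶠ t : ℝ≥0 in atTop, t * tailFn (margin ρ s) (b t) ≤ H := by
  obtain ⟨H, hH⟩ := h.exists_tail_le s
  have h2 : (0 : ℝ) < 2 ^ (-α) := by positivity
  refine ⟨max (H / (2 ^ (-α) / 2)) 1, lt_max_of_lt_right one_pos, ?_⟩
  filter_upwards [hH, (h.tendsto_ratio hs two_pos).eventually (lt_mem_nhds (half_lt_self h2))]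
    with t h3 h4
  refine le_max_of_le_left ?_
  rw [lt_div_iff₀ (hs.pos _)] at h4
  rw [le_div_iff₀ (half_pos h2)]
  have := mul_le_mul_of_nonneg_left h4.le t.coe_nonneg
  linarith

/-- Thin strips carry little mass. -/
lemma IsMRV.eventually_strip_le (h : IsMRV ρ α b ν) {s : Fin L} (hs : HasRVTail (margin ρ s) α)
    {x : ℝ≥0} (hx : 0 < x) {e : ℝ} (he : 0 < e) :
    ∀ᶠ η : ℝ≥0 in 𝓝[>] 0, ∀ᶠ t : ℝ≥0 in atTop,
      t * |tailFn (margin ρ s) (x * b t) - tailFn (margin ρ s) ((x + η : ℝ≥0) * b t)| ≤ e := by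
  obtain ⟨H, hH, hbd⟩ := h.exists_tail_scaling_le hs
  have hx' : (0 : ℝ) < x := hx
  have hc : Tendsto (fun η : ℝ≥0 => |(x : ℝ) ^ (-α) - ((x + η : ℝ≥0) : ℝ) ^ (-α)|) (𝓝[>] 0)
      (𝓝 |(x : ℝ) ^ (-α) - ((x + 0 : ℝ≥0) : ℝ) ^ (-α)|) := by
    refine Tendsto.mono_left ?_ nhdsWithin_le_nhds
    refine (tendsto_const_nhds.sub (Tendsto.rpow_const ?_ (Or.inl ?_))).abs
    · exact (NNReal.continuous_coe.comp (continuous_const.add continuous_id)).tendsto 0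
    · simpa using hx'.ne'
  rw [add_zero, sub_self, abs_zero] at hc
  filter_upwards [hc.eventually (gt_mem_nhds (div_pos he hH))] with η hη
  have hxη : (0 : ℝ) < ((x + η : ℝ≥0) : ℝ) := by
    rw [NNReal.coe_add]; linarith [η.coe_nonneg]
  -- The strip is measured in units of `P(W_s > b(t))`. Regular variation of the margin and
  -- continuity of the power replace any argument about `ν`-null boundaries.
  have hr := ((h.tendsto_ratio hs hx').sub (h.tendsto_ratio hs hxη)).abs
  filter_upwards [hbd, hr.eventually (gt_mem_nhds hη)] with t h1 h2
  have hp := hs.pos (b t)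
  rw [← sub_div, abs_div, abs_of_pos hp, div_lt_iff₀ hp] at h2
  calc (t : ℝ) * _ ≤ t * (e / H * tailFn (margin ρ s) (b t)) := by gcongr
    _ = e / H * (t * tailFn (margin ρ s) (b t)) := by ring
    _ ≤ e / H * H := by gcongr
    _ = e := div_mul_cancel₀ _ hH.ne'

/-- The centre `i` may change with `e`, as does the integral of the bump when its width `η` shrinks;
completeness supplies the limit. -/
lemma exists_tendsto_of_forall_eventually_le {f : ℝ≥0 → ℝ}
    (h : ∀ e : ℝ, 0 < e → ∃ i : ℝ, ∀ᶠ t in atTop, |f t - i| ≤ e) :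
    ∃ l, Tendsto f atTop (𝓝 l) := by
  refine cauchy_map_iff_exists_tendsto.1 (Metric.cauchy_iff.2 ⟨inferInstance, fun ε hε => ?_⟩)
  obtain ⟨i, hi⟩ := h (ε / 3) (by positivity)
  refine ⟨f '' {t | |f t - i| ≤ ε / 3}, image_mem_map hi, ?_⟩
  rintro _ ⟨t, ht, rfl⟩ _ ⟨t', ht', rfl⟩
  have h1 : |f t - i| ≤ ε / 3 := ht
  have h2 : |f t' - i| ≤ ε / 3 := ht'
  have h3 := abs_sub_le (f t) i (f t')
  rw [abs_sub_comm i] at h3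
  rw [Real.dist_eq]
  linarith

/-- Rescaled joint tails converge. -/
lemma IsMRV.exists_tendsto_jointTail (h : IsMRV ρ α b ν) {s m : Fin L}
    (hs : HasRVTail (margin ρ s) α) (hm : HasRVTail (margin ρ m) α) {x y : ℝ≥0} (hx : 0 < x)
    (hy : 0 < y) :
    ∃ l, Tendsto (fun t : ℝ≥0 => t * jointTail ρ s m (x * b t) (y * b t)) atTop (𝓝 l) := by
  refine exists_tendsto_of_forall_eventually_le fun e he => ?_
  obtain ⟨η, ⟨h1, h2⟩, hη⟩ := (((h.eventually_strip_le hs hx (show 0 < e / 3 by positivity)).and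
    (h.eventually_strip_le hm hy (show 0 < e / 3 by positivity))).and
      self_mem_nhdsWithin).exists
  obtain ⟨i, -, hi⟩ := h.exists_jointTail_bounds s m (y := y) hx hη
  refine ⟨i, ?_⟩
  filter_upwards [h1, h2, hi (e / 3) (by positivity)] with t k1 k2 k3
  have k4 := mul_le_mul_of_nonneg_left (abs_jointTail_sub_le (ρ := ρ) s m (x * b t) (y * b t)
    ((x + η : ℝ≥0) * b t) ((y + η : ℝ≥0) * b t)) t.coe_nonneg
  have k5 := mul_le_mul_of_nonneg_left (le_abs_self (jointTail ρ s m (x * b t) (y * b t) -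
    jointTail ρ s m ((x + η : ℝ≥0) * b t) ((y + η : ℝ≥0) * b t))) t.coe_nonneg
  rw [mul_add] at k4
  rw [mul_sub] at k5
  rw [abs_le]
  constructor <;> linarith [k3.1, k3.2]

/-- If the limit measure charges the `s`-th coordinate, then some multiple of the scaling function
is asymptotically the `(1 - 1/t)`-quantile. -/
lemma IsMRV.exists_tendsto_tail_one (h : IsMRV ρ α b ν) (hα : 0 < α) {s : Fin L}
    (hs : HasRVTail (margin ρ s) α) (hν : ν {x | 1 < x s} ≠ 0) :
    ∃ x : ℝ≥0, 0 < x ∧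
      Tendsto (fun t : ℝ≥0 => t * tailFn (margin ρ s) (x * b t)) atTop (𝓝 1) := by
  obtain ⟨c, hc⟩ := h.exists_tendsto_jointTail hs hs one_pos one_pos
  obtain ⟨i, hi, hi'⟩ := h.exists_jointTail_bounds s s (y := 1) one_pos (one_pos (α := ℝ≥0))
  have hi0 : 0 < i := hi (by simpa using hν)
  have hcpos : 0 < c := by
    refine (half_pos hi0).trans_le (ge_of_tendsto hc ?_)
    filter_upwards [hi' (i / 2) (half_pos hi0)] with t ht
    linarith [ht.2]
  simp only [NNReal.coe_one, one_mul, jointTail_self] at hc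
  -- The limit at `x b(t)` is `c x ^ (-α)`, which is one for this `x`.
  refine ⟨(c ^ (1 / α)).toNNReal, Real.toNNReal_pos.2 (by positivity), ?_⟩
  have hx : 0 < c ^ (1 / α) := by positivity
  rw [Real.coe_toNNReal _ hx.le]
  have h1 := hc.mul (h.tendsto_ratio hs hx)
  rw [← Real.rpow_mul hcpos.le, show 1 / α * -α = -1 by field_simp, Real.rpow_neg_one,
    mul_inv_cancel₀ hcpos.ne'] at h1
  refine h1.congr fun t => ?_
  rw [mul_assoc, mul_div_cancel₀ _ (hs.pos _).ne']

/-- At `t = 1 / (1 - q)` the quantile and the multiple of `b(t)` have the same marginal tail up to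
`o(1 - q)`, so their joint tails agree to that order. The thresholds themselves need not be
compared. -/
theorem IsMRV.exists_isUTDCoeff (h : IsMRV ρ α b ν) (hα : 0 < α) {s m : Fin L}
    (hs : HasRVTail (margin ρ s) α) (hm : HasRVTail (margin ρ m) α) (hνs : ν {x | 1 < x s} ≠ 0)
    (hνm : ν {x | 1 < x m} ≠ 0) : ∃ lam : ℝ, IsUTDCoeff ρ s m lam := by
  obtain ⟨x, hx, hxlim⟩ := h.exists_tendsto_tail_one hα hs hνs
  obtain ⟨y, hy, hylim⟩ := h.exists_tendsto_tail_one hα hm hνm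
  obtain ⟨l, hl⟩ := h.exists_tendsto_jointTail hs hm hx hy
  refine ⟨l, (isUTDCoeff_iff hs hα m l).2 ?_⟩
  have hT : Tendsto (fun q : ℝ => (1 - q)⁻¹.toNNReal) (𝓝[<] 1) atTop := by
    have h1 : Tendsto (fun q : ℝ => 1 - q) (𝓝[<] 1) (𝓝[>] 0) := by
      refine tendsto_nhdsWithin_iff.2 ⟨?_, ?_⟩
      · have : Tendsto (fun q : ℝ => 1 - q) (𝓝 1) (𝓝 (1 - 1)) := tendsto_const_nhds.sub tendsto_id
        rw [sub_self] at this
        exact this.mono_left nhdsWithin_le_nhds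
      · filter_upwards [self_mem_nhdsWithin] with q hq
        exact sub_pos.2 (show q < 1 from hq)
    exact tendsto_real_toNNReal_atTop.comp (tendsto_inv_nhdsGT_zero.comp h1)
  refine (tendsto_iff_of_sub_tendsto_zero ?_).2 (hl.comp hT)
  have e1 := ((tendsto_tailFn_marginQuantile hs hα).sub (hxlim.comp hT)).abs
  have e2 := ((tendsto_tailFn_marginQuantile hm hα).sub (hylim.comp hT)).abs
  have e3 := e1.add e2
  simp only [sub_self, abs_zero, add_zero] at e3
  refine squeeze_zero_norm' ?_ e3
  filter_upwards [self_mem_nhdsWithin] with q hq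
  have hq1 : q < 1 := hq
  have hq' : 0 < 1 - q := sub_pos.2 hq1
  have hr : 0 < (1 - q)⁻¹ := inv_pos.2 hq'
  simp only [Function.comp_apply, Real.coe_toNNReal _ hr.le, div_eq_inv_mul, ← mul_sub,
    Real.norm_eq_abs, abs_mul, abs_of_pos hr, ← mul_add]
  exact mul_le_mul_of_nonneg_left (abs_jointTail_sub_le s m _ _ _ _) hr.le

end MultivariateRegularVariation

/-! ### The main theorem. -/

theorem corollary3p2 {Ω : Type*} [MeasurableSpace Ω] (μ : Measure Ω) [IsProbabilityMeasure μ]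
    {L : ℕ} (α : ℝ) (hα : 0 < α)
    -- the law of the weight vector, with regularly varying margins and multivariate regular variation
    (ρ : Measure (Fin L → ℝ≥0)) [IsProbabilityMeasure ρ]
    (b : ℝ≥0 → ℝ≥0) (ν : Measure (Fin L → ℝ≥0)) (hMRV : IsMRV ρ α b ν)
    (hmarg : ∀ l, IsRegularlyVarying (marginalTail ρ l) (-α))
    -- the i.i.d. weights
    (W : ℕ → Ω → Fin L → ℝ≥0) (hWmeas : ∀ i, Measurable (W i)) (hWind : iIndepFun W μ)
    (hWlaw : ∀ i, μ.map (W i) = ρ)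
    -- the random graphs
    (g : Fin L → ℝ≥0 → ℝ≥0) (hg : ∀ l, IsConnectionFun α (g l))
    (A : (N : ℕ) → Fin N → Fin N → Fin L → Ω → ℕ)
    (hA : ∀ N, IsMIRG μ g (fun i : Fin N => W i) (A N))
    -- the intermediate sequence
    (t : ℕ → ℕ) (ht : Tendsto t atTop atTop)
    (htN : Tendsto (fun N : ℕ => (t N : ℝ) / N) atTop (𝓝 0))
    -- two layers and their copula
    (s m : Fin L) (C : ℝ → ℝ → ℝ) (hC : IsPairCopula ρ s m C) :
    (∀ lam : ℝ,
      (IsUTDCoeff ρ s m lam ↔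
        Tendsto (fun q : ℝ => (1 - 2 * q + C q q) / (1 - q)) (𝓝[<] 1) (𝓝 lam)) ∧
      (IsUTDCoeff ρ s m lam →
        TendstoInMeasure μ
          (fun N ω => utdEstimator (fun i j l => A N i j l ω) (t N) s m) atTop (fun _ => lam))) ∧
    (ν {x | 1 < x s} ≠ 0 → ν {x | 1 < x m} ≠ 0 → ∃ lam : ℝ, IsUTDCoeff ρ s m lam) ∧
    (∀ θ : ℝ, 1 ≤ θ →
      (∀ u ∈ Set.Icc (0 : ℝ) 1, ∀ v ∈ Set.Icc (0 : ℝ) 1, C u v = gumbel θ u v) →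
      IsUTDCoeff ρ s m (2 - 2 ^ (1 / θ)) ∧
        TendstoInMeasure μ
          (fun N ω => utdEstimator (fun i j l => A N i j l ω) (t N) s m) atTop
          (fun _ => 2 - 2 ^ (1 / θ))) := by
  have hRV : ∀ l, HasRVTail (margin ρ l) α := fun l => hasRVTail_margin (hmarg l)
  have hiff := isUTDCoeff_iff_copula (hRV s) (hRV m) hα hC
  have hest : ∀ lam, IsUTDCoeff ρ s m lam → TendstoInMeasure μ
      (fun N ω => utdEstimator (fun i j l => A N i j l ω) (t N) s m) atTop (fun _ => lam) :=
    fun lam h => tendstoInMeasure_utdEstimator hα hmarg hWmeas hWind hWlaw hg hA ht htN h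
  refine ⟨fun lam => ⟨hiff lam, hest lam⟩,
    fun hνs hνm => hMRV.exists_isUTDCoeff hα (hRV s) (hRV m) hνs hνm, fun θ hθ hgum => ?_⟩
  have hlim : IsUTDCoeff ρ s m (2 - 2 ^ (1 / θ)) := by
    refine (hiff _).2 ((tendsto_gumbel hθ).congr' ?_)
    filter_upwards [self_mem_nhdsWithin,
      nhdsWithin_le_nhds (lt_mem_nhds (show (0 : ℝ) < 1 by norm_num))] with q hq hq0
    rw [hgum q ⟨hq0.le, le_of_lt hq⟩ q ⟨hq0.le, le_of_lt hq⟩]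
  exact ⟨hlim, hest _ hlim⟩
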